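/- **Setting.** Let $z_1\in\mathbb{CP}^1\setminus\{0,1,\infty\}$, $z_2=0$, $z_3=1$, $z_4=\infty$, $D=\sum_i z_i$, and let $E=\mathcal O(m_1)\oplus\mathcal O(m_2)$ with $m_1\ge m_2$ (by Birkhoff–Grothendieck, every rank 2 bundle on $\mathbb{CP}^1$ is isomorphic to such an $E$); $\deg E=m_1+m_2$, and $E_1=\mathcal O(m_1)\subset E$ if $m_1>m_2$. Let $\mathrm{QP}(E)=\prod_{i=1}^4\mathbb P(E|_{z_i})$ and let $\mathrm{QPH}(E)$ be the set of pairs $(F,\Phi)$ with $F=(F_1,\dots,F_4)\in\mathrm{QP}(E)$, $\Phi\in H^0(\mathrm{End}(E)\otimes K(D))$, $\mathrm{Res}_{z_i}\Phi$ nilpotent and $F_i\subset\ker\mathrm{Res}_{z_i}\Phi$ for all $i$. Put $\mathrm{par}(F,\Phi)=F$, $\iota(F)=(F,0)$, $\mathrm{QPH}_0(E)=\{\det\Phi=0\}$. The group $\mathbb P(\mathrm{Aut}(E))$ ($\mathrm{Aut}(E)$ modulo nonzero scalars) acts on $\mathrm{QPH}(E)$, and $\mathbb C^*$ acts by scaling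 $\Phi$. *Interpolation loci.* $\mathrm L_j(E)$ is the set of line sub-bundles of $E$ of degree $j$, and $\mathrm P_j(E)\to \mathrm L_j(E)$ is the principal $\mathbb C^*$-bundle of pairs $(s_1,s_2)$ of sections of $\mathcal O(m_1-j)$, $\mathcal O(m_2-j)$ without common zero. For $I\subset\{1,2,3,4\}$ and $j\le m_2$, $\mathrm B_{I,j}(E)$ is the set of $F$ for which there is $L\in \mathrm L_j(E)$ with $F_k=L|_{z_k}$ for all $k\in I$; if $m_1>m_2$, $\mathrm B_{I,m_1}(E)$ is the set of $F$ with $\{i: F_i=E_1|_{z_i}\}=I$. Let $\mathrm U(E)=\mathrm{QP}(E)\setminus\bigcup_{I\sqcup I'=\{1,2,3,4\}}(\mathrm B_{I,m_1}(E)\cap \mathrm B_{I',m_2}(E))$. Let $\mathrm U'(E)=\bigcap_{|I|=2}\mathrm B_{I,m}(E)^{c}\setminus \mathrm B_{\{1,2,3,4\},m-1}(E)$ if $m_1=m_2=m$, $\mathrm U'(E)=\mathrm B_{\emptyset,m_1}(E)\setminus\bigcup_{|I|\ge3}\mathrm B_{I,m_2}(E)$ if $m_1-m_2=1$, and $\mathrm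 U'(E)=\emptyset$ if $m_1-m_2\ge2$. *Strata.* A nonzero $\Phi$ with $(F,\Phi)\in\mathrm{QPH}_0(E)$ is nilpotent; $L(\Phi)\subset E$ denotes its kernel line sub-bundle. Let $\mathrm Q(E)=\iota(\mathrm{QP}(E))$; for $m_1>m_2$ let $\mathrm R(E)$ be the set of $(F,\Phi)\in\mathrm{QPH}_0(E)$ with $\Phi\ne0$, $L(\Phi)=E_1$; for $j\le m_2$ let $\mathrm S_j(E)$ be the set of those with $\Phi\neq 0$, $L(\Phi)\in \mathrm L_j(E)$. Let $\mathrm R_I(E)=\mathrm R(E)\cap\mathrm{par}^{-1}(\mathrm B_{I,m_1}(E))$, and let $\mathrm S_{I,j}(E)$ be the set of $(F,\Phi)\in\mathrm S_j(E)$ with $\{i : F_i=L(\Phi)|_{z_i}\}=I$. *Stability.* For $\beta\in[0,1]^4$ let $\beta_I=\sum_{i\in I}\beta_i-\sum_{i\notin I}\beta_i$. A point $(F,\Phi)$ is stable for $\beta\in(0,1)^4$ if $\beta_{I_L}<\deg E-2\deg L$ for each $\Phi$-invariant line sub-bundle $L\subset E$, where $I_L=\{i: L|_{z_i}= F_i\}$.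 Open chambers are the connected components of $(0,1)^4$ minus the walls $\{\beta_I=k\}$, $k\in\{|I|-1,|I|-2,|I|-3\}$, $k\equiv\deg E \pmod 2$. A chamber is interior if it lies in the polytope given, for $\deg E$ even, by $-2\le\beta_I\le0$ for all $|I|=1$, and, for $\deg E$ odd, by $-3\le\beta_\emptyset\le-1$ and $-1\le\beta_I\le1$ for all $|I|=2$. A point is stable for a chamber if it is stable for all $\beta$ in it. The superscript $cs$ denotes the subset of points that are stable for some open chamber. **Proposition.** (i) $\mathrm Q^{cs}(E)=\iota(\mathrm U(E))$ if $m_1-m_2\le2$, and $\mathrm Q^{cs}(E)=\emptyset$ if $m_1-m_2\ge3$. If $m_1>m_2$, then $\mathrm R^{cs}(E)=\bigsqcup_{|I|\le 3-m_1+m_2}\mathrm R_I(E)$. If $m_1=m_2=m$, then $\mathrm S_m^{cs}(E)=\bigsqcup_{|I|=2,3}\mathrm S_{I,m}(E)$. In all other cases with $j\le m_2$, $\mathrm S_j^{cs}(E)=\mathrm S_j(E)$. (ii) The set of points of $\mathrm Q^{cs}(E)$ that are stable for every interior chamber is $\iota(\mathrm U'(E))$. (iii) If $m_1>m_2$, $\mathbb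 P(\mathrm{Aut}(E))$ acts freely on $\mathrm R^{cs}(E)$. If $m_1=m_2=m$, then $\mathbb P(\mathrm{Aut}(E))$ acts freely on $\mathrm S_m^{cs}(E)$, and $\mathbb P(\mathrm{Aut}(E))\times\mathbb C^*$ acts freely and transitively on $\mathrm S_{m-1}^{cs}(E)$, which is nonempty. If $m_1-m_2\in\{1,2\}$, then $\mathbb P(\mathrm{Aut}(E))$ acts freely and transitively in the factor $\mathrm P_{m_2}(E)$ of $\mathrm S_{m_2}(E)$, in the following sense. For $s=(u,w)\in \mathrm P_{m_2}(E)$ ($w$ is a nonzero constant) let $\varphi(s)=\begin{pmatrix}u&-u^2/w\\ w&-u\end{pmatrix}$. - If $m_1-m_2=2$, the relation $\Phi=\varphi(s)$ defines a bijection $\mathrm S_{m_2}(E)\cong \mathrm P_{m_2}(E)$, $(F,\Phi)\mapsto s$, and under it $\mathbb P(\mathrm{Aut}(E))$ acts freely and transitively on $\mathrm P_{m_2}(E)$. - If $m_1-m_2=1$, let $\mathrm{Bl}$ be the nodal curve obtained from $\mathbb{CP}^1$ by attaching at each $z_i$ a projective line at its point $[0:1]$, i.e. the set of $(z,\xi)\in\mathbb{CP}^1\times(\mathbb{CP}^1)^4$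 with $\xi_i=[0:1]$ whenever $z\ne z_i$. For any choice, for each $z\in\mathbb{CP}^1$, of a nonzero vector in the line $z\subset\mathbb C^2$, with $\sigma_z$ the resulting linear form vanishing at $z$, there is a bijection $\mathrm S_{m_2}(E)\cong\mathrm{Bl}\times \mathrm P_{m_2}(E)$, $(F,\Phi)\mapsto((z,\xi),(u,w))$, such that $\Phi=\sigma_z\,\varphi(u,w)$ and $\xi_i=[\,w f_0-u(z_i)f_1: f_1]$ for $F_i=[f_0:f_1]$. Under it, $\mathbb P(\mathrm{Aut}(E))$ acts trivially on $\mathrm{Bl}$ and through a free and transitive action on $\mathrm P_{m_2}(E)$. Here $E|_{z_i}$ is identified with $\mathbb C^2$, and $K(D)$ with $\mathcal O(2)$, through the homogeneous coordinates $(z_1,1),(0,1),(1,1),(1,0)$ of the marked points. -/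

import Mathlib

open scoped LinearAlgebra.Projectivization

noncomputable section

namespace QPHiggs

/-! ### The projective line, its four marked points, the bundle `E` -/

/-- Homogeneous coordinate ring `ℂ[X₀, X₁]` of `ℂℙ¹`; the point `[a : b]` has affine
coordinate `a / b`. -/
abbrev Poly : Type := MvPolynomial (Fin 2) ℂ

/-- The projective line. It serves as the base curve `ℂℙ¹` and as the model of each `ℙ(E|_{z_i})`. -/
abbrev P1 : Type := ℙ ℂ (Fin 2 → ℂ)

/-- `H⁰(ℂℙ¹, 𝒪(n))`: binary forms of degree `n`; it is zero for `n < 0`. -/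
def forms (n : ℤ) : Submodule ℂ Poly :=
  MvPolynomial.weightedHomogeneousSubmodule ℂ (fun _ : Fin 2 => (1 : ℤ)) n

/-- Homogeneous coordinates of the marked points `z₁ = lam, z₂ = 0, z₃ = 1, z₄ = ∞`,
indexed by `0, 1, 2, 3`. The vector `marked lam i` also trivializes the fibre of `𝒪(1)` at `z_i`, and
so identifies the fibre `E|_{z_i}` with `ℂ²`. -/
def marked (lam : ℂ) : Fin 4 → Fin 2 → ℂ := ![![lam, 1], ![0, 1], ![1, 1], ![1, 0]]

/-- The determinant of two vectors of `ℂ²`. -/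
def wedge (v w : Fin 2 → ℂ) : ℂ := v 0 * w 1 - v 1 * w 0

/-- Global endomorphisms of `E = 𝒪(m 0) ⊕ 𝒪(m 1)`: matrices whose `(a, b)` entry is a section of
`𝒪(m a - m b)`. -/
def endAlg (m : Fin 2 → ℤ) : Subalgebra ℂ (Matrix (Fin 2) (Fin 2) Poly) where
  carrier := {A | ∀ a b, A a b ∈ forms (m a - m b)}
  mul_mem' := by
    intro A B hA hB a b
    rw [Matrix.mul_apply]
    refine Submodule.sum_mem _ fun c _ => ?_
    have h := MvPolynomial.IsWeightedHomogeneous.mul (hA a c) (hB c b)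
    have e : m a - m c + (m c - m b) = m a - m b := by ring
    rw [e] at h
    exact h
  add_mem' := by
    intro A B hA hB a b
    exact Submodule.add_mem _ (hA a b) (hB a b)
  algebraMap_mem' := by
    intro r a b
    rw [Matrix.algebraMap_matrix_apply]
    split_ifs with h
    · subst h
      rw [sub_self]
      exact MvPolynomial.isWeightedHomogeneous_C _ r
    · exact Submodule.zero_mem _

/-- The group `Aut(E)`. -/
abbrev AutE (m : Fin 2 → ℤ) : Type := (endAlg m)ˣ

/-- The nonzero multiples of the identity, that is, the centre of `Aut(E)`. -/
def scalars (m : Fin 2 → ℤ) : Subgroup (AutE m) :=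
  (Units.map (algebraMap ℂ (endAlg m) : ℂ →* endAlg m)).range

instance scalars_normal (m : Fin 2 → ℤ) : (scalars m).Normal where
  conj_mem := by
    rintro _ ⟨c, rfl⟩ g
    refine ⟨c, ?_⟩
    have h : Commute g (Units.map (algebraMap ℂ (endAlg m) : ℂ →* endAlg m) c) := by
      refine Units.ext ?_
      exact (Algebra.commutes (c : ℂ) (g : endAlg m)).symm
    rw [h.eq, mul_inv_cancel_right]

/-- The group `ℙ(Aut(E))`. -/
abbrev PAut (m : Fin 2 → ℤ) : Type := AutE m ⧸ scalars m

/-- Evaluation of an automorphism of `E` on the fibre over the point represented by `v`. -/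
def fibreHom (m : Fin 2 → ℤ) (v : Fin 2 → ℂ) :
    AutE m →* LinearMap.GeneralLinearGroup ℂ (Fin 2 → ℂ) :=
  Units.map ((((Matrix.toLinAlgEquiv' : Matrix (Fin 2) (Fin 2) ℂ ≃ₐ[ℂ] _).toRingEquiv.toRingHom.comp
    ((MvPolynomial.eval v : Poly →+* ℂ).mapMatrix.comp (endAlg m).val.toRingHom)) :
      endAlg m →+* Module.End ℂ (Fin 2 → ℂ)) : endAlg m →* Module.End ℂ (Fin 2 → ℂ))

/-! ### Flags, Higgs fields and group actions -/

/-- `QP(E) = ∏ᵢ ℙ(E|_{z_i})`. -/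
abbrev QP : Type := Fin 4 → P1

/-- A quadruple of flags `F_i ⊂ E|_{z_i}` and a matrix of forms. It is a point of `QPH(E)` if it
lies in the set `QPH lam m` below. -/
@[ext]
structure HiggsPair (lam : ℂ) (m : Fin 2 → ℤ) where
  flag : QP
  field : Matrix (Fin 2) (Fin 2) Poly

/-- `Aut(E)` acts on flags by evaluation and on Higgs fields by conjugation. -/
instance autAction (lam : ℂ) (m : Fin 2 → ℤ) : MulAction (AutE m) (HiggsPair lam m) where
  smul g x := ⟨fun i => fibreHom m (marked lam i) g • x.flag i,
    ((g : endAlg m) : Matrix (Fin 2) (Fin 2) Poly) * x.field *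
      (((g⁻¹ : AutE m) : endAlg m) : Matrix (Fin 2) (Fin 2) Poly)⟩
  one_smul x := by
    refine HiggsPair.ext ?_ ?_
    · funext i
      change fibreHom m (marked lam i) 1 • x.flag i = x.flag i
      rw [map_one, one_smul]
    · change (((1 : AutE m) : endAlg m) : Matrix (Fin 2) (Fin 2) Poly) * x.field *
        (((1⁻¹ : AutE m) : endAlg m) : Matrix (Fin 2) (Fin 2) Poly) = x.field
      simp
  mul_smul g h x := by
    refine HiggsPair.ext ?_ ?_
    · funext i
      change fibreHom m (marked lam i) (g * h) • x.flag i =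
        fibreHom m (marked lam i) g • fibreHom m (marked lam i) h • x.flag i
      rw [map_mul, mul_smul]
    · change (((g * h : AutE m) : endAlg m) : Matrix (Fin 2) (Fin 2) Poly) * x.field *
        ((((g * h)⁻¹ : AutE m) : endAlg m) : Matrix (Fin 2) (Fin 2) Poly) =
        ((g : endAlg m) : Matrix (Fin 2) (Fin 2) Poly) *
          (((h : endAlg m) : Matrix (Fin 2) (Fin 2) Poly) * x.field *
          (((h⁻¹ : AutE m) : endAlg m) : Matrix (Fin 2) (Fin 2) Poly)) *
          (((g⁻¹ : AutE m) : endAlg m) : Matrix (Fin 2) (Fin 2) Poly)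
      rw [mul_inv_rev, Units.val_mul, Units.val_mul]
      simp only [MulMemClass.coe_mul, mul_assoc]

theorem scalars_smul (lam : ℂ) (m : Fin 2 → ℤ) (g : AutE m) (hg : g ∈ scalars m)
    (x : HiggsPair lam m) : g • x = x := by
  obtain ⟨c, rfl⟩ := hg
  refine HiggsPair.ext ?_ ?_
  · funext i
    change fibreHom m (marked lam i) (Units.map (algebraMap ℂ (endAlg m) : ℂ →* endAlg m) c) •
      x.flag i = x.flag i
    have key : ∀ v : Fin 2 → ℂ,
        fibreHom m (marked lam i) (Units.map (algebraMap ℂ (endAlg m) : ℂ →* endAlg m) c) • v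
          = (c : ℂ) • v := by
      intro v
      change ((algebraMap ℂ (Matrix (Fin 2) (Fin 2) Poly) (c : ℂ)).map
        (MvPolynomial.eval (marked lam i))).mulVec v = (c : ℂ) • v
      have e : (algebraMap ℂ (Matrix (Fin 2) (Fin 2) Poly) (c : ℂ)).map
          (MvPolynomial.eval (marked lam i)) = (c : ℂ) • (1 : Matrix (Fin 2) (Fin 2) ℂ) := by
        ext a b
        rw [Matrix.map_apply, Matrix.algebraMap_matrix_apply, Matrix.smul_apply, Matrix.one_apply]
        split_ifs <;> simp [MvPolynomial.algebraMap_eq]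
      rw [e, Matrix.smul_mulVec, Matrix.one_mulVec]
    generalize x.flag i = F
    obtain ⟨v, hv, rfl⟩ : ∃ v : Fin 2 → ℂ, ∃ hv : v ≠ 0, Projectivization.mk ℂ v hv = F :=
      ⟨F.rep, F.rep_nonzero, F.mk_rep⟩
    rw [Projectivization.smul_mk, Projectivization.mk_eq_mk_iff']
    exact ⟨c, (key v).symm⟩
  · change (algebraMap ℂ (Matrix (Fin 2) (Fin 2) Poly) (c : ℂ)) * x.field *
      (algebraMap ℂ (Matrix (Fin 2) (Fin 2) Poly) ((c⁻¹ : ℂˣ) : ℂ)) = x.field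
    rw [Algebra.commutes, mul_assoc, ← map_mul, Units.mul_inv, map_one, mul_one]

/-- The induced action of `ℙ(Aut(E))`: the class of `g` sends `x` to `g • x`. -/
instance pautAction (lam : ℂ) (m : Fin 2 → ℤ) : MulAction (PAut m) (HiggsPair lam m) :=
  MulAction.compHom (HiggsPair lam m)
    (QuotientGroup.lift (scalars m) (MulAction.toPermHom (AutE m) (HiggsPair lam m))
      (fun g hg => Equiv.ext fun x => scalars_smul lam m g hg x))

/-- The action `c • (F, Φ) = (F, c Φ)` of `ℂ^*`. -/
instance scaleAction (lam : ℂ) (m : Fin 2 → ℤ) : MulAction ℂˣ (HiggsPair lam m) where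
  smul c x := ⟨x.flag, (c : ℂ) • x.field⟩
  one_smul x := HiggsPair.ext rfl (one_smul ℂ x.field)
  mul_smul c c' x := HiggsPair.ext rfl (mul_smul (c : ℂ) (c' : ℂ) x.field)

/-- The two actions commute, so that their product acts: `(g, c) • x = g • c • x`. -/
instance prodAction (lam : ℂ) (m : Fin 2 → ℤ) : MulAction (PAut m × ℂˣ) (HiggsPair lam m) where
  smul gc x := gc.1 • gc.2 • x
  one_smul x := by
    change (1 : PAut m) • (1 : ℂˣ) • x = x
    rw [one_smul, one_smul]
  mul_smul := by
    rintro ⟨g, c⟩ ⟨h, d⟩ x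
    change (g * h) • (c * d) • x = g • c • h • d • x
    have comm : ∀ y : HiggsPair lam m, h • c • y = c • h • y := by
      intro y
      induction h using QuotientGroup.induction_on with
      | H h =>
        refine HiggsPair.ext rfl ?_
        change ((h : endAlg m) : Matrix (Fin 2) (Fin 2) Poly) * ((c : ℂ) • y.field) *
          (((h⁻¹ : AutE m) : endAlg m) : Matrix (Fin 2) (Fin 2) Poly) =
          (c : ℂ) • (((h : endAlg m) : Matrix (Fin 2) (Fin 2) Poly) * y.field *
          (((h⁻¹ : AutE m) : endAlg m) : Matrix (Fin 2) (Fin 2) Poly))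
        rw [Matrix.mul_smul, Matrix.smul_mul]
    rw [mul_smul, mul_smul, comm]

/-- `G` acts on the subset `S`, freely. -/
def ActsFreelyOn (G : Type*) [Group G] {X : Type*} [MulAction G X] (S : Set X) : Prop :=
  (∀ g : G, ∀ x ∈ S, g • x ∈ S) ∧ ∀ x ∈ S, ∀ g : G, g • x = x → g = 1

/-- `G` acts on the nonempty subset `S`, freely and transitively. -/
def ActsFreelyTransitivelyOn (G : Type*) [Group G] {X : Type*} [MulAction G X] (S : Set X) : Prop :=
  S.Nonempty ∧ (∀ g : G, ∀ x ∈ S, g • x ∈ S) ∧ ∀ x ∈ S, ∀ y ∈ S, ∃! g : G, g • x = y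

/-! ### Quasi-parabolic Higgs bundles -/

/-- Residue at `z_i` of `Φ ∈ H⁰(End(E) ⊗ K(D))`, acting on `E|_{z_i}`. Sections of `K(D)` are
written `q Ω / ∏ⱼ ℓⱼ` with `q` a quadratic form, `Ω = X₀ dX₁ - X₁ dX₀` and
`ℓⱼ = wedge (marked lam j) X`; so `Φ` is a matrix whose `(a, b)` entry is a section of
`𝒪(m a - m b + 2)`. -/
def residue (lam : ℂ) (Φ : Matrix (Fin 2) (Fin 2) Poly) (i : Fin 4) : Matrix (Fin 2) (Fin 2) ℂ :=
  (∏ j ∈ Finset.univ.erase i, wedge (marked lam j) (marked lam i))⁻¹ •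
    Φ.map (MvPolynomial.eval (marked lam i))

/-- `QPH(E)`: the Higgs field has nilpotent residues, whose kernels contain the flags. -/
def QPH (lam : ℂ) (m : Fin 2 → ℤ) : Set (HiggsPair lam m) :=
  {x | (∀ a b, x.field a b ∈ forms (m a - m b + 2)) ∧
    ∀ i, IsNilpotent (residue lam x.field i) ∧
      ∀ v ∈ (x.flag i).submodule, (residue lam x.field i).mulVec v = 0}

/-- The nilpotent locus `QPH₀(E)`. -/
def QPHnil (lam : ℂ) (m : Fin 2 → ℤ) : Set (HiggsPair lam m) :=
  {x ∈ QPH lam m | x.field.det = 0}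

/-- The embedding `ι : QP(E) → QPH₀(E)` by the zero Higgs field. -/
def iota (lam : ℂ) (m : Fin 2 → ℤ) (F : QP) : HiggsPair lam m := ⟨F, 0⟩

/-! ### Line sub-bundles and interpolation loci -/

/-- `P_j(E)`, the principal `ℂ^*`-bundle over the space `L_j(E)` of line sub-bundles of degree `j`:
pairs of sections of `𝒪(m 0 - j)` and `𝒪(m 1 - j)` without common zero, i.e. nowhere vanishing maps
`𝒪(j) → E`. A pair `s` generates the line sub-bundle with fibres `L|_z = ℂ s(z)`, and two pairs
generate the same one iff they differ by a nonzero constant. -/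
def lineGen (m : Fin 2 → ℤ) (j : ℤ) : Set (Fin 2 → Poly) :=
  {s | (∀ a, s a ∈ forms (m a - j)) ∧
    ∀ v : Fin 2 → ℂ, v ≠ 0 → ∃ a, MvPolynomial.eval v (s a) ≠ 0}

/-- For the line sub-bundle `L` generated by `s`: `L|_{z_i} = F_i`. -/
def Meets (lam : ℂ) (F : QP) (s : Fin 2 → Poly) (i : Fin 4) : Prop :=
  (fun a => MvPolynomial.eval (marked lam i) (s a)) ∈ (F i).submodule

/-- The interpolation locus `B_{I,j}(E)`: for `j ≤ m 1` the flags over `I` are those of some line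
sub-bundle of degree `j`; for `j = m 0 > m 1`, where the only line sub-bundle of degree `j` is
`E₁ = 𝒪(m 0)`, the set of `i` with `F_i = E₁|_{z_i}` is exactly `I`. -/
def B (lam : ℂ) (m : Fin 2 → ℤ) (I : Finset (Fin 4)) (j : ℤ) : Set QP :=
  if j ≤ m 1 then {F | ∃ s ∈ lineGen m j, ∀ i ∈ I, Meets lam F s i}
  else {F | ∃ s ∈ lineGen m j, ∀ i, i ∈ I ↔ Meets lam F s i}

/-- The locus `U(E)`. -/
def U (lam : ℂ) (m : Fin 2 → ℤ) : Set QP :=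
  (⋃ I : Finset (Fin 4), B lam m I (m 0) ∩ B lam m Iᶜ (m 1))ᶜ

/-- The locus `U'(E)`; it is empty unless `m 0 - m 1 ≤ 1`. -/
def U' (lam : ℂ) (m : Fin 2 → ℤ) : Set QP :=
  if m 0 = m 1 then
    (⋂ I ∈ {I : Finset (Fin 4) | I.card = 2}, (B lam m I (m 1))ᶜ) \ B lam m Finset.univ (m 1 - 1)
  else if m 0 = m 1 + 1 then
    B lam m ∅ (m 0) \ ⋃ I ∈ {I : Finset (Fin 4) | 3 ≤ I.card}, B lam m I (m 1)
  else ∅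

/-! ### The strata of the nilpotent locus -/

/-- `Q(E)`. -/
def Q (lam : ℂ) (m : Fin 2 → ℤ) : Set (HiggsPair lam m) := Set.range (iota lam m)

/-- `R(E)`: nonzero nilpotent Higgs fields whose kernel is `E₁ = 𝒪(m 0)` (used for `m 1 < m 0`). -/
def R (lam : ℂ) (m : Fin 2 → ℤ) : Set (HiggsPair lam m) :=
  {x ∈ QPHnil lam m | x.field ≠ 0 ∧ x.field.mulVec ![1, 0] = 0}

/-- `S_j(E)`: nonzero nilpotent Higgs fields whose kernel `L(Φ)` has degree `j` (for `j ≤ m 1`). -/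
def S (lam : ℂ) (m : Fin 2 → ℤ) (j : ℤ) : Set (HiggsPair lam m) :=
  {x ∈ QPHnil lam m | x.field ≠ 0 ∧ ∃ s ∈ lineGen m j, x.field.mulVec s = 0}

/-- `R_I(E)`. -/
def RI (lam : ℂ) (m : Fin 2 → ℤ) (I : Finset (Fin 4)) : Set (HiggsPair lam m) :=
  {x ∈ R lam m | x.flag ∈ B lam m I (m 0)}

/-- `S_{I,j}(E)`: points of `S_j(E)` for which `I` is the set of `i` with `F_i = L(Φ)|_{z_i}`. -/
def SI (lam : ℂ) (m : Fin 2 → ℤ) (I : Finset (Fin 4)) (j : ℤ) : Set (HiggsPair lam m) :=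
  {x ∈ S lam m j | ∃ s ∈ lineGen m j, x.field.mulVec s = 0 ∧ ∀ i, i ∈ I ↔ Meets lam x.flag s i}

/-! ### Weights, chambers and stability -/

/-- `β_I`. -/
def weightSum (β : Fin 4 → ℝ) (I : Finset (Fin 4)) : ℝ := ∑ i ∈ I, β i - ∑ i ∈ Iᶜ, β i

/-- The union of the semi-stability walls `β_I = k`, `k ∈ {|I| - 1, |I| - 2, |I| - 3}`, in
`[0,1]⁴` with `k` of the parity of `d`. -/
def walls (d : ℤ) : Set (Fin 4 → ℝ) :=
  {β | (∀ i, β i ∈ Set.Icc (0 : ℝ) 1) ∧ ∃ (I : Finset (Fin 4)) (k : ℤ),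
    (k = I.card - 1 ∨ k = I.card - 2 ∨ k = I.card - 3) ∧ Even (k - d) ∧ weightSum β I = k}

/-- Open chambers of the parity of `d`: the connected components of `(0,1)⁴` minus the walls. -/
def IsChamber (d : ℤ) (C : Set (Fin 4 → ℝ)) : Prop :=
  ∃ β ∈ {β : Fin 4 → ℝ | ∀ i, β i ∈ Set.Ioo (0 : ℝ) 1} \ walls d,
    C = connectedComponentIn ({β : Fin 4 → ℝ | ∀ i, β i ∈ Set.Ioo (0 : ℝ) 1} \ walls d) β

/-- The polytope `𝓑₀` (for `d` even) or `𝓑₁` (for `d` odd), given by interval bounds. -/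
def polytope (d : ℤ) : Set (Fin 4 → ℝ) :=
  {β | (∀ i, β i ∈ Set.Icc (0 : ℝ) 1) ∧
    (Even d → ∀ I : Finset (Fin 4), I.card = 1 → weightSum β I ∈ Set.Icc (-2 : ℝ) 0) ∧
    (Odd d → weightSum β ∅ ∈ Set.Icc (-3 : ℝ) (-1) ∧
      ∀ I : Finset (Fin 4), I.card = 2 → weightSum β I ∈ Set.Icc (-1 : ℝ) 1)}

/-- Interior open chambers: those inside the polytope. -/
def IsInteriorChamber (d : ℤ) (C : Set (Fin 4 → ℝ)) : Prop := IsChamber d C ∧ C ⊆ polytope d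

open Classical in
/-- Stability with weights `β`: every `Φ`-invariant line sub-bundle `L` of degree `j`, generated by
`s`, satisfies `β_{I_L} < deg(E) - 2 j`, where `I_L` is the set of `i` with `L|_{z_i} ⊂ F_i`.
Invariance means `Φ s = t s` for some section `t` of `K(D) ≅ 𝒪(2)`. -/
def Stable {lam : ℂ} {m : Fin 2 → ℤ} (β : Fin 4 → ℝ) (x : HiggsPair lam m) : Prop :=
  ∀ (j : ℤ), ∀ s ∈ lineGen m j, (∃ t ∈ forms 2, x.field.mulVec s = t • s) →
    weightSum β {i | Meets lam x.flag s i} < ((m 0 + m 1 - 2 * j : ℤ) : ℝ)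

/-- Stability with respect to an open chamber. -/
def StableOn {lam : ℂ} {m : Fin 2 → ℤ} (C : Set (Fin 4 → ℝ)) (x : HiggsPair lam m) : Prop :=
  ∀ β ∈ C, Stable β x

/-- The conditionally stable points of a subset of `QPH(E)`: those that are stable for some open
chamber of the parity of `deg(E)`. -/
def condStable {lam : ℂ} {m : Fin 2 → ℤ} (T : Set (HiggsPair lam m)) : Set (HiggsPair lam m) :=
  {x ∈ T | ∃ C, IsChamber (m 0 + m 1) C ∧ StableOn C x}

/-! ### The product decomposition of `S_{m₂}(E)` for `m₁ - m₂ = 1, 2` -/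

/-- For `s = (u, w) ∈ P_{m₂}(E)` with `m₂ < m₁`, `w` is a nonzero constant, and this is the
nilpotent matrix `[u, -u²/w; w, -u]`, whose kernel is the line sub-bundle generated by `s`. -/
def stdNilp (s : Fin 2 → Poly) : Matrix (Fin 2) (Fin 2) Poly :=
  !![s 0, -(MvPolynomial.C (MvPolynomial.constantCoeff (s 1))⁻¹ * s 0 ^ 2); s 1, -(s 0)]

/-- The linear form `X ↦ wedge q X`, vanishing at the point `[q]`. -/
def linForm (q : Fin 2 → ℂ) : Poly :=
  MvPolynomial.C (q 0) * MvPolynomial.X 1 - MvPolynomial.C (q 1) * MvPolynomial.X 0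

/-- The point `[0 : 1]`. -/
def node : P1 := Projectivization.mk ℂ ![0, 1] (fun h => by simpa using congrFun h 1)

/-- The nodal curve `Bl_{1,2,3,4}(ℂℙ¹)`, i.e. `ℂℙ¹` with a further projective line attached at each
`z_i` at its point `[0 : 1]`: pairs `(z, ξ)` such that `ξ i = [0 : 1]` unless `z = z_i`. -/
def Bl (lam : ℂ) : Set (P1 × (Fin 4 → P1)) :=
  {b | ∀ i, marked lam i ∉ b.1.submodule → b.2 i = node}

/-- Under the bijection `e` of `T` with `Base × P_j(E)`, the group `ℙ(Aut(E))` acts on the second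
factor only, and freely and transitively there. -/
def ActsOnFactor {lam : ℂ} {m : Fin 2 → ℤ} {T : Set (HiggsPair lam m)} {j : ℤ} {Base : Type*}
    (e : T ≃ Base × lineGen m j) : Prop :=
  (∀ g : PAut m, ∀ x ∈ T, g • x ∈ T) ∧
  ∃ ρ : PAut m →* Equiv.Perm (lineGen m j),
    (∀ p p', ∃! g, ρ g p = p') ∧
    ∀ (g : PAut m) (x y : T), (y : HiggsPair lam m) = g • (x : HiggsPair lam m) →
      e y = ((e x).1, ρ g (e x).2)

end QPHiggs

end

noncomputable section

namespace QPHiggs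

open MvPolynomial

/-! ### Binary forms -/

/-! Nonzero nilpotent fields. The trace of $\Phi$ is a quadratic form vanishing at the four marked
points, hence zero; together with $\det\Phi=0$ this gives $\Phi^2=0$. If $s$ generates the kernel,
of degree $j$, coprimality of its components gives $\Phi v=-q\,(s\wedge v)\,s$ for a form $q\neq0$
of degree $2+2j-\deg E$ (`exists_eq_nilMat`). The parabolic condition then says that at each $z_i$
either $q$ vanishes or $F_i$ lies on the kernel (`nilMat_mem_QPHnil_iff`). The kernel is the only
invariant line sub-bundle, so stability is the single inequality $\beta_I<\deg E-2j$, with $I$ the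
set of flags on the kernel. Over the open cube the infimum of $\beta_I$ is $|I|-4$ and is not
attained, so a stabilizing chamber exists iff $|I|\le\deg E-2j+3$
(`mem_condStable_iff_of_nilpotent`). The claims of (i) on $R$ and $S_j$ compare this bound with the
number of zeros available to $q$.

Zero field. Every line sub-bundle is now a test. Sub-bundles of degrees $m_1$ and $m_2$ through
complementary sets of flags impose contradictory inequalities (`mem_U_of_stable`). Off these loci,
interpolation by binary forms bounds the number of flags on each sub-bundle, and explicit rational
weights satisfy the remaining inequalities (`exists_stable_of_lt`, `exists_stable_of_eq`).
Thresholds have the parity of $\deg E$ and are never attained off the walls, so one weight decides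
for its whole chamber. For (ii), the polytope supplies exactly the bounds on $\beta_I$ not implied
by $\beta_I<|I|$, and a few test weights inside it show that each condition in $U'$ is necessary.

Actions. On $R$ a stabilizing automorphism is upper triangular; commuting with $\Phi$ equates its
diagonal entries, and the flags off $E_1$ are more numerous than the degree of its corner entry,
which therefore vanishes. On a balanced bundle automorphisms are constant matrices, and two
independent eigenvectors with one eigenvalue make them scalar. For $m_1-m_2\in\{1,2\}$ every kernel
of degree $m_2$ is a graph $(u,w)$, and upper triangular matrices act simply transitively on such
pairs. The scale $q$ has degree $2-(m_1-m_2)$. If it is constant, it is absorbed into the pair and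
all flags are forced. If it is linear, its zero $z$ is a further parameter, and the flag at $z_i$ is
free exactly when $z=z_i$: this is the nodal curve. -/

theorem degree_of_mem_forms {n : ℤ} {p : Poly} (hp : p ∈ forms n) {d : Fin 2 →₀ ℕ}
    (hd : p.coeff d ≠ 0) : (d 0 : ℤ) + d 1 = n := by
  have h := hp hd
  rw [Finsupp.weight_apply, Finsupp.sum_fintype _ _ (by simp)] at h
  simpa using h

theorem forms_of_neg {n : ℤ} (hn : n < 0) {p : Poly} (hp : p ∈ forms n) : p = 0 := by
  ext d
  by_contra h
  have := degree_of_mem_forms hp h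
  omega

theorem C_mem_forms (c : ℂ) : (C c : Poly) ∈ forms 0 := isWeightedHomogeneous_C _ c

theorem forms_zero_eq_C {p : Poly} (hp : p ∈ forms 0) : p = C (constantCoeff p) := by
  ext d
  rw [coeff_C]
  split_ifs with h
  · rw [← h]; rfl
  · by_contra h'
    have := degree_of_mem_forms hp h'
    apply h
    ext i
    fin_cases i <;> simp <;> omega

theorem mul_mem_forms {a b : ℤ} {p q : Poly} (hp : p ∈ forms a) (hq : q ∈ forms b) :
    p * q ∈ forms (a + b) := IsWeightedHomogeneous.mul hp hq

theorem pow_mem_forms {a : ℤ} {p : Poly} (hp : p ∈ forms a) (k : ℕ) :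
    p ^ k ∈ forms (k * a) := by
  have := IsWeightedHomogeneous.pow hp k
  rwa [nsmul_eq_mul] at this

theorem forms_inj {a b : ℤ} {p : Poly} (h0 : p ≠ 0) (ha : p ∈ forms a) (hb : p ∈ forms b) :
    a = b := IsWeightedHomogeneous.inj_right h0 ha hb

/-- In degree $a+b$ only the degree $b$ component of `q` contributes to the product, so `p * q`
equals `p` times that component and `p` can be cancelled. -/
theorem mem_forms_of_mul {a b : ℤ} {p q : Poly} (h0 : p ≠ 0) (hp : p ∈ forms a)
    (hpq : p * q ∈ forms (a + b)) : q ∈ forms b := by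
  set w : Fin 2 → ℤ := fun _ => 1
  have key : p * q = p * weightedHomogeneousComponent w b q := by
    have hq := finsum_weightedHomogeneousComponent w q
    have hfin := weightedHomogeneousComponent_finsupp (w := w) q
    rw [finsum_eq_sum _ hfin] at hq
    have h2 : ∀ n, weightedHomogeneousComponent w (a + b)
        (p * weightedHomogeneousComponent w n q) =
        if n = b then p * weightedHomogeneousComponent w b q else 0 := by
      intro n
      have hm : p * weightedHomogeneousComponent w n q ∈ forms (a + n) :=
        mul_mem_forms hp (weightedHomogeneousComponent_isWeightedHomogeneous n q)
      split_ifs with h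
      · subst h
        exact IsWeightedHomogeneous.weightedHomogeneousComponent_same hm
      · exact IsWeightedHomogeneous.weightedHomogeneousComponent_ne (a + b) hm (by omega)
    calc p * q = weightedHomogeneousComponent w (a + b) (p * q) :=
          (IsWeightedHomogeneous.weightedHomogeneousComponent_same hpq).symm
      _ = weightedHomogeneousComponent w (a + b)
          (p * ∑ n ∈ hfin.toFinset, weightedHomogeneousComponent w n q) := by rw [hq]
      _ = ∑ n ∈ hfin.toFinset,
          if n = b then p * weightedHomogeneousComponent w b q else 0 := by
        rw [Finset.mul_sum, map_sum]
        exact Finset.sum_congr rfl fun n _ => h2 n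
      _ = p * weightedHomogeneousComponent w b q := by
        rw [Finset.sum_ite_eq']
        split_ifs with h
        · rfl
        · have h' : weightedHomogeneousComponent w b q = 0 := by
            by_contra h'
            exact h ((Set.Finite.mem_toFinset hfin).2 h')
          rw [h', mul_zero]
  rw [mul_left_cancel₀ h0 key]
  exact weightedHomogeneousComponent_isWeightedHomogeneous b q

theorem eval_smul_eq_zero {n : ℤ} {p : Poly} (hp : p ∈ forms n) {v : Fin 2 → ℂ}
    (hv : eval v p = 0) (c : ℂ) : eval (c • v) p = 0 := by
  rcases lt_or_ge n 0 with hn | hn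
  · rw [forms_of_neg hn hp, map_zero]
  have h : eval (c • v) p = c ^ n.toNat * eval v p := by
    rw [eval_eq', eval_eq', Finset.mul_sum]
    refine Finset.sum_congr rfl fun d hd => ?_
    have := degree_of_mem_forms hp (mem_support_iff.1 hd)
    have e : n.toNat = d 0 + d 1 := by omega
    simp only [Fin.prod_univ_two, Pi.smul_apply, smul_eq_mul, e]
    ring
  rw [h, hv, mul_zero]

/-! ### Vectors of `ℂ²` and points of the projective line -/

theorem wedge_self (v : Fin 2 → ℂ) : wedge v v = 0 := by simp only [wedge]; ring

theorem wedge_comm (v w : Fin 2 → ℂ) : wedge v w = -wedge w v := by simp only [wedge]; ring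

theorem exists_smul_of_wedge {v w : Fin 2 → ℂ} (hw : w ≠ 0) (h : wedge v w = 0) :
    ∃ c : ℂ, v = c • w := by
  simp only [wedge] at h
  by_cases h0 : w 0 = 0
  · have h1 : w 1 ≠ 0 := fun h1 => hw (by ext i; fin_cases i <;> simp [h0, h1])
    refine ⟨v 1 / w 1, ?_⟩
    have : v 0 = 0 := by
      rw [h0, mul_zero, sub_zero] at h
      exact (mul_eq_zero.1 h).resolve_right h1
    ext i; fin_cases i
    · simp [h0, this]
    · simp [h1]
  · refine ⟨v 0 / w 0, ?_⟩
    ext i; fin_cases i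
    · simp [h0]
    · simp only [Fin.mk_one, Pi.smul_apply, smul_eq_mul]
      field_simp
      linear_combination -h

theorem wedge_smul_left (c : ℂ) (v w : Fin 2 → ℂ) : wedge (c • v) w = c * wedge v w := by
  simp only [wedge, Pi.smul_apply, smul_eq_mul]; ring

theorem wedge_smul_right (c : ℂ) (v w : Fin 2 → ℂ) : wedge v (c • w) = c * wedge v w := by
  simp only [wedge, Pi.smul_apply, smul_eq_mul]; ring

theorem mem_submodule_iff {F : P1} {w : Fin 2 → ℂ} (hw : w ∈ F.submodule) (hw0 : w ≠ 0)
    (v : Fin 2 → ℂ) : v ∈ F.submodule ↔ wedge v w = 0 := by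
  rw [Projectivization.submodule_eq, Submodule.mem_span_singleton] at *
  obtain ⟨c, rfl⟩ := hw
  have hc : c ≠ 0 := fun h => hw0 (by rw [h, zero_smul])
  constructor
  · rintro ⟨d, rfl⟩
    rw [wedge_smul_left, wedge_smul_right, wedge_self, mul_zero, mul_zero]
  · intro h
    rw [wedge_smul_right, mul_eq_zero] at h
    obtain ⟨d, hd⟩ := exists_smul_of_wedge F.rep_nonzero (h.resolve_left hc)
    exact ⟨d, hd.symm⟩

theorem rep_mem (F : P1) : F.rep ∈ F.submodule := by
  rw [Projectivization.submodule_eq]; exact Submodule.mem_span_singleton_self _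

theorem mem_mk_iff {w : Fin 2 → ℂ} (hw : w ≠ 0) (v : Fin 2 → ℂ) :
    v ∈ (Projectivization.mk ℂ w hw).submodule ↔ wedge v w = 0 :=
  mem_submodule_iff (by rw [Projectivization.submodule_mk]; exact Submodule.mem_span_singleton_self _)
    hw v

theorem P1_eq_of_mem {F G : P1} {w : Fin 2 → ℂ} (hw : w ≠ 0) (hF : w ∈ F.submodule)
    (hG : w ∈ G.submodule) : F = G := by
  apply Projectivization.submodule_injective
  ext v
  rw [mem_submodule_iff hF hw, mem_submodule_iff hG hw]

theorem mk_eq_of_mem {F : P1} {w : Fin 2 → ℂ} (hw : w ≠ 0) (hF : w ∈ F.submodule) :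
    Projectivization.mk ℂ w hw = F :=
  P1_eq_of_mem hw ((mem_mk_iff hw w).2 (wedge_self w)) hF

/-! ### Linear forms and zeros of binary forms -/

theorem linForm_mem_forms (v : Fin 2 → ℂ) : linForm v ∈ forms 1 := by
  have hX : ∀ i : Fin 2, (X i : Poly) ∈ forms 1 := fun i => isWeightedHomogeneous_X ℂ _ i
  unfold linForm
  refine Submodule.sub_mem _ ?_ ?_
  · have := mul_mem_forms (C_mem_forms (v 0)) (hX 1); rwa [zero_add] at this
  · have := mul_mem_forms (C_mem_forms (v 1)) (hX 0); rwa [zero_add] at this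

@[simp] theorem eval_linForm (v w : Fin 2 → ℂ) : eval w (linForm v) = wedge v w := by
  simp [linForm, wedge]

theorem linForm_ne_zero {v : Fin 2 → ℂ} (hv : v ≠ 0) : linForm v ≠ 0 := by
  intro h
  apply hv
  have h0 := eval_linForm v ![0, 1]
  have h1 := eval_linForm v ![1, 0]
  rw [h, map_zero] at h0 h1
  simp [wedge] at h0 h1
  ext i; fin_cases i <;> simp [h0, h1]

theorem linForm_prime {v : Fin 2 → ℂ} (hv : v ≠ 0) : Prime (linForm v) := by
  rw [← UniqueFactorizationMonoid.irreducible_iff_prime]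
  apply irreducible_of_totalDegree_eq_one
  · refine IsHomogeneous.totalDegree (n := 1) ?_ (linForm_ne_zero hv)
    intro d hd
    have := degree_of_mem_forms (linForm_mem_forms v) hd
    rw [Finsupp.weight_apply, Finsupp.sum_fintype _ _ (by simp)]
    simp
    omega
  · intro x hx
    rw [isUnit_iff_ne_zero]
    rintro rfl
    refine linForm_ne_zero hv ?_
    ext d
    simpa using hx d

/-- Homogeneity makes `p` vanish on the whole line $\mathbb C v$, which is the zero locus of the
prime `linForm v`. The Nullstellensatz then gives divisibility. -/
theorem linForm_dvd {n : ℤ} {p : Poly} (hp : p ∈ forms n) {v : Fin 2 → ℂ} (hv : v ≠ 0)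
    (h : eval v p = 0) : ∃ q ∈ forms (n - 1), p = linForm v * q := by
  have hmem : p ∈ vanishingIdeal ℂ (zeroLocus ℂ (Ideal.span {linForm v})) := by
    intro x hx
    have hx' := hx (linForm v) (Ideal.mem_span_singleton_self _)
    rw [aeval_eq_eval] at hx' ⊢
    change eval x _ = 0 at hx'
    change eval x _ = 0
    rw [eval_linForm, wedge_comm, neg_eq_zero] at hx'
    obtain ⟨c, rfl⟩ := exists_smul_of_wedge hv hx'
    exact eval_smul_eq_zero hp h c
  rw [vanishingIdeal_zeroLocus_eq_radical,
    ((Ideal.span_singleton_prime (linForm_ne_zero hv)).2 (linForm_prime hv)).radical,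
    Ideal.mem_span_singleton] at hmem
  obtain ⟨q, rfl⟩ := hmem
  refine ⟨q, mem_forms_of_mul (linForm_ne_zero hv) (linForm_mem_forms v) ?_, rfl⟩
  rwa [add_sub_cancel]

theorem marked_ne_zero (lam : ℂ) (i : Fin 4) : marked lam i ≠ 0 := by
  intro h
  have h0 := congrFun h 0
  have h1 := congrFun h 1
  fin_cases i <;> simp [marked] at h0 h1

theorem wedge_marked_ne_zero {lam : ℂ} (h0 : lam ≠ 0) (h1 : lam ≠ 1) {i j : Fin 4} (h : i ≠ j) :
    wedge (marked lam i) (marked lam j) ≠ 0 := by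
  have h1' : lam - 1 ≠ 0 := sub_ne_zero.2 h1
  have h1'' : 1 - lam ≠ 0 := sub_ne_zero.2 h1.symm
  fin_cases i <;> fin_cases j <;> simp_all [marked, wedge]

/-- Each zero splits off a linear factor that does not vanish at the other marked points, so the
degree drops below zero. This count is what forces traces, scales and off-diagonal entries to vanish
later. -/
theorem forms_eq_zero_of_eval {lam : ℂ} (h0 : lam ≠ 0) (h1 : lam ≠ 1) (A : Finset (Fin 4)) :
    ∀ {n : ℤ} {p : Poly}, p ∈ forms n → n < A.card →
      (∀ i ∈ A, eval (marked lam i) p = 0) → p = 0 := by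
  induction A using Finset.induction_on with
  | empty =>
    intro n p hp hn _
    exact forms_of_neg (by simpa using hn) hp
  | insert a A ha ih =>
    intro n p hp hn h
    obtain ⟨q, hq, rfl⟩ := linForm_dvd hp (marked_ne_zero lam a) (h a (Finset.mem_insert_self a A))
    rw [Finset.card_insert_of_notMem ha] at hn
    rw [ih hq (by push_cast at hn; omega), mul_zero]
    intro i hi
    have := h i (Finset.mem_insert_of_mem hi)
    rw [map_mul, eval_linForm] at this
    exact (mul_eq_zero.1 this).resolve_left
      (wedge_marked_ne_zero h0 h1 (fun e => ha (e ▸ hi)))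

theorem exists_linForm_ne_zero {v : Fin 2 → ℂ} (hv : v ≠ 0) : ∃ w, w ≠ 0 ∧ wedge w v ≠ 0 := by
  by_cases h : v 0 = 0
  · refine ⟨![1, 0], fun e => by simpa using congrFun e 0, ?_⟩
    simp only [wedge, Matrix.cons_val_zero, Matrix.cons_val_one, zero_mul, sub_zero, one_mul]
    intro h'
    exact hv (by ext i; fin_cases i <;> simp [h, h'])
  · exact ⟨![0, 1], fun e => by simpa using congrFun e 1, by simpa [wedge] using h⟩

/-- Lagrange interpolation by binary forms at the marked points. -/
theorem exists_form_interpolating {lam : ℂ} (h0 : lam ≠ 0) (h1 : lam ≠ 1) (n : ℕ)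
    (A : Finset (Fin 4)) (hA : A.card ≤ n + 1) (c : Fin 4 → ℂ) :
    ∃ p ∈ forms n, ∀ i ∈ A, eval (marked lam i) p = c i := by
  induction A using Finset.induction_on with
  | empty => exact ⟨0, Submodule.zero_mem _, by simp⟩
  | insert a A ha ih =>
    rw [Finset.card_insert_of_notMem ha] at hA
    obtain ⟨p, hp, hpA⟩ := ih (by omega)
    obtain ⟨w, -, hw⟩ := exists_linForm_ne_zero (marked_ne_zero lam a)
    -- A form vanishing on `A` but not at `a`; the power of `linForm w` only raises the degree to
    -- `n`. A multiple of it corrects the value at `a`.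
    set f : Poly := (∏ j ∈ A, linForm (marked lam j)) * linForm w ^ (n - A.card) with hf
    have hfm : f ∈ forms n := by
      have h2 : (∏ j ∈ A, linForm (marked lam j)) ∈ forms (∑ j ∈ A, (1 : ℤ)) :=
        IsWeightedHomogeneous.prod A _ _ fun j _ => linForm_mem_forms _
      have h3 := mul_mem_forms h2 (pow_mem_forms (linForm_mem_forms w) (n - A.card))
      have e : (∑ j ∈ A, (1 : ℤ)) + ((n - A.card : ℕ) : ℤ) * 1 = n := by
        rw [Finset.sum_const, nsmul_eq_mul]; push_cast [show A.card ≤ n by omega]; ring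
      rwa [e] at h3
    have hfa : eval (marked lam a) f ≠ 0 := by
      rw [hf, map_mul, map_prod, map_pow, eval_linForm]
      refine mul_ne_zero (Finset.prod_ne_zero_iff.2 fun j hj => ?_) (pow_ne_zero _ hw)
      rw [eval_linForm]
      exact wedge_marked_ne_zero h0 h1 (fun e => ha (e ▸ hj))
    have hfA : ∀ i ∈ A, eval (marked lam i) f = 0 := by
      intro i hi
      rw [hf, map_mul, map_prod, Finset.prod_eq_zero hi (by rw [eval_linForm, wedge_self]), zero_mul]
    refine ⟨p + ((c a - eval (marked lam a) p) / eval (marked lam a) f) • f,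
      Submodule.add_mem _ hp (Submodule.smul_mem _ _ hfm), fun i hi => ?_⟩
    rw [map_add, smul_eval]
    rcases Finset.mem_insert.1 hi with rfl | hi
    · field_simp; ring
    · rw [hfA i hi, hpA i hi]; ring

/-- Two binary polynomials whose only common zero is the origin are coprime. -/
theorem isRelPrime_of_no_common_zero {p q : Poly}
    (h : ∀ v : Fin 2 → ℂ, v ≠ 0 → eval v p ≠ 0 ∨ eval v q ≠ 0) : IsRelPrime p q := by
  -- By the Nullstellensatz the ideal contains powers of both variables, and a common divisor of `p`
  -- and `q` divides these coprime powers.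
  have hX : ∀ i : Fin 2, ∃ N : ℕ, (X i : Poly) ^ N ∈ Ideal.span {p, q} := by
    intro i
    have : (X i : Poly) ∈ vanishingIdeal ℂ (zeroLocus ℂ (Ideal.span {p, q})) := by
      intro x hx
      have hp := hx p (Ideal.subset_span (by simp))
      have hq := hx q (Ideal.subset_span (by simp))
      rw [aeval_eq_eval] at hp hq
      have : x = 0 := by
        by_contra hx0
        rcases h x hx0 with h' | h'
        · exact h' hp
        · exact h' hq
      simp [this]
    rw [vanishingIdeal_zeroLocus_eq_radical] at this
    exact this
  intro d hdp hdq
  have hd : ∀ r ∈ Ideal.span {p, q}, d ∣ r := by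
    intro r hr
    obtain ⟨a, b, rfl⟩ := Ideal.mem_span_pair.1 hr
    exact dvd_add (hdp.mul_left a) (hdq.mul_left b)
  obtain ⟨N, hN⟩ := hX 0
  obtain ⟨M, hM⟩ := hX 1
  have hrel : IsRelPrime (X 0 : Poly) (X 1) := by
    rw [(X_prime (R := ℂ) (i := (0 : Fin 2))).irreducible.isRelPrime_iff_not_dvd, X_dvd_X]
    simp
  exact (hrel.pow_left (m := N)).pow_right (n := M) (hd _ hN) (hd _ hM)

/-! ### Line sub-bundles -/

theorem eval_lineGen_ne_zero {m : Fin 2 → ℤ} {j : ℤ} {s : Fin 2 → Poly} (hs : s ∈ lineGen m j)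
    {v : Fin 2 → ℂ} (hv : v ≠ 0) : (fun a => eval v (s a)) ≠ 0 := by
  obtain ⟨a, ha⟩ := hs.2 v hv
  exact fun h => ha (congrFun h a)

theorem meets_iff_of_mem {lam : ℂ} {F : QP} {s : Fin 2 → Poly} {i : Fin 4} {v : Fin 2 → ℂ}
    (hv : v ∈ (F i).submodule) (hv0 : v ≠ 0) :
    Meets lam F s i ↔ wedge (fun a => eval (marked lam i) (s a)) v = 0 :=
  mem_submodule_iff hv hv0 _

theorem isRelPrime_of_lineGen {m : Fin 2 → ℤ} {j : ℤ} {s : Fin 2 → Poly} (hs : s ∈ lineGen m j) :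
    IsRelPrime (s 0) (s 1) := by
  refine isRelPrime_of_no_common_zero fun v hv => ?_
  simpa [Fin.exists_fin_two] using hs.2 v hv

/-- Coprimality applied to the pair `(t, t)` makes `t` a unit. -/
theorem eq_C_of_no_zero {t : Poly} (h : ∀ v : Fin 2 → ℂ, v ≠ 0 → eval v t ≠ 0) :
    ∃ c : ℂ, c ≠ 0 ∧ t = C c := by
  have := isRelPrime_of_no_common_zero (p := t) (q := t) fun v hv => Or.inl (h v hv)
  obtain ⟨c, hc, h⟩ := isUnit_iff_eq_C_of_isReduced.1 (this dvd_rfl dvd_rfl)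
  exact ⟨c, hc.ne_zero, h⟩

/-- Above degree `m 1` the second component has negative degree and vanishes; the first is then
nowhere zero, hence constant. -/
theorem le_or_of_lineGen {m : Fin 2 → ℤ} {j : ℤ} {s : Fin 2 → Poly} (hs : s ∈ lineGen m j) :
    j ≤ m 1 ∨ j = m 0 := by
  rcases le_or_gt j (m 1) with h | h
  · exact Or.inl h
  · right
    have h1 : s 1 = 0 := forms_of_neg (by omega) (hs.1 1)
    obtain ⟨c, hc, h0⟩ := eq_C_of_no_zero (t := s 0) fun v hv => by
      simpa [Fin.exists_fin_two, h1] using hs.2 v hv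
    have := hs.1 0
    rw [h0] at this
    have := forms_inj (by simpa using hc) this (C_mem_forms c)
    omega

theorem lineGen_top {m : Fin 2 → ℤ} (hm : m 1 < m 0) {s : Fin 2 → Poly}
    (hs : s ∈ lineGen m (m 0)) : ∃ c : ℂ, c ≠ 0 ∧ s 0 = C c ∧ s 1 = 0 := by
  have h1 : s 1 = 0 := forms_of_neg (by omega) (hs.1 1)
  obtain ⟨c, hc, h0⟩ := eq_C_of_no_zero (t := s 0) fun v hv => by
      simpa [Fin.exists_fin_two, h1] using hs.2 v hv
  exact ⟨c, hc, h0, h1⟩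

theorem one_zero_mem_lineGen (m : Fin 2 → ℤ) : (![1, 0] : Fin 2 → Poly) ∈ lineGen m (m 0) := by
  refine ⟨fun a => ?_, fun v _ => ⟨0, by simp⟩⟩
  fin_cases a
  · simpa using C_mem_forms 1
  · exact Submodule.zero_mem _

theorem lineGen_second {m : Fin 2 → ℤ} (hm : m 1 < m 0) {s : Fin 2 → Poly}
    (hs : s ∈ lineGen m (m 1)) : ∃ c : ℂ, c ≠ 0 ∧ s 1 = C c := by
  have h1 := hs.1 1
  rw [sub_self] at h1
  refine ⟨_, fun hc => ?_, forms_zero_eq_C h1⟩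
  have h1' : s 1 = 0 := by rw [forms_zero_eq_C h1, hc, C_0]
  obtain ⟨c, hc, h0⟩ := eq_C_of_no_zero (t := s 0) fun v hv => by
      simpa [Fin.exists_fin_two, h1'] using hs.2 v hv
  have := hs.1 0
  rw [h0] at this
  have := forms_inj (by simpa using hc) this (C_mem_forms c)
  omega

theorem mem_lineGen_second {m : Fin 2 → ℤ} {p : Poly} (hp : p ∈ forms (m 0 - m 1)) {c : ℂ}
    (hc : c ≠ 0) : (![p, C c] : Fin 2 → Poly) ∈ lineGen m (m 1) := by
  refine ⟨fun a => ?_, fun v _ => ⟨1, by simpa using hc⟩⟩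
  fin_cases a
  · exact hp
  · simpa using C_mem_forms c

theorem meets_top_iff {lam : ℂ} {m : Fin 2 → ℤ} (hm : m 1 < m 0) {s : Fin 2 → Poly}
    (hs : s ∈ lineGen m (m 0)) (F : QP) (i : Fin 4) :
    Meets lam F s i ↔ (![1, 0] : Fin 2 → ℂ) ∈ (F i).submodule := by
  obtain ⟨c, hc, h0, h1⟩ := lineGen_top hm hs
  have : (fun a => eval (marked lam i) (s a)) = c • ![1, 0] := by
    ext a; fin_cases a <;> simp [h0, h1]
  rw [Meets, this]
  exact Submodule.smul_mem_iff _ hc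

/-- Generators of the same line sub-bundle differ by a nonzero constant. -/
theorem exists_eq_smul_of_lineGen {m : Fin 2 → ℤ} {j j' : ℤ} {s s' : Fin 2 → Poly}
    (hs : s ∈ lineGen m j) (hs' : s' ∈ lineGen m j') (h : s 0 * s' 1 = s 1 * s' 0) :
    j = j' ∧ ∃ c : ℂ, c ≠ 0 ∧ s' = c • s := by
  have hrel := isRelPrime_of_lineGen hs
  -- Proportionality to a coprime pair gives a polynomial factor; since `s'` has no zero, neither
  -- has the factor, which is therefore constant.
  obtain ⟨t, ht⟩ : ∃ t : Poly, ∀ a, s' a = s a * t := by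
    by_cases h0 : s 0 = 0
    · rw [h0, isRelPrime_zero_left] at hrel
      obtain ⟨t, ht⟩ := hrel.dvd (a := s' 1)
      rw [h0, zero_mul] at h
      refine ⟨t, fun a => ?_⟩
      fin_cases a
      · simpa [h0, hrel.ne_zero] using h.symm
      · exact ht
    · obtain ⟨t, ht⟩ := hrel.dvd_of_dvd_mul_left (Dvd.intro _ h)
      refine ⟨t, fun a => ?_⟩
      fin_cases a
      · exact ht
      · exact mul_left_cancel₀ h0 (by simp only [Fin.mk_one]; rw [h, ht]; ring)
  obtain ⟨c, hc, rfl⟩ := eq_C_of_no_zero (t := t) fun v hv => by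
    obtain ⟨a, ha⟩ := hs'.2 v hv
    rw [ht, map_mul] at ha
    exact right_ne_zero_of_mul ha
  obtain ⟨a, ha⟩ := hs'.2 ![1, 0] fun e => by simpa using congrFun e 0
  have ha0 : s a ≠ 0 := fun e => ha (by rw [ht, e, zero_mul, map_zero])
  constructor
  · have h1 := mul_mem_forms (hs.1 a) (C_mem_forms c)
    rw [← ht, add_zero] at h1
    have := forms_inj (by rw [ht]; exact mul_ne_zero ha0 (by simpa using hc)) h1 (hs'.1 a)
    omega
  · exact ⟨c, hc, funext fun a => by rw [ht, Pi.smul_apply, smul_eq_C_mul, mul_comm]⟩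

theorem smul_mem_lineGen {m : Fin 2 → ℤ} {j : ℤ} {s : Fin 2 → Poly} (hs : s ∈ lineGen m j) {c : ℂ}
    (hc : c ≠ 0) : c • s ∈ lineGen m j := by
  refine ⟨fun a => Submodule.smul_mem _ _ (hs.1 a), fun v hv => ?_⟩
  obtain ⟨a, ha⟩ := hs.2 v hv
  exact ⟨a, by rw [Pi.smul_apply, smul_eval]; exact mul_ne_zero hc ha⟩

theorem meets_smul {lam : ℂ} {F : QP} {s : Fin 2 → Poly} {i : Fin 4} {c : ℂ} (hc : c ≠ 0) :
    Meets lam F (c • s) i ↔ Meets lam F s i := by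
  have : (fun a => eval (marked lam i) ((c • s) a)) =
      c • fun a => eval (marked lam i) (s a) := by
    ext a; simp [smul_eval]
  rw [Meets, this]
  exact Submodule.smul_mem_iff _ hc

/-! ### Nilpotent Higgs fields -/

/-- The nilpotent matrix with kernel generated by `s` and scale `q`. -/
def nilMat (q : Poly) (s : Fin 2 → Poly) : Matrix (Fin 2) (Fin 2) Poly :=
  !![q * (s 0 * s 1), -(q * s 0 ^ 2); q * s 1 ^ 2, -(q * (s 0 * s 1))]

theorem nilMat_zero_zero (q : Poly) (s : Fin 2 → Poly) : nilMat q s 0 0 = q * (s 0 * s 1) := rfl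

theorem nilMat_zero_one (q : Poly) (s : Fin 2 → Poly) : nilMat q s 0 1 = -(q * s 0 ^ 2) := rfl

theorem nilMat_one_zero (q : Poly) (s : Fin 2 → Poly) : nilMat q s 1 0 = q * s 1 ^ 2 := rfl

theorem nilMat_one_one (q : Poly) (s : Fin 2 → Poly) : nilMat q s 1 1 = -(q * (s 0 * s 1)) := rfl

theorem residue_mulVec_eq_zero_iff {lam : ℂ} (h0 : lam ≠ 0) (h1 : lam ≠ 1)
    (Φ : Matrix (Fin 2) (Fin 2) Poly) (i : Fin 4) (v : Fin 2 → ℂ) :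
    (residue lam Φ i).mulVec v = 0 ↔ (Φ.map (eval (marked lam i))).mulVec v = 0 := by
  have hne : (∏ j ∈ Finset.univ.erase i, wedge (marked lam j) (marked lam i))⁻¹ ≠ 0 :=
    inv_ne_zero (Finset.prod_ne_zero_iff.2 fun j hj =>
      wedge_marked_ne_zero h0 h1 (Finset.ne_of_mem_erase hj))
  rw [residue, Matrix.smul_mulVec, smul_eq_zero_iff_right hne]

theorem isNilpotent_residue_iff {lam : ℂ} (h0 : lam ≠ 0) (h1 : lam ≠ 1)
    (Φ : Matrix (Fin 2) (Fin 2) Poly) (i : Fin 4) :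
    IsNilpotent (residue lam Φ i) ↔ IsNilpotent (Φ.map (eval (marked lam i))) := by
  have hne : (∏ j ∈ Finset.univ.erase i, wedge (marked lam j) (marked lam i))⁻¹ ≠ 0 :=
    inv_ne_zero (Finset.prod_ne_zero_iff.2 fun j hj =>
      wedge_marked_ne_zero h0 h1 (Finset.ne_of_mem_erase hj))
  unfold IsNilpotent
  refine exists_congr fun n => ?_
  rw [residue, smul_pow, smul_eq_zero_iff_right (pow_ne_zero n hne)]

/-- The trace is a form of degree 2, and nilpotency of the residues gives it four zeros. -/
theorem trace_eq_zero_of_mem_QPH {lam : ℂ} (h0 : lam ≠ 0) (h1 : lam ≠ 1) {m : Fin 2 → ℤ}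
    {x : HiggsPair lam m} (hx : x ∈ QPH lam m) : x.field 1 1 = -x.field 0 0 := by
  rw [eq_neg_iff_add_eq_zero]
  refine forms_eq_zero_of_eval h0 h1 Finset.univ (n := 2) ?_ (by simp) fun i _ => ?_
  · have a := hx.1 0 0
    have b := hx.1 1 1
    rw [sub_self, zero_add] at a b
    exact Submodule.add_mem _ b a
  · have := Matrix.isNilpotent_trace_of_isNilpotent
      ((isNilpotent_residue_iff h0 h1 _ _).1 (hx.2 i).1)
    rw [isNilpotent_iff_eq_zero, Matrix.trace_fin_two] at this
    rw [map_add, add_comm]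
    exact this

theorem mulVec_eq_iff (Φ : Matrix (Fin 2) (Fin 2) Poly) (s u : Fin 2 → Poly) :
    Φ.mulVec s = u ↔ Φ 0 0 * s 0 + Φ 0 1 * s 1 = u 0 ∧ Φ 1 0 * s 0 + Φ 1 1 * s 1 = u 1 := by
  rw [funext_iff, Fin.forall_fin_two]
  simp [Matrix.mulVec, dotProduct, Fin.sum_univ_two]

theorem matrix_ne_zero_iff (Φ : Matrix (Fin 2) (Fin 2) Poly) :
    Φ ≠ 0 ↔ Φ 0 0 ≠ 0 ∨ Φ 0 1 ≠ 0 ∨ Φ 1 0 ≠ 0 ∨ Φ 1 1 ≠ 0 := by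
  rw [← not_iff_not]
  push Not
  rw [← Matrix.ext_iff]
  simp [Fin.forall_fin_two, and_assoc]

/-- The invariant line sub-bundles of a nonzero nilpotent Higgs field are its kernel. -/
theorem wedge_eq_of_invariant {lam : ℂ} (h0 : lam ≠ 0) (h1 : lam ≠ 1) {m : Fin 2 → ℤ}
    {x : HiggsPair lam m} (hx : x ∈ QPHnil lam m) (hne : x.field ≠ 0) {j : ℤ}
    {s s' : Fin 2 → Poly} (hs : x.field.mulVec s = 0)
    (hs' : s' ∈ lineGen m j) {t : Poly} (ht : x.field.mulVec s' = t • s') :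
    s 0 * s' 1 = s 1 * s' 0 := by
  have htr := trace_eq_zero_of_mem_QPH h0 h1 hx.1
  have hdet := hx.2
  rw [Matrix.det_fin_two] at hdet
  rw [mulVec_eq_iff] at hs ht
  simp only [Pi.zero_apply, Pi.smul_apply, smul_eq_mul] at hs ht
  rw [matrix_ne_zero_iff] at hne
  set a := x.field 0 0
  set b := x.field 0 1
  set c := x.field 1 0
  set d := x.field 1 1
  -- Trace and determinant vanish, so the field squares to zero by Cayley–Hamilton; hence $t^2s'=0$.
  -- Afterwards any nonzero entry of the field gives a row annihilating both `s` and `s'`, which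
  -- makes them proportional.
  have ht0 : t = 0 := by
    obtain ⟨k, hk⟩ := hs'.2 ![1, 0] fun e => by simpa using congrFun e 0
    have hk0 : s' k ≠ 0 := fun e => hk (by rw [e, map_zero])
    have : t ^ 2 * s' k = 0 := by
      fin_cases k
      · simp only [Fin.zero_eta]
        linear_combination (-t - a) * ht.1 - b * ht.2 + (a * s' 0 + b * s' 1) * htr - s' 0 * hdet
      · simp only [Fin.mk_one]
        linear_combination (-t - d) * ht.2 - c * ht.1 + (c * s' 0 + d * s' 1) * htr - s' 1 * hdet
    exact pow_eq_zero_iff two_ne_zero |>.1 ((mul_eq_zero.1 this).resolve_right hk0)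
  rw [ht0] at ht
  rw [← sub_eq_zero]
  rcases hne with h | h | h | h
  · exact (mul_eq_zero.1 (show a * (s 0 * s' 1 - s 1 * s' 0) = 0 by
      linear_combination s' 1 * hs.1 - s 1 * ht.1)).resolve_left h
  · exact (mul_eq_zero.1 (show b * (s 0 * s' 1 - s 1 * s' 0) = 0 by
      linear_combination s 0 * ht.1 - s' 0 * hs.1)).resolve_left h
  · exact (mul_eq_zero.1 (show c * (s 0 * s' 1 - s 1 * s' 0) = 0 by
      linear_combination s' 1 * hs.2 - s 1 * ht.2)).resolve_left h
  · exact (mul_eq_zero.1 (show d * (s 0 * s' 1 - s 1 * s' 0) = 0 by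
      linear_combination s 0 * ht.2 - s' 0 * hs.2)).resolve_left h

-- Every invariant line sub-bundle is the kernel, so only one inequality has to be tested.
open Classical in
theorem stable_iff_of_nilpotent {lam : ℂ} (h0 : lam ≠ 0) (h1 : lam ≠ 1) {m : Fin 2 → ℤ}
    {x : HiggsPair lam m} (hx : x ∈ QPHnil lam m) (hne : x.field ≠ 0) {j : ℤ}
    {s : Fin 2 → Poly} (hs : s ∈ lineGen m j) (hker : x.field.mulVec s = 0) (β : Fin 4 → ℝ) :
    Stable β x ↔
      weightSum β {i | Meets lam x.flag s i} < ((m 0 + m 1 - 2 * j : ℤ) : ℝ) := by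
  constructor
  · intro h
    exact h j s hs ⟨0, Submodule.zero_mem _, by rw [hker, zero_smul]⟩
  · rintro h j' s' hs' ⟨t, -, ht⟩
    obtain ⟨rfl, c, hc, rfl⟩ := exists_eq_smul_of_lineGen hs hs'
      (wedge_eq_of_invariant h0 h1 hx hne hker hs' ht)
    simpa only [meets_smul hc] using h

/-- A nonzero nilpotent Higgs field with a prescribed kernel is determined by its scale. -/
theorem exists_eq_nilMat {lam : ℂ} (h0 : lam ≠ 0) (h1 : lam ≠ 1) {m : Fin 2 → ℤ}
    {x : HiggsPair lam m} (hx : x ∈ QPH lam m) (hne : x.field ≠ 0) {j : ℤ}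
    {s : Fin 2 → Poly} (hs : s ∈ lineGen m j) (hker : x.field.mulVec s = 0) :
    ∃ q ∈ forms (2 + 2 * j - m 0 - m 1), q ≠ 0 ∧ x.field = nilMat q s := by
  have htr := trace_eq_zero_of_mem_QPH h0 h1 hx
  have hrel := isRelPrime_of_lineGen hs
  rw [mulVec_eq_iff] at hker
  simp only [Pi.zero_apply] at hker
  rw [htr] at hker
  obtain ⟨q, hq⟩ : ∃ q, x.field = nilMat q s := by
    suffices ∃ q, x.field 0 0 = q * (s 0 * s 1) ∧ x.field 0 1 = -(q * s 0 ^ 2) ∧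
        x.field 1 0 = q * s 1 ^ 2 by
      obtain ⟨q, ha, hb, hc⟩ := this
      refine ⟨q, ?_⟩
      ext1 i k
      fin_cases i <;> fin_cases k <;> simp [nilMat, ha, hb, hc, htr]
    by_cases hs0 : s 0 = 0
    · rw [hs0, isRelPrime_zero_left] at hrel
      obtain ⟨q, hq⟩ := (hrel.pow 2).dvd (a := x.field 1 0)
      rw [hs0] at hker
      refine ⟨q, ?_, ?_, by rw [hq, mul_comm]⟩
      · have := hker.2
        simp only [mul_zero, zero_add, neg_mul, neg_eq_zero, mul_eq_zero] at this
        rw [this.resolve_right hrel.ne_zero, hs0]; ring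
      · have := hker.1
        simp only [mul_zero, zero_add, mul_eq_zero] at this
        rw [this.resolve_right hrel.ne_zero, hs0]; ring
    by_cases hs1 : s 1 = 0
    · rw [hs1, isRelPrime_zero_right] at hrel
      obtain ⟨q, hq⟩ := (hrel.pow 2).dvd (a := x.field 0 1)
      rw [hs1] at hker
      refine ⟨-q, ?_, by rw [hq]; ring, ?_⟩
      · have := hker.1
        simp only [mul_zero, add_zero, mul_eq_zero] at this
        rw [this.resolve_right hrel.ne_zero, hs1]; ring
      · have := hker.2
        simp only [mul_zero, add_zero, mul_eq_zero] at this
        rw [this.resolve_right hrel.ne_zero, hs1]; ring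
    -- With both components nonzero, the first row of $\Phi s=0$ shows that `s 1` divides the corner
    -- entry, and the second row that `s 0` divides the quotient.
    obtain ⟨a, ha⟩ : s 1 ∣ x.field 0 0 := hrel.symm.dvd_of_dvd_mul_right
      ⟨-x.field 0 1, by linear_combination hker.1⟩
    rw [ha] at hker
    obtain ⟨q, hq⟩ : s 0 ∣ a := (hrel.pow_right (n := 2)).dvd_of_dvd_mul_right
      ⟨x.field 1 0, by linear_combination -hker.2⟩
    rw [hq] at hker ha
    refine ⟨q, by rw [ha]; ring, ?_, ?_⟩
    · exact mul_right_cancel₀ hs1 (by linear_combination hker.1)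
    · exact mul_right_cancel₀ hs0 (by linear_combination hker.2)
  have hq0 : q ≠ 0 := by
    rintro rfl
    apply hne
    rw [hq]
    ext1 i k
    fin_cases i <;> fin_cases k <;> simp [nilMat]
  refine ⟨q, ?_, hq0, hq⟩
  -- The degree of `q` is read off from an off-diagonal entry, which is $\pm s_k^2q$ for a nonzero
  -- component $s_k$.
  obtain ⟨k, hk⟩ := hs.2 ![1, 0] fun e => by simpa using congrFun e 0
  have hk0 : s k ≠ 0 := fun e => hk (by rw [e, map_zero])
  refine mem_forms_of_mul (pow_ne_zero 2 hk0) (pow_mem_forms (hs.1 k) 2) ?_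
  have key : ∀ k, s k ^ 2 * q ∈ forms ((2 : ℕ) * (m k - j) + (2 + 2 * j - m 0 - m 1)) := by
    rw [Fin.forall_fin_two]
    constructor
    · have := Submodule.neg_mem _ (hx.1 0 1)
      rw [hq, nilMat_zero_one, neg_neg, mul_comm] at this
      rwa [show ((2 : ℕ) : ℤ) * (m 0 - j) + (2 + 2 * j - m 0 - m 1) = m 0 - m 1 + 2 by
        push_cast; ring]
    · have := hx.1 1 0
      rw [hq, nilMat_one_zero, mul_comm] at this
      rwa [show ((2 : ℕ) : ℤ) * (m 1 - j) + (2 + 2 * j - m 0 - m 1) = m 1 - m 0 + 2 by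
        push_cast; ring]
  exact key k

theorem nilMat_ne_zero {m : Fin 2 → ℤ} {j : ℤ} {q : Poly} (hq : q ≠ 0) {s : Fin 2 → Poly}
    (hs : s ∈ lineGen m j) : nilMat q s ≠ 0 := by
  obtain ⟨k, hk⟩ := hs.2 ![1, 0] fun e => by simpa using congrFun e 0
  have hk0 : s k ≠ 0 := fun e => hk (by rw [e, map_zero])
  rw [matrix_ne_zero_iff]
  fin_cases k
  · right; left
    simpa [nilMat, hq] using hk0
  · right; right; left
    simpa [nilMat, hq] using hk0

theorem nilMat_mulVec (q : Poly) (s : Fin 2 → Poly) : (nilMat q s).mulVec s = 0 := by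
  rw [mulVec_eq_iff]
  simp only [nilMat, Matrix.of_apply, Matrix.cons_val', Matrix.cons_val_one, Matrix.cons_val_zero,
    Pi.zero_apply]
  constructor <;> (simp; ring)

theorem eval_nilMat_mulVec (q : Poly) (s : Fin 2 → Poly) (z v : Fin 2 → ℂ) :
    ((nilMat q s).map (eval z)).mulVec v =
      -(eval z q * wedge (fun a => eval z (s a)) v) • fun a => eval z (s a) := by
  ext a
  fin_cases a <;> simp [nilMat, Matrix.mulVec, dotProduct, Fin.sum_univ_two, wedge] <;> ring

/-- Over each point the matrix is the operator $v\mapsto-q\,(s\wedge v)\,s$, and the vector $s(z)$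
is nonzero. This turns the flag condition into a dichotomy between zeros of `q` and incidence with
the kernel. -/
theorem eval_nilMat_mulVec_eq_zero_iff {m : Fin 2 → ℤ} {j : ℤ} {q : Poly} {s : Fin 2 → Poly}
    (hs : s ∈ lineGen m j) {z : Fin 2 → ℂ} (hz : z ≠ 0) (v : Fin 2 → ℂ) :
    ((nilMat q s).map (eval z)).mulVec v = 0 ↔
      eval z q = 0 ∨ wedge (fun a => eval z (s a)) v = 0 := by
  rw [eval_nilMat_mulVec, smul_eq_zero_iff_left (eval_lineGen_ne_zero hs hz), neg_eq_zero,
    mul_eq_zero]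

/-- The points of `QPH₀(E)` with Higgs field `nilMat q s`. -/
theorem nilMat_mem_QPHnil_iff {lam : ℂ} (h0 : lam ≠ 0) (h1 : lam ≠ 1) {m : Fin 2 → ℤ} {j : ℤ}
    {q : Poly} (hq : q ∈ forms (2 + 2 * j - m 0 - m 1)) {s : Fin 2 → Poly} (hs : s ∈ lineGen m j)
    (F : QP) : (⟨F, nilMat q s⟩ : HiggsPair lam m) ∈ QPHnil lam m ↔
      ∀ i, eval (marked lam i) q = 0 ∨ Meets lam F s i := by
  constructor
  · intro h i
    have := (h.1.2 i).2 _ (rep_mem _)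
    rw [residue_mulVec_eq_zero_iff h0 h1,
      eval_nilMat_mulVec_eq_zero_iff hs (marked_ne_zero lam i)] at this
    rwa [meets_iff_of_mem (rep_mem _) (F i).rep_nonzero]
  · intro h
    refine ⟨⟨?_, fun i => ⟨?_, fun v hv => ?_⟩⟩, ?_⟩
    · have key : ∀ a b, q * (s a * s b) ∈
          forms ((2 + 2 * j - m 0 - m 1) + ((m a - j) + (m b - j))) := fun a b =>
        mul_mem_forms hq (mul_mem_forms (hs.1 a) (hs.1 b))
      suffices ∀ a b, nilMat q s a b ∈ forms (m a - m b + 2) from this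
      rw [Fin.forall_fin_two, Fin.forall_fin_two, Fin.forall_fin_two]
      refine ⟨⟨?_, ?_⟩, ?_, ?_⟩
      · rw [nilMat_zero_zero]
        convert key 0 1 using 2; ring
      · rw [nilMat_zero_one, sq]
        convert Submodule.neg_mem _ (key 0 0) using 2; ring
      · rw [nilMat_one_zero, sq]
        convert key 1 1 using 2; ring
      · rw [nilMat_one_one]
        convert Submodule.neg_mem _ (key 0 1) using 2; ring
    · rw [isNilpotent_residue_iff h0 h1]
      refine ⟨2, ?_⟩
      rw [← Matrix.map_pow]
      have : nilMat q s ^ 2 = 0 := by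
        rw [sq]
        ext1 a b
        fin_cases a <;> fin_cases b <;>
          simp [nilMat, Matrix.mul_apply, Fin.sum_univ_two] <;> ring
      rw [this]; simp
    · rw [residue_mulVec_eq_zero_iff h0 h1,
        eval_nilMat_mulVec_eq_zero_iff hs (marked_ne_zero lam i)]
      refine (h i).imp_right fun h => ?_
      rw [wedge_comm, neg_eq_zero]
      exact (mem_submodule_iff h (eval_lineGen_ne_zero hs (marked_ne_zero lam i)) v).1 hv
    · simp only [Matrix.det_fin_two, nilMat, Matrix.of_apply, Matrix.cons_val',
        Matrix.cons_val_one, Matrix.cons_val_zero]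
      simp; ring

/-! ### The action of `Aut(E)` -/

/-- The matrix of forms of an automorphism of `E`. -/
def autMat {m : Fin 2 → ℤ} (g : AutE m) : Matrix (Fin 2) (Fin 2) Poly := ((g : endAlg m) : _)

theorem autMat_mem {m : Fin 2 → ℤ} (g : AutE m) (a b : Fin 2) : autMat g a b ∈ forms (m a - m b) :=
  (g : endAlg m).2 a b

theorem autMat_mul {m : Fin 2 → ℤ} (g h : AutE m) : autMat (g * h) = autMat g * autMat h := rfl

theorem autMat_one {m : Fin 2 → ℤ} : autMat (1 : AutE m) = 1 := rfl

theorem autMat_mul_inv {m : Fin 2 → ℤ} (g : AutE m) : autMat g * autMat g⁻¹ = 1 := by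
  rw [← autMat_mul, mul_inv_cancel, autMat_one]

theorem autMat_inv_mul {m : Fin 2 → ℤ} (g : AutE m) : autMat g⁻¹ * autMat g = 1 := by
  rw [← autMat_mul, inv_mul_cancel, autMat_one]

theorem smul_field {lam : ℂ} {m : Fin 2 → ℤ} (g : AutE m) (x : HiggsPair lam m) :
    (g • x).field = autMat g * x.field * autMat g⁻¹ := rfl

/-- The value of an automorphism of `E` over a point. -/
def autEval {m : Fin 2 → ℤ} (g : AutE m) (z : Fin 2 → ℂ) : Matrix (Fin 2) (Fin 2) ℂ :=
  (autMat g).map (eval z)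

theorem autEval_inv_mul {m : Fin 2 → ℤ} (g : AutE m) (z : Fin 2 → ℂ) :
    autEval g⁻¹ z * autEval g z = 1 := by
  rw [autEval, autEval, ← Matrix.map_mul, autMat_inv_mul]
  ext a b
  simp [Matrix.one_apply, apply_ite]

theorem autEval_mul_inv {m : Fin 2 → ℤ} (g : AutE m) (z : Fin 2 → ℂ) :
    autEval g z * autEval g⁻¹ z = 1 := by
  simpa using autEval_inv_mul g⁻¹ z

theorem autEval_mulVec_ne_zero {m : Fin 2 → ℤ} (g : AutE m) (z : Fin 2 → ℂ) {v : Fin 2 → ℂ}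
    (hv : v ≠ 0) : (autEval g z).mulVec v ≠ 0 := by
  intro h
  apply hv
  have := congrArg (autEval g⁻¹ z).mulVec h
  rwa [Matrix.mulVec_mulVec, autEval_inv_mul, Matrix.one_mulVec, Matrix.mulVec_zero] at this

theorem mulVec_mem_smul_flag {lam : ℂ} {m : Fin 2 → ℤ} (g : AutE m) (x : HiggsPair lam m)
    (i : Fin 4) {v : Fin 2 → ℂ} (hv : v ∈ (x.flag i).submodule) :
    (autEval g (marked lam i)).mulVec v ∈ ((g • x).flag i).submodule := by
  by_cases hv0 : v = 0
  · rw [hv0, Matrix.mulVec_zero]; exact Submodule.zero_mem _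
  change _ ∈ (fibreHom m (marked lam i) g • x.flag i).submodule
  rw [← mk_eq_of_mem hv0 hv, Projectivization.smul_mk, Projectivization.submodule_mk]
  exact Submodule.mem_span_singleton_self _

theorem mulVec_mem_smul_flag_iff {lam : ℂ} {m : Fin 2 → ℤ} (g : AutE m) (x : HiggsPair lam m)
    (i : Fin 4) (v : Fin 2 → ℂ) :
    (autEval g (marked lam i)).mulVec v ∈ ((g • x).flag i).submodule ↔
      v ∈ (x.flag i).submodule := by
  refine ⟨fun h => ?_, mulVec_mem_smul_flag g x i⟩
  have := mulVec_mem_smul_flag g⁻¹ _ i h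
  rwa [inv_smul_smul, Matrix.mulVec_mulVec, autEval_inv_mul, Matrix.one_mulVec] at this

theorem eval_mulVec {m : Fin 2 → ℤ} (g : AutE m) (z : Fin 2 → ℂ) (s : Fin 2 → Poly) :
    (fun a => eval z ((autMat g).mulVec s a)) = (autEval g z).mulVec fun a => eval z (s a) := by
  ext a
  simp [Matrix.mulVec, dotProduct, autEval]

theorem mulVec_mem_lineGen {m : Fin 2 → ℤ} (g : AutE m) {j : ℤ} {s : Fin 2 → Poly}
    (hs : s ∈ lineGen m j) : (autMat g).mulVec s ∈ lineGen m j := by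
  refine ⟨fun a => ?_, fun v hv => ?_⟩
  · rw [Matrix.mulVec, dotProduct]
    refine Submodule.sum_mem _ fun b _ => ?_
    have := mul_mem_forms (autMat_mem g a b) (hs.1 b)
    rwa [show m a - m b + (m b - j) = m a - j by ring] at this
  · have := autEval_mulVec_ne_zero g v (eval_lineGen_ne_zero hs hv)
    rw [← eval_mulVec] at this
    exact Function.ne_iff.1 this

theorem meets_smul_iff {lam : ℂ} {m : Fin 2 → ℤ} (g : AutE m) (x : HiggsPair lam m)
    (s : Fin 2 → Poly) (i : Fin 4) :
    Meets lam (g • x).flag ((autMat g).mulVec s) i ↔ Meets lam x.flag s i := by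
  rw [Meets, eval_mulVec]
  exact mulVec_mem_smul_flag_iff g x i _

theorem smul_field_mulVec {lam : ℂ} {m : Fin 2 → ℤ} (g : AutE m) (x : HiggsPair lam m)
    (s : Fin 2 → Poly) :
    (g • x).field.mulVec ((autMat g).mulVec s) = (autMat g).mulVec (x.field.mulVec s) := by
  rw [smul_field, Matrix.mulVec_mulVec, Matrix.mulVec_mulVec, mul_assoc, mul_assoc, autMat_inv_mul,
    mul_one]

/-- Translation by `g⁻¹` carries invariant sub-bundles of `g • x` to those of `x` and preserves
degrees and incidences with the flags. -/
theorem stable_smul {lam : ℂ} {m : Fin 2 → ℤ} (g : AutE m) {x : HiggsPair lam m}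
    {β : Fin 4 → ℝ} (h : Stable β x) : Stable β (g • x) := by
  rintro j s hs ⟨t, ht, hst⟩
  have e : s = (autMat g).mulVec ((autMat g⁻¹).mulVec s) := by
    rw [Matrix.mulVec_mulVec, autMat_mul_inv, Matrix.one_mulVec]
  have h2 := h j _ (mulVec_mem_lineGen g⁻¹ hs) ⟨t, ht, by
    have := smul_field_mulVec g⁻¹ (g • x) s
    rw [inv_smul_smul, hst, Matrix.mulVec_smul] at this
    exact this⟩
  rw [e]
  convert h2 using 3
  exact meets_smul_iff g x _ _

theorem eval_field_smul {lam : ℂ} {m : Fin 2 → ℤ} (g : AutE m) (x : HiggsPair lam m)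
    (z : Fin 2 → ℂ) : (g • x).field.map (eval z) =
      autEval g z * x.field.map (eval z) * autEval g⁻¹ z := by
  rw [smul_field, Matrix.map_mul, Matrix.map_mul, autEval, autEval]

theorem smul_mem_QPHnil {lam : ℂ} (h0 : lam ≠ 0) (h1 : lam ≠ 1) {m : Fin 2 → ℤ} (g : AutE m)
    {x : HiggsPair lam m} (hx : x ∈ QPHnil lam m) : g • x ∈ QPHnil lam m := by
  refine ⟨⟨fun a b => ?_, fun i => ⟨?_, fun v hv => ?_⟩⟩, ?_⟩
  · rw [smul_field, Matrix.mul_apply]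
    refine Submodule.sum_mem _ fun c _ => ?_
    rw [Matrix.mul_apply, Finset.sum_mul]
    refine Submodule.sum_mem _ fun d _ => ?_
    have := mul_mem_forms (mul_mem_forms (autMat_mem g a d) (hx.1.1 d c)) (autMat_mem g⁻¹ c b)
    rwa [show m a - m d + (m d - m c + 2) + (m c - m b) = m a - m b + 2 by ring] at this
  · have := (hx.1.2 i).1
    rw [isNilpotent_residue_iff h0 h1] at this ⊢
    obtain ⟨k, hk⟩ := this
    refine ⟨k, ?_⟩
    rw [eval_field_smul]
    have key : ∀ k : ℕ, (autEval g (marked lam i) * x.field.map (eval (marked lam i)) *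
        autEval g⁻¹ (marked lam i)) ^ k = autEval g (marked lam i) *
        x.field.map (eval (marked lam i)) ^ k * autEval g⁻¹ (marked lam i) := by
      intro k
      induction k with
      | zero => simp [autEval_mul_inv]
      | succ k ih =>
        rw [pow_succ, ih, pow_succ]
        simp only [mul_assoc]
        rw [← mul_assoc (autEval g⁻¹ _) (autEval g _), autEval_inv_mul, one_mul]
    rw [key, hk, mul_zero, zero_mul]
  · rw [residue_mulVec_eq_zero_iff h0 h1, eval_field_smul]
    have e : v = (autEval g (marked lam i)).mulVec ((autEval g⁻¹ (marked lam i)).mulVec v) := by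
      rw [Matrix.mulVec_mulVec, autEval_mul_inv, Matrix.one_mulVec]
    rw [e, mulVec_mem_smul_flag_iff] at hv
    have := (hx.1.2 i).2 _ hv
    rw [residue_mulVec_eq_zero_iff h0 h1] at this
    rw [mul_assoc, ← Matrix.mulVec_mulVec, ← Matrix.mulVec_mulVec, this, Matrix.mulVec_zero]
  · rw [smul_field, Matrix.det_mul, Matrix.det_mul, hx.2, mul_zero, zero_mul]

theorem smul_field_ne_zero {lam : ℂ} {m : Fin 2 → ℤ} (g : AutE m) {x : HiggsPair lam m}
    (hx : x.field ≠ 0) : (g • x).field ≠ 0 := by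
  intro h
  apply hx
  have := smul_field g⁻¹ (g • x)
  rwa [inv_smul_smul, h, mul_zero, zero_mul] at this

theorem smul_mem_S {lam : ℂ} (h0 : lam ≠ 0) (h1 : lam ≠ 1) {m : Fin 2 → ℤ} {j : ℤ} (g : AutE m)
    {x : HiggsPair lam m} (hx : x ∈ S lam m j) : g • x ∈ S lam m j := by
  obtain ⟨hx, hne, s, hs, hker⟩ := hx
  exact ⟨smul_mem_QPHnil h0 h1 g hx, smul_field_ne_zero g hne, _, mulVec_mem_lineGen g hs, by
    rw [smul_field_mulVec, hker, Matrix.mulVec_zero]⟩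

/-- `R(E)` is the stratum of Higgs fields with kernel of degree `m 0`. -/
theorem R_eq_S {lam : ℂ} {m : Fin 2 → ℤ} (hm : m 1 < m 0) : R lam m = S lam m (m 0) := by
  ext x
  refine ⟨fun h => ⟨h.1, h.2.1, _, one_zero_mem_lineGen m, h.2.2⟩, ?_⟩
  rintro ⟨hx, hne, s, hs, hker⟩
  obtain ⟨c, hc, hs0, hs1⟩ := lineGen_top hm hs
  refine ⟨hx, hne, ?_⟩
  rw [mulVec_eq_iff, hs0, hs1] at hker
  rw [mulVec_eq_iff]
  simpa [hc] using hker

theorem smul_mem_condStable {lam : ℂ} {m : Fin 2 → ℤ} {T : Set (HiggsPair lam m)}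
    (hT : ∀ g : AutE m, ∀ x ∈ T, g • x ∈ T) (g : AutE m) {x : HiggsPair lam m}
    (hx : x ∈ condStable T) : g • x ∈ condStable T := by
  obtain ⟨hx, C, hC, hst⟩ := hx
  exact ⟨hT g x hx, C, hC, fun β hβ => stable_smul g (hst β hβ)⟩

theorem actsFreelyOn_of_aut {lam : ℂ} {m : Fin 2 → ℤ} {T : Set (HiggsPair lam m)}
    (hT : ∀ g : AutE m, ∀ x ∈ T, g • x ∈ T)
    (h : ∀ x ∈ T, ∀ g : AutE m, g • x = x → g ∈ scalars m) : ActsFreelyOn (PAut m) T := by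
  refine ⟨fun g x hx => ?_, fun x hx g hg => ?_⟩
  · induction g using QuotientGroup.induction_on with
    | H g => exact hT g x hx
  · induction g using QuotientGroup.induction_on with
    | H g => exact (QuotientGroup.eq_one_iff g).2 (h x hx g hg)

theorem mem_scalars_of_eq {m : Fin 2 → ℤ} {g : AutE m} {c : ℂ} (h : ∀ a b, autMat g a b =
    if a = b then C c else 0) : g ∈ scalars m := by
  have hc : c ≠ 0 := by
    rintro rfl
    have h1 := autMat_mul_inv g
    have : autMat g = 0 := by ext1 a b; simp [h]
    rw [this, zero_mul] at h1
    exact zero_ne_one h1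
  refine ⟨Units.mk0 c hc, Units.ext (Subtype.ext ?_)⟩
  change algebraMap ℂ (Matrix (Fin 2) (Fin 2) Poly) c = autMat g
  ext1 a b
  rw [h, Matrix.algebraMap_matrix_apply]
  rfl

/-- Automorphisms of an unstable bundle are upper triangular. -/
theorem exists_autMat_of_lt {m : Fin 2 → ℤ} (hm : m 1 < m 0) (g : AutE m) :
    ∃ a c : ℂ, a ≠ 0 ∧ c ≠ 0 ∧ autMat g 0 0 = C a ∧ autMat g 1 0 = 0 ∧ autMat g 1 1 = C c := by
  have hlow : ∀ g : AutE m, autMat g 1 0 = 0 := fun g => forms_of_neg (by omega) (autMat_mem g 1 0)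
  have ha := autMat_mem g 0 0
  have hc := autMat_mem g 1 1
  rw [sub_self] at ha hc
  have h00 := congrFun (congrFun (autMat_inv_mul g) 0) 0
  have h11 := congrFun (congrFun (autMat_mul_inv g) 1) 1
  rw [Matrix.mul_apply, Fin.sum_univ_two, hlow, mul_zero, add_zero] at h00
  rw [Matrix.mul_apply, Fin.sum_univ_two, hlow, zero_mul, zero_add] at h11
  refine ⟨_, _, fun h => ?_, fun h => ?_, forms_zero_eq_C ha, hlow g, forms_zero_eq_C hc⟩
  · rw [forms_zero_eq_C ha, h] at h00
    simp at h00
  · rw [forms_zero_eq_C hc, h] at h11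
    simp at h11

theorem exists_upper_triangular_aut {m : Fin 2 → ℤ} {a c : ℂ} (ha : a ≠ 0) (hc : c ≠ 0)
    {p : Poly} (hp : p ∈ forms (m 0 - m 1)) : ∃ g : AutE m, autMat g = !![C a, p; 0, C c] := by
  have key : ∀ (a c : ℂ) (p : Poly), p ∈ forms (m 0 - m 1) →
      (!![C a, p; 0, C c] : Matrix (Fin 2) (Fin 2) Poly) ∈ endAlg m := by
    intro a c p hp
    suffices ∀ i j, (!![C a, p; 0, C c] : Matrix (Fin 2) (Fin 2) Poly) i j ∈ forms (m i - m j)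
      from this
    rw [Fin.forall_fin_two, Fin.forall_fin_two, Fin.forall_fin_two, sub_self, sub_self]
    exact ⟨⟨C_mem_forms a, hp⟩, Submodule.zero_mem _, C_mem_forms c⟩
  have hC : ∀ {a : ℂ}, a ≠ 0 → (C a * C a⁻¹ : Poly) = 1 := fun {a} ha => by
    rw [← C_mul, mul_inv_cancel₀ ha, C_1]
  have hC' : ∀ {a : ℂ}, a ≠ 0 → (C a⁻¹ * C a : Poly) = 1 := fun {a} ha => by
    rw [← C_mul, inv_mul_cancel₀ ha, C_1]
  have hq : (-(a⁻¹ * c⁻¹)) • p ∈ forms (m 0 - m 1) := Submodule.smul_mem _ _ hp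
  refine ⟨⟨⟨_, key a c p hp⟩, ⟨_, key a⁻¹ c⁻¹ _ hq⟩, Subtype.ext ?_, Subtype.ext ?_⟩, rfl⟩
  · change !![C a, p; 0, C c] * !![C a⁻¹, (-(a⁻¹ * c⁻¹)) • p; 0, C c⁻¹] = 1
    rw [Matrix.mul_fin_two, Matrix.one_fin_two]
    simp only [smul_eq_C_mul, C_neg, C_mul, hC ha, hC hc, mul_zero, zero_mul, add_zero, zero_add]
    rw [show C a * (-(C a⁻¹ * C c⁻¹) * p) + p * C c⁻¹ = (0 : Poly) by
      linear_combination -p * C c⁻¹ * hC ha]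
  · change !![C a⁻¹, (-(a⁻¹ * c⁻¹)) • p; 0, C c⁻¹] * !![C a, p; 0, C c] = 1
    rw [Matrix.mul_fin_two, Matrix.one_fin_two]
    simp only [smul_eq_C_mul, C_neg, C_mul, hC' ha, hC' hc, mul_zero, zero_mul, add_zero, zero_add]
    rw [show C a⁻¹ * p + -(C a⁻¹ * C c⁻¹) * p * C c = (0 : Poly) by
      linear_combination -p * C a⁻¹ * hC' hc]

/-- Automorphisms of `𝒪(m) ⊕ 𝒪(m)` are constant. -/
theorem autMat_eq_C_of_eq {m : Fin 2 → ℤ} (hm : m 0 = m 1) (g : AutE m) (a b : Fin 2) :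
    autMat g a b = C (constantCoeff (autMat g a b)) := by
  have h := autMat_mem g a b
  rw [show m a - m b = 0 by fin_cases a <;> fin_cases b <;> simp [hm]] at h
  exact forms_zero_eq_C h

theorem exists_aut_of_eq {m : Fin 2 → ℤ} (hm : m 0 = m 1) (A : Matrix (Fin 2) (Fin 2) ℂ)
    (hA : A.det ≠ 0) : ∃ g : AutE m, autMat g = A.map C := by
  have key : ∀ A : Matrix (Fin 2) (Fin 2) ℂ, A.map C ∈ endAlg m := by
    intro A a b
    rw [show m a - m b = 0 by fin_cases a <;> fin_cases b <;> simp [hm]]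
    exact C_mem_forms _
  have hone : (1 : Matrix (Fin 2) (Fin 2) ℂ).map C = (1 : Matrix (Fin 2) (Fin 2) Poly) := by
    ext1 a b; simp [Matrix.one_apply, apply_ite]
  refine ⟨⟨⟨_, key A⟩, ⟨_, key A⁻¹⟩, Subtype.ext ?_, Subtype.ext ?_⟩, rfl⟩
  · change A.map C * A⁻¹.map C = 1
    rw [← Matrix.map_mul, Matrix.mul_nonsing_inv _ (isUnit_iff_ne_zero.2 hA), hone]
  · change A⁻¹.map C * A.map C = 1
    rw [← Matrix.map_mul, Matrix.nonsing_inv_mul _ (isUnit_iff_ne_zero.2 hA), hone]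

/-! ### Weights and chambers -/

theorem weightSum_compl (β : Fin 4 → ℝ) (I : Finset (Fin 4)) :
    weightSum β Iᶜ = -weightSum β I := by
  rw [weightSum, weightSum, compl_compl]; ring

theorem weightSum_mono {β : Fin 4 → ℝ} (hβ : ∀ i, 0 ≤ β i) {I J : Finset (Fin 4)} (h : I ⊆ J) :
    weightSum β I ≤ weightSum β J := by
  have h1 := Finset.sum_le_sum_of_subset_of_nonneg (f := β) h fun i _ _ => hβ i
  have h2 := Finset.sum_le_sum_of_subset_of_nonneg (f := β)
    (Finset.compl_subset_compl.2 h) fun i _ _ => hβ i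
  unfold weightSum
  linarith

theorem sum_lt_card {β : Fin 4 → ℝ} (hβ : ∀ i, β i < 1) (I : Finset (Fin 4)) (hI : I.Nonempty) :
    ∑ i ∈ I, β i < I.card := by
  have := Finset.sum_lt_sum_of_nonempty hI fun i _ => hβ i
  simpa using this

theorem weightSum_lt_card {β : Fin 4 → ℝ} (hβ : ∀ i, β i ∈ Set.Ioo (0 : ℝ) 1)
    (I : Finset (Fin 4)) : weightSum β I < I.card := by
  unfold weightSum
  rcases I.eq_empty_or_nonempty with rfl | hI
  · have : 0 < ∑ i, β i := Finset.sum_pos (fun i _ => (hβ i).1) Finset.univ_nonempty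
    simpa using this
  · have h1 := sum_lt_card (fun i => (hβ i).2) I hI
    have h2 : 0 ≤ ∑ i ∈ Iᶜ, β i := Finset.sum_nonneg fun i _ => (hβ i).1.le
    linarith

theorem lt_weightSum {β : Fin 4 → ℝ} (hβ : ∀ i, β i ∈ Set.Ioo (0 : ℝ) 1) (I : Finset (Fin 4)) :
    (I.card : ℝ) - 4 < weightSum β I := by
  have h := weightSum_lt_card hβ Iᶜ
  rw [weightSum_compl, Finset.card_compl, Fintype.card_fin,
    Nat.cast_sub (by simpa using Finset.card_le_univ I)] at h
  push_cast at h
  linarith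

/-- The weights in the open cube that lie on no wall. -/
def generic (d : ℤ) : Set (Fin 4 → ℝ) := {β | ∀ i, β i ∈ Set.Ioo (0 : ℝ) 1} \ walls d

/-- In the open cube $|I|-4<\beta_I<|I|$, so the three values of $k$ in the definition of the walls
are the only integers that $\beta_I$ can take. -/
theorem weightSum_ne_of_generic {d : ℤ} {β : Fin 4 → ℝ} (hβ : β ∈ generic d)
    (I : Finset (Fin 4)) {k : ℤ} (hk : Even (k - d)) : weightSum β I ≠ k := by
  intro h
  have h1 := weightSum_lt_card hβ.1 I
  have h2 := lt_weightSum hβ.1 I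
  rw [h] at h1 h2
  have h1' : k < I.card := by exact_mod_cast h1
  have h2' : (I.card : ℤ) - 4 < k := by exact_mod_cast h2
  exact hβ.2 ⟨fun i => Set.Ioo_subset_Icc_self (hβ.1 i), I, k, by omega, hk, h⟩

theorem continuous_weightSum (I : Finset (Fin 4)) : Continuous fun β => weightSum β I := by
  unfold weightSum
  fun_prop

/-- By the intermediate value theorem, a change of side would produce a weight on a wall. -/
theorem weightSum_lt_of_isPreconnected {d : ℤ} {C : Set (Fin 4 → ℝ)} (hC : IsPreconnected C)
    (hsub : C ⊆ generic d) {β γ : Fin 4 → ℝ} (hβ : β ∈ C) (hγ : γ ∈ C) (I : Finset (Fin 4)) {k : ℤ}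
    (hk : Even (k - d)) (h : weightSum β I < k) : weightSum γ I < k := by
  by_contra h'
  obtain ⟨δ, hδ, e⟩ := hC.intermediate_value hβ hγ (continuous_weightSum I).continuousOn
    ⟨h.le, not_lt.1 h'⟩
  exact weightSum_ne_of_generic (hsub hδ) I hk e

theorem IsChamber.subset_generic {d : ℤ} {C : Set (Fin 4 → ℝ)} (hC : IsChamber d C) :
    C ⊆ generic d := by
  obtain ⟨β, -, rfl⟩ := hC
  exact connectedComponentIn_subset _ _

theorem IsChamber.isPreconnected {d : ℤ} {C : Set (Fin 4 → ℝ)} (hC : IsChamber d C) :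
    IsPreconnected C := by
  obtain ⟨β, -, rfl⟩ := hC
  exact isPreconnected_connectedComponentIn

theorem IsChamber.nonempty {d : ℤ} {C : Set (Fin 4 → ℝ)} (hC : IsChamber d C) : C.Nonempty := by
  obtain ⟨β, hβ, rfl⟩ := hC
  exact ⟨β, mem_connectedComponentIn hβ⟩

theorem exists_chamber {d : ℤ} {β : Fin 4 → ℝ} (hβ : β ∈ generic d) :
    ∃ C, IsChamber d C ∧ β ∈ C :=
  ⟨_, ⟨β, hβ, rfl⟩, mem_connectedComponentIn hβ⟩

/-- The thresholds $\deg E-2j$ have the parity of the walls, so each stability inequality is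
constant on a chamber. -/
theorem stableOn_of_stable {lam : ℂ} {m : Fin 2 → ℤ} {C : Set (Fin 4 → ℝ)}
    (hC : IsChamber (m 0 + m 1) C) {β : Fin 4 → ℝ} (hβ : β ∈ C) {x : HiggsPair lam m}
    (h : Stable β x) : StableOn C x := fun _ hγ j s hs ht =>
  weightSum_lt_of_isPreconnected hC.isPreconnected hC.subset_generic hβ hγ _
    ⟨-j, by ring⟩ (h j s hs ht)

theorem mem_condStable_iff {lam : ℂ} {m : Fin 2 → ℤ} {T : Set (HiggsPair lam m)}
    {x : HiggsPair lam m} :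
    x ∈ condStable T ↔ x ∈ T ∧ ∃ β ∈ generic (m 0 + m 1), Stable β x := by
  constructor
  · rintro ⟨hx, C, hC, hst⟩
    obtain ⟨β, hβ⟩ := hC.nonempty
    exact ⟨hx, β, hC.subset_generic hβ, hst β hβ⟩
  · rintro ⟨hx, β, hβ, hst⟩
    obtain ⟨C, hC, hβC⟩ := exists_chamber hβ
    exact ⟨hx, C, hC, stableOn_of_stable hC hβC hst⟩

/-- The bounds of the polytope are integers of the parity of `d`, so a chamber cannot cross them and
one of its points suffices. -/
theorem isInteriorChamber_of_mem {d : ℤ} {C : Set (Fin 4 → ℝ)} (hC : IsChamber d C)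
    {β : Fin 4 → ℝ} (hβ : β ∈ C) (hp : β ∈ polytope d) : IsInteriorChamber d C := by
  have up : ∀ γ ∈ C, ∀ I : Finset (Fin 4), ∀ k : ℤ, Even (k - d) → weightSum β I ≤ k →
      weightSum γ I ≤ k := fun γ hγ I k hk h =>
    (weightSum_lt_of_isPreconnected hC.isPreconnected hC.subset_generic hβ hγ I hk
      (lt_of_le_of_ne h (weightSum_ne_of_generic (hC.subset_generic hβ) I hk))).le
  have low : ∀ γ ∈ C, ∀ I : Finset (Fin 4), ∀ k : ℤ, Even (k - d) → k ≤ weightSum β I →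
      k ≤ weightSum γ I := fun γ hγ I k hk h => by
    by_contra h'
    exact not_lt.2 h (weightSum_lt_of_isPreconnected hC.isPreconnected hC.subset_generic hγ hβ I hk
      (not_le.1 h'))
  refine ⟨hC, fun γ hγ => ⟨fun i => Set.Ioo_subset_Icc_self ((hC.subset_generic hγ).1 i),
    fun hd I hI => ?_, fun hd => ⟨?_, fun I hI => ?_⟩⟩⟩
  · have h := hp.2.1 hd I hI
    have e1 := low γ hγ I (-2) ((by decide : Even (-2 : ℤ)).sub hd) (by simpa using h.1)
    have e2 := up γ hγ I 0 (by simpa using hd) (by simpa using h.2)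
    exact ⟨by simpa using e1, by simpa using e2⟩
  · have h := (hp.2.2 hd).1
    have e1 := low γ hγ ∅ (-3) ((by decide : Odd (-3 : ℤ)).sub_odd hd) (by simpa using h.1)
    have e2 := up γ hγ ∅ (-1) ((by decide : Odd (-1 : ℤ)).sub_odd hd) (by simpa using h.2)
    exact ⟨by simpa using e1, by simpa using e2⟩
  · have h := (hp.2.2 hd).2 I hI
    have e1 := low γ hγ I (-1) ((by decide : Odd (-1 : ℤ)).sub_odd hd) (by simpa using h.1)
    have e2 := up γ hγ I 1 (odd_one.sub_odd hd) (by simpa using h.2)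
    exact ⟨by simpa using e1, by simpa using e2⟩

/-! ### Explicit rational test weights -/

/-- The weight with numerators `b` over the denominator `64`. -/
def intWeight (b : Fin 4 → ℤ) : Fin 4 → ℝ := fun i => b i / 64

/-- The integral analogue of `weightSum`. -/
def intSum (b : Fin 4 → ℤ) (I : Finset (Fin 4)) : ℤ := ∑ i ∈ I, b i - ∑ i ∈ Iᶜ, b i

theorem weightSum_intWeight (b : Fin 4 → ℤ) (I : Finset (Fin 4)) :
    weightSum (intWeight b) I = (intSum b I : ℝ) / 64 := by
  unfold weightSum intWeight intSum
  push_cast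
  rw [← Finset.sum_div, ← Finset.sum_div]
  ring

theorem weightSum_intWeight_lt {b : Fin 4 → ℤ} {I : Finset (Fin 4)} {k : ℤ} :
    weightSum (intWeight b) I < k ↔ intSum b I < 64 * k := by
  rw [weightSum_intWeight, div_lt_iff₀ (by norm_num), mul_comm]
  exact_mod_cast Iff.rfl

theorem weightSum_intWeight_le {b : Fin 4 → ℤ} {I : Finset (Fin 4)} {k : ℤ} :
    weightSum (intWeight b) I ≤ k ↔ intSum b I ≤ 64 * k := by
  rw [weightSum_intWeight, div_le_iff₀ (by norm_num), mul_comm]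
  exact_mod_cast Iff.rfl

theorem le_weightSum_intWeight {b : Fin 4 → ℤ} {I : Finset (Fin 4)} {k : ℤ} :
    k ≤ weightSum (intWeight b) I ↔ 64 * k ≤ intSum b I := by
  rw [weightSum_intWeight, le_div_iff₀ (by norm_num), mul_comm]
  exact_mod_cast Iff.rfl

theorem intSum_mono {b : Fin 4 → ℤ} (hb : ∀ i, 0 ≤ b i) {I J : Finset (Fin 4)} (h : I ⊆ J) :
    intSum b I ≤ intSum b J := by
  have h1 := Finset.sum_le_sum_of_subset_of_nonneg (f := b) h fun i _ _ => hb i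
  have h2 := Finset.sum_le_sum_of_subset_of_nonneg (f := b)
    (Finset.compl_subset_compl.2 h) fun i _ _ => hb i
  unfold intSum
  linarith

/-- Numerators in `(0, 64)` with an odd sum. -/
def OddNumerators (b : Fin 4 → ℤ) : Prop := (∀ i, 0 < b i ∧ b i < 64) ∧ Odd (∑ i, b i)

instance (b : Fin 4 → ℤ) : Decidable (OddNumerators b) := by
  unfold OddNumerators; infer_instance

/-- Changing signs preserves parity, so each $\beta_I$ is an odd integer over 64 and never an
integer. -/
theorem intWeight_generic {b : Fin 4 → ℤ} (hb : OddNumerators b) (d : ℤ) :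
    intWeight b ∈ generic d := by
  refine ⟨fun i => ?_, ?_⟩
  · have h1 : (0 : ℝ) < b i := by exact_mod_cast (hb.1 i).1
    have h2 : (b i : ℝ) < 64 := by exact_mod_cast (hb.1 i).2
    exact ⟨by unfold intWeight; positivity, by unfold intWeight; rw [div_lt_one (by norm_num)]; exact h2⟩
  · rintro ⟨-, I, k, -, -, h⟩
    rw [weightSum_intWeight, div_eq_iff (by norm_num)] at h
    have h' : intSum b I = k * 64 := by exact_mod_cast h
    have e : ∑ i, b i = intSum b I + 2 * ∑ i ∈ Iᶜ, b i := by
      rw [← Finset.sum_add_sum_compl I, intSum]; ring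
    have hodd := hb.2
    rw [e, h', Int.odd_iff] at hodd
    omega

/-- The bounds on numerators that put a weight into both polytopes. -/
def InPolytopes (b : Fin 4 → ℤ) : Prop :=
  (∀ i, 0 ≤ b i ∧ b i ≤ 64) ∧
    (∀ I : Finset (Fin 4), I.card = 1 → -128 ≤ intSum b I ∧ intSum b I ≤ 0) ∧
    (-192 ≤ intSum b ∅ ∧ intSum b ∅ ≤ -64) ∧
    ∀ I : Finset (Fin 4), I.card = 2 → -64 ≤ intSum b I ∧ intSum b I ≤ 64

instance (b : Fin 4 → ℤ) : Decidable (InPolytopes b) := by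
  unfold InPolytopes; infer_instance

theorem intWeight_mem_polytope {b : Fin 4 → ℤ} (hb : InPolytopes b) (d : ℤ) :
    intWeight b ∈ polytope d := by
  obtain ⟨hb0, hb1, hb2, hb3⟩ := hb
  have hle : ∀ (I : Finset (Fin 4)) (k : ℤ), intSum b I ≤ 64 * k →
      weightSum (intWeight b) I ≤ k := fun I k h => weightSum_intWeight_le.2 h
  have hge : ∀ (I : Finset (Fin 4)) (k : ℤ), 64 * k ≤ intSum b I →
      k ≤ weightSum (intWeight b) I := fun I k h => le_weightSum_intWeight.2 h
  refine ⟨fun i => ?_, fun _ I hI => ?_, fun _ => ⟨?_, fun I hI => ?_⟩⟩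
  · have h1 : (0 : ℝ) ≤ b i := by exact_mod_cast (hb0 i).1
    have h2 : (b i : ℝ) ≤ 64 := by exact_mod_cast (hb0 i).2
    exact ⟨by unfold intWeight; positivity, by
      unfold intWeight; rw [div_le_one (by norm_num)]; exact h2⟩
  · have h1 := hge I (-2) (by linarith [(hb1 I hI).1])
    have h2 := hle I 0 (hb1 I hI).2
    exact ⟨by simpa using h1, by simpa using h2⟩
  · have h1 := hge ∅ (-3) (by linarith [hb2.1])
    have h2 := hle ∅ (-1) (by linarith [hb2.2])
    exact ⟨by simpa using h1, by simpa using h2⟩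
  · have h1 := hge I (-1) (by linarith [(hb3 I hI).1])
    have h2 := hle I 1 (hb3 I hI).2
    exact ⟨by simpa using h1, by simpa using h2⟩

/-- The numerators `t ± 2 ^ i`, with the negative sign over `A`. -/
def perturbed (t : ℤ) (A : Finset (Fin 4)) (i : Fin 4) : ℤ :=
  t + if i ∈ A then -(2 ^ (i : ℕ)) else 2 ^ (i : ℕ)

/-- Numerators near `0` over `A` and near `64` off `A`. -/
def extreme (A : Finset (Fin 4)) (i : Fin 4) : ℤ :=
  if i ∈ A then 2 ^ (i : ℕ) else 64 - 2 ^ (i : ℕ)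

theorem extreme_odd : ∀ A, OddNumerators (extreme A) := by decide

/-- The left side is $64(|A|-4)+15$: these weights nearly reach the infimum $|A|-4$ of $\beta_A$.
The 15 is $1+2+4+8$, the total perturbation that keeps the sum odd. -/
theorem intSum_extreme_self : ∀ A, intSum (extreme A) A < 64 * ((A.card : ℤ) - 3) := by decide

theorem perturbed_twenty_odd : ∀ A, OddNumerators (perturbed 20 A) := by decide

theorem perturbed_twenty_polytope : ∀ A, InPolytopes (perturbed 20 A) := by decide

/-- For two-element sets the constant 20 cancels and the signs leave $\mp15$. The value 20 makes
$4t-15\ge64$, which is what membership in both polytopes requires of $\beta_\emptyset$. -/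
theorem intSum_perturbed_twenty : ∀ A : Finset (Fin 4), A.card = 2 →
    intSum (perturbed 20 A) A < 0 ∧ 0 < intSum (perturbed 20 A) Aᶜ := by decide

theorem intSum_perturbed_twenty_of_card_le : ∀ A I : Finset (Fin 4), I.card ≤ 1 →
    intSum (perturbed 20 A) I < 0 := by decide

theorem intSum_perturbed_twenty_lt : ∀ A I : Finset (Fin 4),
    intSum (perturbed 20 A) I < 128 := by decide

theorem perturbed_odd : ∀ t ∈ ({24, 40, 48} : Finset ℤ), OddNumerators (perturbed t ∅) := by decide

theorem perturbed_polytope : ∀ t ∈ ({24, 40} : Finset ℤ), InPolytopes (perturbed t ∅) := by decide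

/-- Weights near $3/8$ separate the empty set from the others at the level $-1$ and the full set
from the others at the level $1$. -/
theorem intSum_perturbed_24 : intSum (perturbed 24 ∅) ∅ < -64 ∧
    (∀ I : Finset (Fin 4), I.card ≤ 3 → intSum (perturbed 24 ∅) I < 64) ∧
    (∀ I : Finset (Fin 4), intSum (perturbed 24 ∅) I < 192 ∧ -128 < intSum (perturbed 24 ∅) I) ∧
    ∀ I : Finset (Fin 4), I.Nonempty → -64 < intSum (perturbed 24 ∅) I := by decide

/-- Weights near $5/8$ push the full set above $2$, triples above $1$ and singletons below $-1$. -/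
theorem intSum_perturbed_40 : 128 < intSum (perturbed 40 ∅) Finset.univ ∧
    (∀ I : Finset (Fin 4), I.card ≤ 1 → intSum (perturbed 40 ∅) I < -64) ∧
    (∀ I : Finset (Fin 4), I.card ≤ 2 → intSum (perturbed 40 ∅) I < 64) ∧
    (∀ I : Finset (Fin 4), 3 ≤ I.card → 64 < intSum (perturbed 40 ∅) I) ∧
    ∀ I : Finset (Fin 4), intSum (perturbed 40 ∅) I < 192 := by decide

theorem intSum_perturbed_48 : intSum (perturbed 48 ∅) ∅ < -128 ∧
    (∀ I : Finset (Fin 4), I.card ≤ 3 → intSum (perturbed 48 ∅) I < 128) ∧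
    ∀ I : Finset (Fin 4), intSum (perturbed 48 ∅) I < 256 := by decide

/-! ### Stability of the zero section -/

open Classical in
/-- The marked points over which the flag lies in the line sub-bundle generated by `s`. -/
def meetSet (lam : ℂ) (F : QP) (s : Fin 2 → Poly) : Finset (Fin 4) := {i | Meets lam F s i}

theorem mem_meetSet {lam : ℂ} {F : QP} {s : Fin 2 → Poly} {i : Fin 4} :
    i ∈ meetSet lam F s ↔ Meets lam F s i := by simp [meetSet]

theorem stable_iota_iff {lam : ℂ} {m : Fin 2 → ℤ} {β : Fin 4 → ℝ} {F : QP} :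
    Stable β (iota lam m F) ↔ ∀ j, ∀ s ∈ lineGen m j,
      weightSum β (meetSet lam F s) < ((m 0 + m 1 - 2 * j : ℤ) : ℝ) := by
  constructor
  · intro h j s hs
    exact h j s hs ⟨0, Submodule.zero_mem _, by rw [zero_smul]; exact Matrix.zero_mulVec s⟩
  · intro h j s hs _
    exact h j s hs

theorem stable_intWeight_iota_iff {lam : ℂ} {m : Fin 2 → ℤ} {b : Fin 4 → ℤ} {F : QP} :
    Stable (intWeight b) (iota lam m F) ↔ ∀ j, ∀ s ∈ lineGen m j,
      intSum b (meetSet lam F s) < 64 * (m 0 + m 1 - 2 * j) := by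
  rw [stable_iota_iff]
  simp only [weightSum_intWeight_lt]

theorem exists_of_mem_B {lam : ℂ} {m : Fin 2 → ℤ} {I : Finset (Fin 4)} {j : ℤ} {F : QP}
    (h : F ∈ B lam m I j) : ∃ s ∈ lineGen m j, I ⊆ meetSet lam F s := by
  unfold B at h
  split_ifs at h
  · obtain ⟨s, hs, h⟩ := h
    exact ⟨s, hs, fun i hi => mem_meetSet.2 (h i hi)⟩
  · obtain ⟨s, hs, h⟩ := h
    exact ⟨s, hs, fun i hi => mem_meetSet.2 ((h i).1 hi)⟩

theorem mem_B_of_le {lam : ℂ} {m : Fin 2 → ℤ} {I : Finset (Fin 4)} {j : ℤ} {F : QP} (hj : j ≤ m 1) :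
    F ∈ B lam m I j ↔ ∃ s ∈ lineGen m j, I ⊆ meetSet lam F s := by
  refine ⟨exists_of_mem_B, ?_⟩
  rintro ⟨s, hs, h⟩
  rw [B, if_pos hj]
  exact ⟨s, hs, fun i hi => mem_meetSet.1 (h hi)⟩

theorem mem_B_top {lam : ℂ} {m : Fin 2 → ℤ} (hm : m 1 < m 0) {I : Finset (Fin 4)} {F : QP} :
    F ∈ B lam m I (m 0) ↔ I = meetSet lam F ![1, 0] := by
  rw [B, if_neg (not_le.2 hm)]
  constructor
  · rintro ⟨s, hs, h⟩
    ext i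
    rw [h, mem_meetSet, meets_top_iff hm hs, meets_top_iff hm (one_zero_mem_lineGen m)]
  · rintro rfl
    exact ⟨_, one_zero_mem_lineGen m, fun i => mem_meetSet⟩

/-- The second component of the generator is a nonzero constant, so the sub-bundle is transverse to
$E_1$ everywhere. -/
theorem disjoint_meetSet_second {lam : ℂ} {m : Fin 2 → ℤ} (hm : m 1 < m 0) {s : Fin 2 → Poly}
    (hs : s ∈ lineGen m (m 1)) (F : QP) :
    Disjoint (meetSet lam F s) (meetSet lam F ![1, 0]) := by
  rw [Finset.disjoint_left]
  intro i hi hi'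
  rw [mem_meetSet] at hi hi'
  rw [meets_top_iff hm (one_zero_mem_lineGen m)] at hi'
  rw [meets_iff_of_mem hi' fun e => by simpa using congrFun e 0] at hi
  obtain ⟨c, hc, h1⟩ := lineGen_second hm hs
  simp [wedge, h1, hc] at hi

/-- A flag off $E_1$ has the form $[c:1]$, so a sub-bundle generated by $(p,1)$ passes through it
once the form $p$, of degree $m_1-m_2$, takes the value $c$; interpolation handles $m_1-m_2+1$
flags. -/
theorem exists_lineGen_second {lam : ℂ} (h0 : lam ≠ 0) (h1 : lam ≠ 1) {m : Fin 2 → ℤ}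
    (hm : m 1 < m 0) {F : QP} {A : Finset (Fin 4)} (hA : (A.card : ℤ) ≤ m 0 - m 1 + 1)
    (hF : Disjoint A (meetSet lam F ![1, 0])) : ∃ s ∈ lineGen m (m 1), A ⊆ meetSet lam F s := by
  obtain ⟨p, hp, hpA⟩ := exists_form_interpolating h0 h1 (m 0 - m 1).toNat A (by omega)
    fun i => (F i).rep 0 / (F i).rep 1
  rw [Int.toNat_of_nonneg (by omega)] at hp
  refine ⟨_, mem_lineGen_second hp one_ne_zero, fun i hi => ?_⟩
  have h2 : (F i).rep 1 ≠ 0 := by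
    intro h
    refine Finset.disjoint_left.1 hF hi ?_
    rw [mem_meetSet, meets_top_iff hm (one_zero_mem_lineGen m),
      mem_submodule_iff (rep_mem _) (F i).rep_nonzero]
    simp [wedge, h]
  rw [mem_meetSet, meets_iff_of_mem (rep_mem _) (F i).rep_nonzero]
  simp [wedge, hpA i hi, h2]

theorem not_mem_U_iff {lam : ℂ} {m : Fin 2 → ℤ} {F : QP} :
    F ∉ U lam m ↔ ∃ I : Finset (Fin 4), F ∈ B lam m I (m 0) ∧ F ∈ B lam m Iᶜ (m 1) := by
  simp [U]

/-- Sub-bundles through complementary sets of flags would require $\beta_I<m_2-m_1$ and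
$-\beta_I<m_1-m_2$, whose sum is $0<0$. -/
theorem mem_U_of_stable {lam : ℂ} {m : Fin 2 → ℤ} {F : QP} {β : Fin 4 → ℝ}
    (hβ : ∀ i, 0 ≤ β i) (h : Stable β (iota lam m F)) : F ∈ U lam m := by
  by_contra hU
  obtain ⟨I, hI, hI'⟩ := not_mem_U_iff.1 hU
  obtain ⟨s, hs, hsI⟩ := exists_of_mem_B hI
  obtain ⟨s', hs', hsI'⟩ := exists_of_mem_B hI'
  rw [stable_iota_iff] at h
  have e1 := (weightSum_mono hβ hsI).trans_lt (h _ s hs)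
  have e2 := (weightSum_mono hβ hsI').trans_lt (h _ s' hs')
  rw [weightSum_compl] at e2
  push_cast at e1 e2
  linarith

/-- No sub-bundle of degree `m 1` may contain all flags off $E_1$. Interpolation would provide one
if at most $m_1-m_2+1$ such flags existed, which gives the first bound; transversality to $E_1$
gives the second. -/
theorem mem_U_of_lt {lam : ℂ} (h0 : lam ≠ 0) (h1 : lam ≠ 1) {m : Fin 2 → ℤ}
    (hm : m 1 < m 0) {F : QP} (hF : F ∈ U lam m) :
    ((meetSet lam F ![1, 0]).card : ℤ) ≤ 2 - m 0 + m 1 ∧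
      ∀ s ∈ lineGen m (m 1), (meetSet lam F s).card + (meetSet lam F ![1, 0]).card < 4 := by
  have key : ∀ s ∈ lineGen m (m 1), ¬ (meetSet lam F ![1, 0])ᶜ ⊆ meetSet lam F s := by
    intro s hs h
    exact not_mem_U_iff.2 ⟨_, (mem_B_top hm).2 rfl, (mem_B_of_le le_rfl).2 ⟨s, hs, h⟩⟩ hF
  constructor
  · by_contra h
    obtain ⟨s, hs, h⟩ := exists_lineGen_second h0 h1 hm (F := F) (A := (meetSet lam F ![1, 0])ᶜ)
      (by rw [Finset.card_compl, Fintype.card_fin]; omega) disjoint_compl_left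
    exact key s hs h
  · intro s hs
    have hsub : meetSet lam F s ⊂ (meetSet lam F ![1, 0])ᶜ :=
      ⟨fun i hi => by
        rw [Finset.mem_compl]
        exact Finset.disjoint_left.1 (disjoint_meetSet_second hm hs F) hi, key s hs⟩
    have := Finset.card_lt_card hsub
    rw [Finset.card_compl, Fintype.card_fin] at this
    omega

theorem exists_stable_of_lt {lam : ℂ} (h0 : lam ≠ 0) (h1 : lam ≠ 1) {m : Fin 2 → ℤ}
    (hm : m 1 < m 0) {F : QP} (hF : F ∈ U lam m) :
    ∃ b, OddNumerators b ∧ Stable (intWeight b) (iota lam m F) := by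
  obtain ⟨hE, hs⟩ := mem_U_of_lt h0 h1 hm hF
  have htop : ∀ s ∈ lineGen m (m 0), meetSet lam F s = meetSet lam F ![1, 0] := by
    intro s hs
    ext i
    rw [mem_meetSet, mem_meetSet, meets_top_iff hm hs, meets_top_iff hm (one_zero_mem_lineGen m)]
  -- Below degree `m 1` the threshold is at least $m_1-m_2+2$, so one bound uniform in the set of
  -- flags covers all these sub-bundles.
  suffices ∃ b, OddNumerators b ∧ intSum b (meetSet lam F ![1, 0]) < 64 * (m 1 - m 0) ∧
      (∀ s ∈ lineGen m (m 1), intSum b (meetSet lam F s) < 64 * (m 0 - m 1)) ∧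
      ∀ I, intSum b I < 64 * (m 0 - m 1 + 2) by
    obtain ⟨b, hb, hb0, hb1, hb2⟩ := this
    refine ⟨b, hb, stable_intWeight_iota_iff.2 fun j s hs => ?_⟩
    rcases le_or_of_lineGen hs with hj | rfl
    · rcases hj.eq_or_lt with rfl | hj
      · exact (hb1 s hs).trans_le (by linarith)
      · exact (hb2 _).trans_le (by omega)
    · rw [htop s hs]
      exact hb0.trans_le (by linarith)
  -- The bound on the flags in $E_1$ leaves three cases: difference 1 with no flag or one flag in
  -- $E_1$, and difference 2 with none. The numerators 24, 40 and 48 serve them in this order.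
  rcases (show m 0 - m 1 = 1 ∨ m 0 - m 1 = 2 by omega) with hn | hn
  · rcases Nat.eq_zero_or_pos (meetSet lam F ![1, 0]).card with h | h
    · obtain ⟨e1, e2, e3, -⟩ := intSum_perturbed_24
      refine ⟨_, perturbed_odd 24 (by decide), ?_, fun s hs' => ?_, fun I => ?_⟩
      · rw [Finset.card_eq_zero.1 h]
        exact e1.trans_le (by omega)
      · exact (e2 _ (by have := hs s hs'; omega)).trans_le (by omega)
      · exact (e3 I).1.trans_le (by omega)
    · obtain ⟨-, e1, e2, -, e3⟩ := intSum_perturbed_40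
      refine ⟨_, perturbed_odd 40 (by decide), ?_, fun s hs' => ?_, fun I => ?_⟩
      · exact (e1 _ (by omega)).trans_le (by omega)
      · exact (e2 _ (by have := hs s hs'; omega)).trans_le (by omega)
      · exact (e3 I).trans_le (by omega)
  · have h : (meetSet lam F ![1, 0]).card = 0 := by omega
    obtain ⟨e1, e2, e3⟩ := intSum_perturbed_48
    refine ⟨_, perturbed_odd 48 (by decide), ?_, fun s hs' => ?_, fun I => ?_⟩
    · rw [Finset.card_eq_zero.1 h]
      exact e1.trans_le (by omega)
    · exact (e2 _ (by have := hs s hs'; omega)).trans_le (by omega)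
    · exact (e3 I).trans_le (by omega)

/-- For a balanced bundle there is a constant line sub-bundle through any one flag. -/
theorem exists_constant_lineGen {lam : ℂ} {m : Fin 2 → ℤ} (hm : m 0 = m 1) (F : QP) (k : Fin 4) :
    ∃ s ∈ lineGen m (m 1), ∀ i, Meets lam F s i ↔ F i = F k := by
  refine ⟨fun a => C ((F k).rep a), ⟨fun a => ?_, fun v _ => ?_⟩, fun i => ?_⟩
  · rw [show m a - m 1 = 0 by fin_cases a <;> simp [hm]]
    exact C_mem_forms _
  · obtain ⟨a, ha⟩ := Function.ne_iff.1 (F k).rep_nonzero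
    exact ⟨a, by simpa using ha⟩
  · have : (fun a => eval (marked lam i) (C ((F k).rep a) : Poly)) = (F k).rep := by ext a; simp
    rw [Meets, this]
    constructor
    · intro h
      exact P1_eq_of_mem (F k).rep_nonzero h (rep_mem _)
    · intro h
      rw [h]
      exact rep_mem _

theorem eval_constant_lineGen {m : Fin 2 → ℤ} (hm : m 0 = m 1) {s : Fin 2 → Poly}
    (hs : s ∈ lineGen m (m 1)) : ∃ c : Fin 2 → ℂ, c ≠ 0 ∧ ∀ a, s a = C (c a) := by
  have h : ∀ a, s a = C (constantCoeff (s a)) := by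
    intro a
    have := hs.1 a
    rw [show m a - m 1 = 0 by fin_cases a <;> simp [hm]] at this
    exact forms_zero_eq_C this
  refine ⟨fun a => constantCoeff (s a), fun hc => ?_, h⟩
  obtain ⟨a, ha⟩ := hs.2 ![1, 0] fun e => by simpa using congrFun e 0
  rw [h a, congrFun hc a] at ha
  simp at ha

theorem flag_eq_of_constant {lam : ℂ} {m : Fin 2 → ℤ} (hm : m 0 = m 1) {s : Fin 2 → Poly}
    (hs : s ∈ lineGen m (m 1)) {F : QP} {i k : Fin 4} (hi : i ∈ meetSet lam F s)
    (hk : k ∈ meetSet lam F s) : F i = F k := by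
  obtain ⟨c, hc, h⟩ := eval_constant_lineGen hm hs
  rw [mem_meetSet] at hi hk
  unfold Meets at hi hk
  simp only [h, eval_C] at hi hk
  exact P1_eq_of_mem hc hi hk

/-- Sub-bundles of top degree are constant lines, so their nonempty incidence sets are the classes
of equal flags. Since no two of these sets cover all four indices, classes have at most two elements
and at most one class `A` has two; lowering the weights on `A` makes $\beta_A<0$. -/
theorem exists_stable_of_eq {lam : ℂ} {m : Fin 2 → ℤ}
    (hm : m 0 = m 1) {F : QP} (hF : F ∈ U lam m) :
    ∃ b, OddNumerators b ∧ Stable (intWeight b) (iota lam m F) := by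
  have key : ∀ s ∈ lineGen m (m 1), ∀ s' ∈ lineGen m (m 1),
      ¬ (meetSet lam F s)ᶜ ⊆ meetSet lam F s' := by
    intro s hs s' hs' h
    refine not_mem_U_iff.2 ⟨meetSet lam F s, ?_, (mem_B_of_le le_rfl).2 ⟨s', hs', h⟩⟩ hF
    rw [hm]
    exact (mem_B_of_le le_rfl).2 ⟨s, hs, subset_rfl⟩
  have hcard : ∀ s ∈ lineGen m (m 1), (meetSet lam F s).card ≤ 2 := by
    intro s hs
    by_contra hc
    have h3 : (meetSet lam F s)ᶜ.card ≤ 1 := by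
      rw [Finset.card_compl, Fintype.card_fin]; omega
    -- With three equal flags, the constant line through the fourth would complete a cover.
    obtain ⟨k, hk⟩ := Finset.card_le_one_iff_subset_singleton.1 h3
    obtain ⟨s', hs', h'⟩ := exists_constant_lineGen (lam := lam) hm F k
    refine key s hs s' hs' (hk.trans ?_)
    rw [Finset.singleton_subset_iff, mem_meetSet, h']
  obtain ⟨A, hA⟩ : ∃ A : Finset (Fin 4), ∀ s ∈ lineGen m (m 1),
      (meetSet lam F s).card ≤ 1 ∨ (meetSet lam F s = A ∧ A.card = 2) := by
    by_cases hex : ∃ s ∈ lineGen m (m 1), (meetSet lam F s).card = 2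
    · obtain ⟨s, hs, hs2⟩ := hex
      refine ⟨meetSet lam F s, fun s' hs' => ?_⟩
      rcases (hcard s' hs').lt_or_eq with h | h
      · left; omega
      · right
        refine ⟨?_, hs2⟩
        -- Disjoint pairs would be complementary, which is excluded; pairs with a common index are
        -- the same class.
        by_cases hdis : Disjoint (meetSet lam F s) (meetSet lam F s')
        · exfalso
          refine key s hs s' hs' ?_
          have hsub : meetSet lam F s' ⊆ (meetSet lam F s)ᶜ := by
            intro i hi
            rw [Finset.mem_compl]
            exact Finset.disjoint_right.1 hdis hi
          rw [Finset.eq_of_subset_of_card_le hsub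
            (by rw [Finset.card_compl, Fintype.card_fin]; omega)]
        · obtain ⟨k, hk, hk'⟩ := Finset.not_disjoint_iff.1 hdis
          have hmem : ∀ s ∈ lineGen m (m 1), k ∈ meetSet lam F s →
              ∀ i, i ∈ meetSet lam F s ↔ F i = F k := by
            intro s hs hk i
            refine ⟨fun hi => flag_eq_of_constant hm hs hi hk, fun h => ?_⟩
            obtain ⟨c, -, hc⟩ := eval_constant_lineGen hm hs
            rw [mem_meetSet] at hk ⊢
            unfold Meets at hk ⊢
            simp only [hc, eval_C] at hk ⊢
            rwa [h]
          ext i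
          rw [hmem s hs hk, hmem s' hs' hk']
    · refine ⟨∅, fun s hs => Or.inl ?_⟩
      have h1 := hcard s hs
      have h2 : (meetSet lam F s).card ≠ 2 := fun h => hex ⟨s, hs, h⟩
      omega
  refine ⟨_, perturbed_twenty_odd A, stable_intWeight_iota_iff.2 fun j s hs => ?_⟩
  have hj : j ≤ m 1 := by rcases le_or_of_lineGen hs with h | h <;> omega
  rcases hj.eq_or_lt with rfl | hj
  · rw [hm, show m 1 + m 1 - 2 * m 1 = 0 by ring, mul_zero]
    rcases hA s hs with h | ⟨h, h2⟩
    · exact intSum_perturbed_twenty_of_card_le A _ h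
    · rw [h]
      exact (intSum_perturbed_twenty A h2).1
  · exact (intSum_perturbed_twenty_lt A _).trans_le (by omega)

theorem condStable_Q {lam : ℂ} (h0 : lam ≠ 0) (h1 : lam ≠ 1) {m : Fin 2 → ℤ} (hm : m 1 ≤ m 0) :
    condStable (Q lam m) = iota lam m '' U lam m := by
  ext x
  rw [mem_condStable_iff]
  constructor
  · rintro ⟨⟨F, rfl⟩, β, hβ, hst⟩
    exact ⟨F, mem_U_of_stable (fun i => (hβ.1 i).1.le) hst, rfl⟩
  · rintro ⟨F, hF, rfl⟩
    refine ⟨⟨F, rfl⟩, ?_⟩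
    obtain ⟨b, hb, hst⟩ : ∃ b, OddNumerators b ∧ Stable (intWeight b) (iota lam m F) := by
      rcases hm.eq_or_lt with h | h
      · exact exists_stable_of_eq h.symm hF
      · exact exists_stable_of_lt h0 h1 h hF
    exact ⟨_, intWeight_generic hb _, hst⟩

theorem U_eq_empty {lam : ℂ} (h0 : lam ≠ 0) (h1 : lam ≠ 1) {m : Fin 2 → ℤ}
    (hm : 3 ≤ m 0 - m 1) : U lam m = ∅ := by
  ext F
  refine ⟨fun hF => ?_, False.elim⟩
  have := (mem_U_of_lt h0 h1 (by omega) hF).1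
  omega

/-! ### Stability of nilpotent Higgs fields -/

/-- The infimum $|J|-4$ is not attained on the open cube, which shifts the bound to $k+3$; the
weights `extreme J` come within $15/64$ of it. -/
theorem exists_generic_weightSum_lt_iff (d k : ℤ) (J : Finset (Fin 4)) :
    (∃ β ∈ generic d, weightSum β J < k) ↔ (J.card : ℤ) ≤ k + 3 := by
  constructor
  · rintro ⟨β, hβ, h⟩
    have h2 := (lt_weightSum hβ.1 J).trans h
    have h2' : (J.card : ℤ) - 4 < k := by exact_mod_cast h2
    omega
  · intro h
    refine ⟨_, intWeight_generic (extreme_odd J) d, weightSum_intWeight_lt.2 ?_⟩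
    exact (intSum_extreme_self J).trans_le (by omega)

theorem mem_condStable_iff_of_nilpotent {lam : ℂ} (h0 : lam ≠ 0) (h1 : lam ≠ 1) {m : Fin 2 → ℤ}
    {T : Set (HiggsPair lam m)} {x : HiggsPair lam m} (hT : x ∈ T) (hx : x ∈ QPHnil lam m)
    (hne : x.field ≠ 0) {j : ℤ}
    {s : Fin 2 → Poly} (hs : s ∈ lineGen m j) (hker : x.field.mulVec s = 0) :
    x ∈ condStable T ↔ ((meetSet lam x.flag s).card : ℤ) ≤ m 0 + m 1 - 2 * j + 3 := by
  rw [mem_condStable_iff, ← exists_generic_weightSum_lt_iff (m 0 + m 1)]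
  simp only [stable_iff_of_nilpotent h0 h1 hx hne hs hker]
  exact and_iff_right hT

theorem condStable_R {lam : ℂ} (h0 : lam ≠ 0) (h1 : lam ≠ 1) {m : Fin 2 → ℤ} (hm : m 1 < m 0) :
    condStable (R lam m) =
      ⋃ I ∈ {I : Finset (Fin 4) | (I.card : ℤ) ≤ 3 - m 0 + m 1}, RI lam m I := by
  ext x
  simp only [Set.mem_iUnion, Set.mem_ofPred_eq, RI, mem_B_top hm, exists_prop]
  constructor
  · intro h
    have hx := h.1
    rw [mem_condStable_iff_of_nilpotent h0 h1 hx hx.1 hx.2.1 (one_zero_mem_lineGen m) hx.2.2] at h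
    exact ⟨_, by linarith, hx, rfl⟩
  · rintro ⟨I, hI, hx, rfl⟩
    rw [mem_condStable_iff_of_nilpotent h0 h1 hx hx.1 hx.2.1 (one_zero_mem_lineGen m) hx.2.2]
    linarith

theorem disjoint_RI (lam : ℂ) {m : Fin 2 → ℤ} (hm : m 1 < m 0) :
    Pairwise fun I I' => Disjoint (RI lam m I) (RI lam m I') := by
  intro I I' hne
  rw [Set.disjoint_left]
  rintro x ⟨-, hx⟩ ⟨-, hx'⟩
  rw [mem_B_top hm] at hx hx'
  exact hne (hx.trans hx'.symm)

theorem meetSet_eq_of_kernel {lam : ℂ} (h0 : lam ≠ 0) (h1 : lam ≠ 1) {m : Fin 2 → ℤ}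
    {x : HiggsPair lam m} (hx : x ∈ QPHnil lam m) (hne : x.field ≠ 0) {j j' : ℤ}
    {s s' : Fin 2 → Poly} (hs : s ∈ lineGen m j) (hker : x.field.mulVec s = 0)
    (hs' : s' ∈ lineGen m j') (hker' : x.field.mulVec s' = 0) (F : QP) :
    meetSet lam F s' = meetSet lam F s := by
  obtain ⟨-, c, hc, rfl⟩ := exists_eq_smul_of_lineGen hs hs'
    (wedge_eq_of_invariant h0 h1 hx hne hker hs' (t := 0) (by rw [hker', zero_smul]))
  ext i
  rw [mem_meetSet, mem_meetSet, meets_smul hc]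

theorem mem_SI_iff {lam : ℂ} (h0 : lam ≠ 0) (h1 : lam ≠ 1) {m : Fin 2 → ℤ} {I : Finset (Fin 4)}
    {j : ℤ} {x : HiggsPair lam m} (hx : x ∈ S lam m j) {s : Fin 2 → Poly} (hs : s ∈ lineGen m j)
    (hker : x.field.mulVec s = 0) : x ∈ SI lam m I j ↔ I = meetSet lam x.flag s := by
  constructor
  · rintro ⟨-, s', hs', hker', h⟩
    rw [← meetSet_eq_of_kernel h0 h1 hx.1 hx.2.1 hs hker hs' hker']
    ext i
    rw [h, mem_meetSet]
  · rintro rfl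
    exact ⟨hx, s, hs, hker, fun i => mem_meetSet⟩

theorem disjoint_SI {lam : ℂ} (h0 : lam ≠ 0) (h1 : lam ≠ 1) (m : Fin 2 → ℤ) (j : ℤ) :
    Pairwise fun I I' => Disjoint (SI lam m I j) (SI lam m I' j) := by
  intro I I' hne
  rw [Set.disjoint_left]
  intro x hx hx'
  obtain ⟨s, hs, hker⟩ := hx.1.2.2
  exact hne (((mem_SI_iff h0 h1 hx.1 hs hker).1 hx).trans
    ((mem_SI_iff h0 h1 hx.1 hs hker).1 hx').symm)

/-- A kernel of degree `j` passes through at least `deg E - 2 j + 2` flags. -/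
theorem card_meetSet_of_mem_S {lam : ℂ} (h0 : lam ≠ 0) (h1 : lam ≠ 1) {m : Fin 2 → ℤ}
    {j : ℤ} {x : HiggsPair lam m} (hx : x ∈ S lam m j) {s : Fin 2 → Poly} (hs : s ∈ lineGen m j)
    (hker : x.field.mulVec s = 0) : m 0 + m 1 - 2 * j + 2 ≤ (meetSet lam x.flag s).card := by
  obtain ⟨q, hq, hq0, hΦ⟩ := exists_eq_nilMat h0 h1 hx.1.1 hx.2.1 hs hker
  have hx' : (⟨x.flag, nilMat q s⟩ : HiggsPair lam m) ∈ QPHnil lam m := by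
    rw [← hΦ]; exact hx.1
  rw [nilMat_mem_QPHnil_iff h0 h1 hq hs] at hx'
  by_contra hc
  -- The scale vanishes wherever the flag is off the kernel, and a nonzero form has no more zeros
  -- than its degree $2+2j-\deg E$.
  refine hq0 (forms_eq_zero_of_eval h0 h1 (meetSet lam x.flag s)ᶜ hq ?_ fun i hi => ?_)
  · rw [Finset.card_compl, Fintype.card_fin]
    have := Finset.card_le_univ (meetSet lam x.flag s)
    rw [Fintype.card_fin] at this
    omega
  · rw [Finset.mem_compl, mem_meetSet] at hi
    exact (hx' i).resolve_right hi

theorem condStable_S_top {lam : ℂ} (h0 : lam ≠ 0) (h1 : lam ≠ 1) {m : Fin 2 → ℤ} (hm : m 0 = m 1) :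
    condStable (S lam m (m 1)) =
      ⋃ I ∈ {I : Finset (Fin 4) | I.card = 2 ∨ I.card = 3}, SI lam m I (m 1) := by
  ext x
  simp only [Set.mem_iUnion, Set.mem_ofPred_eq, exists_prop]
  constructor
  · intro h
    have hx := h.1
    obtain ⟨s, hs, hker⟩ := hx.2.2
    rw [mem_condStable_iff_of_nilpotent h0 h1 hx hx.1 hx.2.1 hs hker] at h
    have := card_meetSet_of_mem_S h0 h1 hx hs hker
    exact ⟨_, by omega, (mem_SI_iff h0 h1 hx hs hker).2 rfl⟩
  · rintro ⟨I, hI, hxI⟩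
    have hx := hxI.1
    obtain ⟨s, hs, hker⟩ := hx.2.2
    obtain rfl := (mem_SI_iff h0 h1 hx hs hker).1 hxI
    rw [mem_condStable_iff_of_nilpotent h0 h1 hx hx.1 hx.2.1 hs hker]
    omega

/-- Here $\deg E-2j\ge1$, so the admissible number of flags on the kernel is at least four and the
condition is empty. -/
theorem condStable_S {lam : ℂ} (h0 : lam ≠ 0) (h1 : lam ≠ 1) {m : Fin 2 → ℤ} {j : ℤ}
    (hj : 2 * j < m 0 + m 1) : condStable (S lam m j) = S lam m j := by
  ext x
  refine ⟨fun h => h.1, fun hx => ?_⟩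
  obtain ⟨s, hs, hker⟩ := hx.2.2
  rw [mem_condStable_iff_of_nilpotent h0 h1 hx hx.1 hx.2.1 hs hker]
  have := Finset.card_le_univ (meetSet lam x.flag s)
  rw [Fintype.card_fin] at this
  omega

/-! ### Stability for all interior chambers -/

theorem stable_of_forall_interior {lam : ℂ} {m : Fin 2 → ℤ} {x : HiggsPair lam m}
    (h : ∀ C, IsInteriorChamber (m 0 + m 1) C → StableOn C x) {b : Fin 4 → ℤ}
    (hb : OddNumerators b) (hb' : InPolytopes b) : Stable (intWeight b) x := by
  obtain ⟨C, hC, hbC⟩ := exists_chamber (intWeight_generic hb (m 0 + m 1))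
  exact h C (isInteriorChamber_of_mem hC hbC (intWeight_mem_polytope hb' _)) _ hbC

/-- Each excluded incidence is destabilized by a test weight in the polytope: near $5/16$, perturbed
according to the pair, for two equal flags; near $5/8$ for four flags on a sub-bundle of degree
$m-1$ or three on one of degree $m_2$; near $3/8$ for a flag in $E_1$, and for every $F$ when
$m_1-m_2\ge2$. -/
theorem mem_U'_of_stable {lam : ℂ} {m : Fin 2 → ℤ} (hm : m 1 ≤ m 0) {F : QP}
    (h : ∀ b, OddNumerators b → InPolytopes b → Stable (intWeight b) (iota lam m F)) :
    F ∈ U' lam m := by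
  simp only [stable_intWeight_iota_iff] at h
  have h24 := h _ (perturbed_odd 24 (by decide)) (perturbed_polytope 24 (by decide))
  have h40 := h _ (perturbed_odd 40 (by decide)) (perturbed_polytope 40 (by decide))
  unfold U'
  split_ifs with hn hn
  · simp only [Set.mem_sdiff, Set.mem_iInter, Set.mem_ofPred_eq, Set.mem_compl_iff]
    refine ⟨fun I hI hF => ?_, fun hF => ?_⟩
    · obtain ⟨s, hs, hsI⟩ := exists_of_mem_B hF
      have hst := h _ (perturbed_twenty_odd Iᶜ) (perturbed_twenty_polytope Iᶜ) _ s hs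
      have hpos := (intSum_perturbed_twenty Iᶜ
        (by rw [Finset.card_compl, Fintype.card_fin, hI])).2
      rw [compl_compl] at hpos
      have := intSum_mono (fun i => ((perturbed_twenty_odd Iᶜ).1 i).1.le) hsI
      omega
    · obtain ⟨s, hs, hsI⟩ := exists_of_mem_B hF
      have hst := h40 _ s hs
      rw [Finset.univ_subset_iff.1 hsI] at hst
      have := intSum_perturbed_40.1
      omega
  · simp only [Set.mem_sdiff, Set.mem_iUnion, Set.mem_ofPred_eq, not_exists]
    refine ⟨(mem_B_top (by omega)).2 ?_, fun I hI hF => ?_⟩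
    · by_contra hne
      have h1 := h24 _ _ (one_zero_mem_lineGen m)
      have h2 := intSum_perturbed_24.2.2.2 _ (Finset.nonempty_iff_ne_empty.2 fun e => hne e.symm)
      omega
    · obtain ⟨s, hs, hsI⟩ := exists_of_mem_B hF
      have hst := h40 _ s hs
      have h2 := intSum_perturbed_40.2.2.2.1 _ (hI.trans (Finset.card_le_card hsI))
      omega
  · have h1 := h24 _ _ (one_zero_mem_lineGen m)
    have h2 := (intSum_perturbed_24.2.2.1 (meetSet lam F ![1, 0])).2
    omega

/-- Most inequalities follow from $\beta_I<|I|$. The rest are the bounds of the polytope for $I$ or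
for its complement; they become strict because a generic weight attains no integer of the parity of
$\deg E$. -/
theorem stable_of_mem_U' {lam : ℂ} {m : Fin 2 → ℤ} {F : QP} (hF : F ∈ U' lam m)
    {β : Fin 4 → ℝ} (hβ : β ∈ generic (m 0 + m 1)) (hp : β ∈ polytope (m 0 + m 1)) :
    Stable β (iota lam m F) := by
  have hlt : ∀ (I : Finset (Fin 4)) (k : ℤ), Even (k - (m 0 + m 1)) → weightSum β I ≤ k →
      weightSum β I < k := fun I k hk h => lt_of_le_of_ne h (weightSum_ne_of_generic hβ I hk)
  have hle : ∀ (I : Finset (Fin 4)) (k : ℤ), (I.card : ℤ) ≤ k → weightSum β I < k :=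
    fun I k h => (weightSum_lt_card hβ.1 I).trans_le (by exact_mod_cast h)
  rw [stable_iota_iff]
  intro j s hs
  have hpar : Even ((m 0 + m 1 - 2 * j) - (m 0 + m 1)) := ⟨-j, by ring⟩
  set I := meetSet lam F s with hI
  have hI4 : I.card ≤ 4 := by simpa using Finset.card_le_univ I
  unfold U' at hF
  split_ifs at hF with hn hn
  · simp only [Set.mem_sdiff, Set.mem_iInter, Set.mem_ofPred_eq, Set.mem_compl_iff] at hF
    obtain ⟨hF1, hF2⟩ := hF
    have hpoly := hp.2.1 ⟨m 1, by omega⟩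
    have hj : j ≤ m 1 := by rcases le_or_of_lineGen hs with h | h <;> omega
    rcases hj.eq_or_lt with rfl | hj
    · have hc : I.card ≤ 1 := by
        by_contra hc
        obtain ⟨A, hA, hA2⟩ := Finset.exists_subset_card_eq (s := I) (n := 2) (by omega)
        exact hF1 A hA2 ((mem_B_of_le le_rfl).2 ⟨s, hs, hA⟩)
      rcases Nat.le_one_iff_eq_zero_or_eq_one.1 hc with hc | hc
      · exact hle _ _ (by omega)
      · refine hlt _ _ hpar ?_
        rw [show m 0 + m 1 - 2 * m 1 = 0 by omega]
        simpa using (hpoly I hc).2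
    · by_cases hj1 : j = m 1 - 1
      · subst hj1
        have hc : I.card ≠ 4 := by
          intro hc
          refine hF2 ((mem_B_of_le (by omega)).2 ⟨s, hs, ?_⟩)
          rw [← hI, Finset.eq_univ_of_card I (by simpa using hc)]
        by_cases hc3 : I.card = 3
        · refine hlt _ _ hpar ?_
          have h3 := (hpoly Iᶜ (by rw [Finset.card_compl, Fintype.card_fin, hc3])).1
          rw [weightSum_compl] at h3
          rw [show m 0 + m 1 - 2 * (m 1 - 1) = 2 by omega]
          push_cast
          linarith
        · exact hle _ _ (by omega)
      · exact hle _ _ (by omega)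
  · simp only [Set.mem_sdiff, Set.mem_iUnion, Set.mem_ofPred_eq, not_exists] at hF
    obtain ⟨hF1, hF2⟩ := hF
    have hpoly := hp.2.2 ⟨m 1, by omega⟩
    rcases le_or_of_lineGen hs with hj | rfl
    · rcases hj.eq_or_lt with rfl | hj
      · have hc : I.card ≤ 2 := by
          by_contra hc
          exact hF2 I (by omega) ((mem_B_of_le le_rfl).2 ⟨s, hs, hI.le⟩)
        by_cases hc2 : I.card = 2
        · refine hlt _ _ hpar ?_
          rw [show m 0 + m 1 - 2 * m 1 = 1 by omega]
          simpa using (hpoly.2 I hc2).2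
        · exact hle _ _ (by omega)
      · by_cases hj1 : j = m 1 - 1 ∧ I.card = 4
        · refine hlt _ _ hpar ?_
          have h3 := hpoly.1.1
          rw [← compl_compl ∅, weightSum_compl, Finset.compl_empty] at h3
          rw [Finset.eq_univ_of_card I (by simpa using hj1.2),
            show m 0 + m 1 - 2 * j = 3 by omega]
          push_cast
          linarith
        · exact hle _ _ (by omega)
    · have hIe : I = ∅ := by
        rw [(mem_B_top (by omega)).1 hF1]
        ext i
        rw [hI, mem_meetSet, mem_meetSet, meets_top_iff (by omega) hs,
          meets_top_iff (by omega) (one_zero_mem_lineGen m)]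
      refine hlt _ _ hpar ?_
      rw [show m 0 + m 1 - 2 * m 0 = -1 by omega, hIe]
      simpa using hpoly.1.2
  · exact hF.elim

theorem stable_for_interior_chambers {lam : ℂ} {m : Fin 2 → ℤ} (hm : m 1 ≤ m 0) :
    {x ∈ condStable (Q lam m) | ∀ C, IsInteriorChamber (m 0 + m 1) C → StableOn C x} =
      iota lam m '' U' lam m := by
  ext x
  constructor
  · rintro ⟨⟨⟨F, rfl⟩, -⟩, h⟩
    exact ⟨F, mem_U'_of_stable hm fun b hb hb' => stable_of_forall_interior h hb hb', rfl⟩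
  · rintro ⟨F, hF, rfl⟩
    -- Conditional stability needs one actual weight, and the one near $3/8$ lies in both polytopes.
    refine ⟨mem_condStable_iff.2 ⟨⟨F, rfl⟩, _,
      intWeight_generic (perturbed_odd 24 (by decide)) _, stable_of_mem_U' hF
      (intWeight_generic (perturbed_odd 24 (by decide)) _)
      (intWeight_mem_polytope (perturbed_polytope 24 (by decide)) _)⟩, fun C hC β hβ => ?_⟩
    exact stable_of_mem_U' hF (hC.1.subset_generic hβ) (hC.2 hβ)

/-! ### Free and transitive actions -/

theorem autMat_mul_field {lam : ℂ} {m : Fin 2 → ℤ} {g : AutE m} {x : HiggsPair lam m} :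
    (g • x).field * autMat g = autMat g * x.field := by
  rw [smul_field, mul_assoc, autMat_inv_mul, mul_one]

/-- Commuting with a field of kernel $E_1$ equates the diagonal entries of the triangular matrix. It
then fixes a flag off $E_1$ only if its corner entry vanishes there. Stability leaves at least
$m_1-m_2+1$ such flags, one more than the degree of that entry. -/
theorem actsFreelyOn_condStable_R {lam : ℂ} (h0 : lam ≠ 0) (h1 : lam ≠ 1) {m : Fin 2 → ℤ}
    (hm : m 1 < m 0) : ActsFreelyOn (PAut m) (condStable (R lam m)) := by
  refine actsFreelyOn_of_aut (fun g x hx => smul_mem_condStable (fun g x hx => ?_) g hx) ?_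
  · rw [R_eq_S hm] at hx ⊢
    exact smul_mem_S h0 h1 g hx
  intro x hx g hg
  have hxR := hx.1
  rw [mem_condStable_iff_of_nilpotent h0 h1 hxR hxR.1 hxR.2.1 (one_zero_mem_lineGen m)
    hxR.2.2] at hx
  obtain ⟨q, -, hq0, hΦ⟩ := exists_eq_nilMat h0 h1 hxR.1.1 hxR.2.1 (one_zero_mem_lineGen m) hxR.2.2
  obtain ⟨a, c, ha, -, e00, e10, e11⟩ := exists_autMat_of_lt hm g
  have hcomm := autMat_mul_field (g := g) (x := x)
  rw [hg, hΦ] at hcomm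
  have hac : (C a : Poly) = C c := by
    have h := congrFun (congrFun hcomm 0) 1
    rw [Matrix.mul_apply, Matrix.mul_apply, Fin.sum_univ_two, Fin.sum_univ_two, nilMat_zero_zero,
      nilMat_zero_one, nilMat_one_one, e00, e11] at h
    simp only [Matrix.cons_val_zero, Matrix.cons_val_one, mul_zero, neg_zero, add_zero, one_pow,
      mul_one, zero_mul, zero_add] at h
    exact mul_left_cancel₀ hq0 (by linear_combination h)
  have hp : autMat g 0 1 = 0 := by
    refine forms_eq_zero_of_eval h0 h1 (meetSet lam x.flag ![1, 0])ᶜ (autMat_mem g 0 1) ?_ ?_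
    · rw [Finset.card_compl, Fintype.card_fin]
      omega
    · intro i hi
      rw [Finset.mem_compl, mem_meetSet, meets_top_iff hm (one_zero_mem_lineGen m),
        mem_submodule_iff (rep_mem _) (x.flag i).rep_nonzero] at hi
      have hmem := mulVec_mem_smul_flag g x i (rep_mem _)
      rw [hg, mem_submodule_iff (rep_mem _) (x.flag i).rep_nonzero] at hmem
      set v := (x.flag i).rep
      have e00' : autEval g (marked lam i) 0 0 = a := by
        rw [autEval, Matrix.map_apply, e00, eval_C]
      have e10' : autEval g (marked lam i) 1 0 = 0 := by
        rw [autEval, Matrix.map_apply, e10, map_zero]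
      have e11' : autEval g (marked lam i) 1 1 = a := by
        rw [autEval, Matrix.map_apply, e11, ← hac, eval_C]
      have e01' : autEval g (marked lam i) 0 1 = eval (marked lam i) (autMat g 0 1) := rfl
      simp only [wedge, Matrix.mulVec, dotProduct, Fin.sum_univ_two, e00', e10', e11', e01'] at hmem
      simp only [wedge, Matrix.cons_val_zero, Matrix.cons_val_one, one_mul, zero_mul,
        sub_zero] at hi
      exact (mul_eq_zero.1 (show eval (marked lam i) (autMat g 0 1) * (v 1 * v 1) = 0 by
        linear_combination hmem)).resolve_right (mul_self_ne_zero.2 hi)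
  refine mem_scalars_of_eq (c := a) ?_
  rw [Fin.forall_fin_two, Fin.forall_fin_two, Fin.forall_fin_two]
  simp [e00, e10, e11, hp, hac]

/-- A constant automorphism with two independent eigenvectors of the same eigenvalue is scalar. -/
theorem mem_scalars_of_eigenvectors {m : Fin 2 → ℤ} (hm : m 0 = m 1) {g : AutE m}
    {z z' u v : Fin 2 → ℂ} {k : ℂ} (hu : (autEval g z).mulVec u = k • u)
    (hv : (autEval g z').mulVec v = k • v) (huv : wedge u v ≠ 0) : g ∈ scalars m := by
  obtain ⟨A, hA⟩ : ∃ A : Matrix (Fin 2) (Fin 2) ℂ, ∀ a b, autMat g a b = C (A a b) :=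
    ⟨fun a b => constantCoeff (autMat g a b), autMat_eq_C_of_eq hm g⟩
  have hE : ∀ z, autEval g z = A := by
    intro z
    ext a b
    rw [autEval, Matrix.map_apply, hA, eval_C]
  rw [hE] at hu hv
  have hu0 := congrFun hu 0
  have hu1 := congrFun hu 1
  have hv0 := congrFun hv 0
  have hv1 := congrFun hv 1
  simp only [Matrix.mulVec, dotProduct, Fin.sum_univ_two, Pi.smul_apply, smul_eq_mul]
    at hu0 hu1 hv0 hv1
  have e00 : A 0 0 = k := mul_right_cancel₀ huv (by
    simp only [wedge]; linear_combination v 1 * hu0 - u 1 * hv0)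
  have e01 : A 0 1 = 0 := mul_right_cancel₀ huv (by
    simp only [wedge]; linear_combination u 0 * hv0 - v 0 * hu0)
  have e10 : A 1 0 = 0 := mul_right_cancel₀ huv (by
    simp only [wedge]; linear_combination v 1 * hu1 - u 1 * hv1)
  have e11 : A 1 1 = k := mul_right_cancel₀ huv (by
    simp only [wedge]; linear_combination u 0 * hv1 - v 0 * hu1)
  refine mem_scalars_of_eq (c := k) ?_
  rw [Fin.forall_fin_two, Fin.forall_fin_two, Fin.forall_fin_two]
  simp [hA, e00, e01, e10, e11]

/-- An automorphism preserving a nilpotent Higgs field up to scale preserves its kernel. -/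
theorem exists_mulVec_eq_smul {lam : ℂ} (h0 : lam ≠ 0) (h1 : lam ≠ 1) {m : Fin 2 → ℤ}
    {x : HiggsPair lam m} (hx : x ∈ QPHnil lam m) (hne : x.field ≠ 0) {j : ℤ}
    {s : Fin 2 → Poly} (hs : s ∈ lineGen m j) (hker : x.field.mulVec s = 0) {g : AutE m} {c : ℂ}
    (hg : (g • x).field = c • x.field) (hc : c ≠ 0) :
    ∃ k : ℂ, ∀ z : Fin 2 → ℂ,
      (autEval g z).mulVec (fun a => eval z (s a)) = k • fun a => eval z (s a) := by
  have hk := smul_field_mulVec g x s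
  rw [hker, Matrix.mulVec_zero, hg, Matrix.smul_mulVec, smul_eq_zero_iff_right hc] at hk
  obtain ⟨-, k, -, h⟩ := exists_eq_smul_of_lineGen hs (mulVec_mem_lineGen g hs)
    (wedge_eq_of_invariant h0 h1 hx hne hker (mulVec_mem_lineGen g hs) (t := 0)
      (by rw [hk, zero_smul]))
  refine ⟨k, fun z => ?_⟩
  rw [← eval_mulVec, h]
  ext a
  simp [smul_eval]

/-- Stability leaves a flag off the kernel. A stabilizing automorphism is a constant matrix with
this flag and the kernel as eigenlines, and commuting with a field that maps the flag onto the
kernel equates the two eigenvalues. -/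
theorem actsFreelyOn_condStable_S_top {lam : ℂ} (h0 : lam ≠ 0) (h1 : lam ≠ 1) {m : Fin 2 → ℤ}
    (hm : m 0 = m 1) : ActsFreelyOn (PAut m) (condStable (S lam m (m 1))) := by
  refine actsFreelyOn_of_aut
    (fun g x hx => smul_mem_condStable (fun g x hx => smul_mem_S h0 h1 g hx) g hx) ?_
  intro x hx g hg
  have hxS := hx.1
  obtain ⟨s, hs, hker⟩ := hxS.2.2
  rw [mem_condStable_iff_of_nilpotent h0 h1 hxS hxS.1 hxS.2.1 hs hker] at hx
  obtain ⟨q, hq, hq0, hΦ⟩ := exists_eq_nilMat h0 h1 hxS.1.1 hxS.2.1 hs hker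
  obtain ⟨k, hk⟩ := exists_mulVec_eq_smul h0 h1 hxS.1 hxS.2.1 hs hker (g := g) (c := 1)
    (by rw [hg, one_smul]) one_ne_zero
  obtain ⟨c, hc, hsc⟩ := eval_constant_lineGen hm hs
  have hsev : ∀ z : Fin 2 → ℂ, (fun a => eval z (s a)) = c := fun z => by ext a; simp [hsc]
  simp only [hsev] at hk
  obtain ⟨i, hi⟩ : ∃ i, i ∉ meetSet lam x.flag s := by
    by_contra! hall
    rw [Finset.eq_univ_iff_forall.2 hall, Finset.card_univ, Fintype.card_fin] at hx
    omega
  rw [mem_meetSet, meets_iff_of_mem (rep_mem _) (x.flag i).rep_nonzero, hsev] at hi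
  have hmem := mulVec_mem_smul_flag g x i (rep_mem _)
  rw [hg, mem_submodule_iff (rep_mem _) (x.flag i).rep_nonzero] at hmem
  obtain ⟨l, hl⟩ := exists_smul_of_wedge (x.flag i).rep_nonzero hmem
  set v := (x.flag i).rep
  -- At `i` itself the field vanishes, because the flag is off the kernel. It is evaluated at
  -- another marked point, where the quadratic form `q` is nonzero; constancy of `g` allows the
  -- transfer.
  obtain ⟨i', hi'⟩ : ∃ i, eval (marked lam i) q ≠ 0 := by
    by_contra! hall
    refine hq0 (forms_eq_zero_of_eval h0 h1 Finset.univ hq ?_ fun i _ => hall i)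
    rw [Finset.card_univ, Fintype.card_fin]
    omega
  have hG : autEval g (marked lam i) = autEval g (marked lam i') := by
    ext a b
    rw [autEval, autEval, Matrix.map_apply, Matrix.map_apply, autMat_eq_C_of_eq hm, eval_C, eval_C]
  rw [hG] at hl
  have hcomm := congrArg (fun M => (M.map (eval (marked lam i'))).mulVec v)
    (autMat_mul_field (g := g) (x := x))
  simp only [hg, hΦ, Matrix.map_mul] at hcomm
  rw [← Matrix.mulVec_mulVec, ← Matrix.mulVec_mulVec] at hcomm
  change ((nilMat q s).map _).mulVec ((autEval g _).mulVec v) =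
    (autEval g _).mulVec (((nilMat q s).map _).mulVec v) at hcomm
  rw [hl, Matrix.mulVec_smul, eval_nilMat_mulVec, hsev, Matrix.mulVec_smul, hk, smul_smul, smul_smul]
    at hcomm
  have hlk := smul_left_injective ℂ hc hcomm
  have hμ : -(eval (marked lam i') q * wedge c v) ≠ 0 := neg_ne_zero.2 (mul_ne_zero hi' hi)
  have hkl : l = k := mul_right_cancel₀ hμ (by rw [hlk, mul_comm])
  rw [hkl] at hl
  exact mem_scalars_of_eigenvectors hm (hk (marked lam i')) hl hi

/-! ### Kernels of degree `m - 1` on a balanced bundle -/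

theorem forms_one_eq {p : Poly} (hp : p ∈ forms 1) :
    p = C (eval ![1, 0] p) * X 0 + C (eval ![0, 1] p) * X 1 := by
  have hX : ∀ i : Fin 2, (X i : Poly) ∈ forms 1 := fun i => isWeightedHomogeneous_X ℂ _ i
  have hC : ∀ (c : ℂ) (i : Fin 2), C c * (X i : Poly) ∈ forms 1 := fun c i => by
    have := mul_mem_forms (C_mem_forms c) (hX i)
    rwa [zero_add] at this
  rw [← sub_eq_zero]
  refine forms_eq_zero_of_eval (lam := 2) (by norm_num) (by norm_num) {1, 3}
    (Submodule.sub_mem _ hp (Submodule.add_mem _ (hC _ _) (hC _ _))) (by decide) ?_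
  simp [marked]

/-- For a balanced bundle, line sub-bundles of colength one are the images of the tautological one
under constant automorphisms. -/
theorem exists_aut_of_lineGen_one {m : Fin 2 → ℤ} (hm : m 0 = m 1) {s : Fin 2 → Poly}
    (hs : s ∈ lineGen m (m 1 - 1)) : ∃ g : AutE m, s = (autMat g).mulVec X := by
  have hlin : ∀ a, s a ∈ forms 1 := by
    intro a
    have := hs.1 a
    rwa [show m a - (m 1 - 1) = 1 by fin_cases a <;> simp [hm]] at this
  set A : Matrix (Fin 2) (Fin 2) ℂ :=
    Matrix.of fun a b => eval (if b = 0 then ![1, 0] else ![0, 1]) (s a) with hA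
  have hsA : s = (A.map C).mulVec X := by
    funext a
    rw [Matrix.mulVec, dotProduct, Fin.sum_univ_two]
    simpa [hA] using forms_one_eq (hlin a)
  -- A vector in the kernel of the coefficient matrix would be a common zero of the components of
  -- `s`.
  have hdet : A.det ≠ 0 := by
    intro h
    obtain ⟨v, hv, hAv⟩ := Matrix.exists_mulVec_eq_zero_iff.2 h
    obtain ⟨a, ha⟩ := hs.2 v hv
    apply ha
    have := congrFun hAv a
    rw [Matrix.mulVec, dotProduct, Fin.sum_univ_two, Pi.zero_apply] at this
    rw [hsA, Matrix.mulVec, dotProduct, Fin.sum_univ_two]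
    simpa using this
  obtain ⟨g, hg⟩ := exists_aut_of_eq hm A hdet
  exact ⟨g, by rw [hg]; exact hsA⟩

/-- The normal form from which the strata are parametrized: a kernel generator, a scale, and flags
constrained only where the scale does not vanish. -/
theorem mem_S_iff {lam : ℂ} (h0 : lam ≠ 0) (h1 : lam ≠ 1) {m : Fin 2 → ℤ} {j : ℤ}
    {x : HiggsPair lam m} : x ∈ S lam m j ↔ ∃ s ∈ lineGen m j,
      ∃ q ∈ forms (2 + 2 * j - m 0 - m 1), q ≠ 0 ∧ x.field = nilMat q s ∧
        ∀ i, eval (marked lam i) q = 0 ∨ Meets lam x.flag s i := by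
  constructor
  · rintro ⟨hx, hne, s, hs, hker⟩
    obtain ⟨q, hq, hq0, hΦ⟩ := exists_eq_nilMat h0 h1 hx.1 hne hs hker
    refine ⟨s, hs, q, hq, hq0, hΦ, ?_⟩
    rw [← nilMat_mem_QPHnil_iff h0 h1 hq hs, ← hΦ]
    exact hx
  · rintro ⟨s, hs, q, hq, hq0, hΦ, h⟩
    rw [← nilMat_mem_QPHnil_iff h0 h1 hq hs, ← hΦ] at h
    refine ⟨h, ?_, s, hs, ?_⟩
    · rw [hΦ]; exact nilMat_ne_zero hq0 hs
    · rw [hΦ]; exact nilMat_mulVec q s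

theorem smul_nilMat (c : ℂ) (q : Poly) (s : Fin 2 → Poly) :
    c • nilMat q s = nilMat (C c * q) s := by
  ext1 a b
  rw [Matrix.smul_apply, smul_eq_C_mul]
  fin_cases a <;> fin_cases b <;> simp [nilMat] <;> ring

theorem units_smul_eq {lam : ℂ} {m : Fin 2 → ℤ} (c : ℂˣ) (x : HiggsPair lam m) :
    c • x = ⟨x.flag, (c : ℂ) • x.field⟩ := rfl

theorem units_smul_mem_S {lam : ℂ} (h0 : lam ≠ 0) (h1 : lam ≠ 1) {m : Fin 2 → ℤ} {j : ℤ} (c : ℂˣ)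
    {x : HiggsPair lam m} (hx : x ∈ S lam m j) : c • x ∈ S lam m j := by
  rw [mem_S_iff h0 h1] at hx ⊢
  obtain ⟨s, hs, q, hq, hq0, hΦ, h⟩ := hx
  have hc : (C (c : ℂ) : Poly) ≠ 0 := by simp
  refine ⟨s, hs, C (c : ℂ) * q, ?_, mul_ne_zero hc hq0, ?_, fun i => ?_⟩
  · have := mul_mem_forms (C_mem_forms c) hq
    rwa [zero_add] at this
  · rw [units_smul_eq, hΦ, smul_nilMat]
  · exact (h i).imp_left fun h => by rw [map_mul, h, mul_zero]

theorem flag_eq_of_meets {lam : ℂ} {m : Fin 2 → ℤ} {j : ℤ} {s : Fin 2 → Poly} (hs : s ∈ lineGen m j)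
    {F F' : QP} (h : ∀ i, Meets lam F s i) (h' : ∀ i, Meets lam F' s i) : F = F' :=
  funext fun i => P1_eq_of_mem (eval_lineGen_ne_zero hs (marked_ne_zero lam i)) (h i) (h' i)

/-- The flags cut out by a line sub-bundle. -/
theorem exists_flag_meets (lam : ℂ) {m : Fin 2 → ℤ} {j : ℤ} {s : Fin 2 → Poly}
    (hs : s ∈ lineGen m j) : ∃ F : QP, ∀ i, Meets lam F s i :=
  ⟨fun i => Projectivization.mk ℂ _ (eval_lineGen_ne_zero hs (marked_ne_zero lam i)),
    fun _ => (mem_mk_iff _ _).2 (wedge_self _)⟩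

/-- If the scale is constant, the kernel passes through all flags. -/
theorem exists_constant_scale {lam : ℂ} (h0 : lam ≠ 0) (h1 : lam ≠ 1) {m : Fin 2 → ℤ} {j : ℤ}
    (hj : 2 + 2 * j - m 0 - m 1 = 0) {x : HiggsPair lam m} (hx : x ∈ S lam m j) :
    ∃ s ∈ lineGen m j, ∃ k : ℂ, k ≠ 0 ∧ x.field = nilMat (C k) s ∧ ∀ i, Meets lam x.flag s i := by
  obtain ⟨s, hs, q, hq, hq0, hΦ, h⟩ := (mem_S_iff h0 h1).1 hx
  rw [hj] at hq
  rw [forms_zero_eq_C hq] at hq0 hΦ h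
  have hk : constantCoeff q ≠ 0 := by simpa using hq0
  exact ⟨s, hs, _, hk, hΦ, fun i => (h i).resolve_left (by rwa [eval_C])⟩

theorem mem_S_of_constant_scale {lam : ℂ} (h0 : lam ≠ 0) (h1 : lam ≠ 1) {m : Fin 2 → ℤ} {j : ℤ}
    (hj : 2 + 2 * j - m 0 - m 1 = 0) {s : Fin 2 → Poly} (hs : s ∈ lineGen m j) {k : ℂ} (hk : k ≠ 0)
    {F : QP} (hF : ∀ i, Meets lam F s i) : (⟨F, nilMat (C k) s⟩ : HiggsPair lam m) ∈ S lam m j :=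
  (mem_S_iff h0 h1).2 ⟨s, hs, C k, by rw [hj]; exact C_mem_forms k, by simpa using hk, rfl,
    fun i => Or.inr (hF i)⟩

theorem prod_smul_eq {lam : ℂ} {m : Fin 2 → ℤ} (g : AutE m) (c : ℂˣ) (x : HiggsPair lam m) :
    ((QuotientGroup.mk g : PAut m), c) • x = g • (⟨x.flag, (c : ℂ) • x.field⟩ : HiggsPair lam m) :=
  rfl

theorem smul_flag {lam : ℂ} {m : Fin 2 → ℤ} (g : AutE m) (x : HiggsPair lam m) :
    (g • x).flag = fun i => fibreHom m (marked lam i) g • x.flag i := rfl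

theorem prod_smul_field {lam : ℂ} {m : Fin 2 → ℤ} (g : AutE m) (c : ℂˣ) (x : HiggsPair lam m) :
    (((QuotientGroup.mk g : PAut m), c) • x).field = (c : ℂ) • (g • x).field := by
  rw [prod_smul_eq, smul_field, Matrix.mul_smul, Matrix.smul_mul, ← smul_field]

theorem prod_smul_flag {lam : ℂ} {m : Fin 2 → ℤ} (g : AutE m) (c : ℂˣ) (x : HiggsPair lam m) :
    (((QuotientGroup.mk g : PAut m), c) • x).flag = (g • x).flag := by
  rw [prod_smul_eq, smul_flag, smul_flag]

theorem prod_smul_mem_S {lam : ℂ} (h0 : lam ≠ 0) (h1 : lam ≠ 1) {m : Fin 2 → ℤ} {j : ℤ}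
    (gc : PAut m × ℂˣ) {x : HiggsPair lam m} (hx : x ∈ S lam m j) : gc • x ∈ S lam m j := by
  obtain ⟨g, c⟩ := gc
  induction g using QuotientGroup.induction_on with
  | H g => exact smul_mem_S h0 h1 g (units_smul_mem_S h0 h1 c hx)

theorem X_mem_lineGen {m : Fin 2 → ℤ} (hm : m 0 = m 1) : (X : Fin 2 → Poly) ∈ lineGen m (m 1 - 1) := by
  refine ⟨fun a => ?_, fun v hv => ?_⟩
  · rw [show m a - (m 1 - 1) = 1 by fin_cases a <;> simp [hm]]
    exact isWeightedHomogeneous_X ℂ _ a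
  · obtain ⟨a, ha⟩ := Function.ne_iff.1 hv
    exact ⟨a, by simpa using ha⟩

/-- A constant automorphism carries the tautological kernel to any other, the kernel determines the
flags, and the remaining constant scale is adjusted by $\mathbb C^*$. -/
theorem exists_prod_smul_eq {lam : ℂ} (h0 : lam ≠ 0) (h1 : lam ≠ 1) {m : Fin 2 → ℤ}
    (hm : m 0 = m 1) {x0 x : HiggsPair lam m} (hx0 : x0 ∈ S lam m (m 1 - 1))
    (hker0 : x0.field.mulVec X = 0) (hF : ∀ i, Meets lam x0.flag X i)
    (hx : x ∈ S lam m (m 1 - 1)) : ∃ gc : PAut m × ℂˣ, gc • x0 = x := by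
  have hj : 2 + 2 * (m 1 - 1) - m 0 - m 1 = 0 := by omega
  obtain ⟨s, hs, k, hk, hΦ, hx⟩ := exists_constant_scale h0 h1 hj hx
  obtain ⟨g, rfl⟩ := exists_aut_of_lineGen_one hm hs
  have hgx := smul_mem_S h0 h1 g hx0
  have hker : (g • x0).field.mulVec ((autMat g).mulVec X) = 0 := by
    rw [smul_field_mulVec, hker0, Matrix.mulVec_zero]
  obtain ⟨q, hq, hq0, hΦ'⟩ := exists_eq_nilMat h0 h1 hgx.1.1 hgx.2.1 hs hker
  rw [hj] at hq
  rw [forms_zero_eq_C hq] at hq0 hΦ'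
  have hq0' : constantCoeff q ≠ 0 := by simpa using hq0
  refine ⟨(QuotientGroup.mk g, Units.mk0 (k / constantCoeff q) (div_ne_zero hk hq0')), ?_⟩
  refine HiggsPair.ext ?_ ?_
  · rw [prod_smul_flag]
    exact flag_eq_of_meets hs (fun i => (meets_smul_iff g x0 X i).2 (hF i)) hx
  · rw [prod_smul_field, hΦ', hΦ, smul_nilMat, ← C_mul, Units.val_mk0, div_mul_cancel₀ _ hq0']

theorem wedge_eval_ne_zero {m : Fin 2 → ℤ} (hm : m 0 = m 1) {s : Fin 2 → Poly}
    (hs : s ∈ lineGen m (m 1 - 1)) :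
    wedge (fun a => eval ![1, 0] (s a)) (fun a => eval ![0, 1] (s a)) ≠ 0 := by
  intro hw
  have hv : (fun a => eval ![0, 1] (s a)) ≠ 0 :=
    eval_lineGen_ne_zero hs fun e => by simpa using congrFun e 1
  obtain ⟨t, ht⟩ := exists_smul_of_wedge hv hw
  refine eval_lineGen_ne_zero hs (v := ![1, -t]) (fun e => by simpa using congrFun e 0) ?_
  funext a
  have hlin := hs.1 a
  rw [show m a - (m 1 - 1) = 1 by fin_cases a <;> simp [hm]] at hlin
  have h10 : eval ![1, 0] (s a) = t * eval ![0, 1] (s a) := congrFun ht a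
  rw [forms_one_eq hlin, h10]
  simp
  ring

/-- The automorphism multiplies the kernel generator by one constant over all points. Since the
kernel lines at $[1:0]$ and $[0:1]$ are independent, it is scalar, and the scaling of the field is
then trivial. -/
theorem eq_one_of_prod_smul_eq {lam : ℂ} (h0 : lam ≠ 0) (h1 : lam ≠ 1) {m : Fin 2 → ℤ}
    (hm : m 0 = m 1) {x : HiggsPair lam m} (hx : x ∈ S lam m (m 1 - 1)) {gc : PAut m × ℂˣ}
    (hgc : gc • x = x) : gc = 1 := by
  obtain ⟨g, c⟩ := gc
  induction g using QuotientGroup.induction_on with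
  | H g =>
    have hfield : (g • x).field = (c : ℂ)⁻¹ • x.field := by
      have h := prod_smul_field g c x
      rw [hgc] at h
      rw [h, smul_smul, inv_mul_cancel₀ c.ne_zero, one_smul]
    obtain ⟨s, hs, hker⟩ := hx.2.2
    obtain ⟨k, hk⟩ := exists_mulVec_eq_smul h0 h1 hx.1 hx.2.1 hs hker hfield
      (inv_ne_zero c.ne_zero)
    have hg : g ∈ scalars m :=
      mem_scalars_of_eigenvectors hm (hk ![1, 0]) (hk ![0, 1]) (wedge_eval_ne_zero hm hs)
    rw [scalars_smul lam m g hg x] at hfield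
    have hc : (1 : ℂ) = (c : ℂ)⁻¹ :=
      smul_left_injective ℂ hx.2.1 (by simpa using hfield)
    refine Prod.ext ((QuotientGroup.eq_one_iff g).2 hg) (Units.ext ?_)
    change (c : ℂ) = 1
    rw [← inv_inv (c : ℂ), ← hc, inv_one]

theorem actsFreelyTransitivelyOn_S {lam : ℂ} (h0 : lam ≠ 0) (h1 : lam ≠ 1) {m : Fin 2 → ℤ}
    (hm : m 0 = m 1) : ActsFreelyTransitivelyOn (PAut m × ℂˣ) (S lam m (m 1 - 1)) := by
  obtain ⟨F, hF⟩ := exists_flag_meets lam (X_mem_lineGen hm)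
  have hx0 := mem_S_of_constant_scale h0 h1 (by omega) (X_mem_lineGen hm) one_ne_zero hF
  have htrans := fun {x} => exists_prod_smul_eq (x := x) h0 h1 hm hx0 (nilMat_mulVec _ _) hF
  generalize (⟨F, nilMat (C 1) X⟩ : HiggsPair lam m) = x0 at hx0 htrans
  refine ⟨⟨x0, hx0⟩, fun g x hx => prod_smul_mem_S h0 h1 g hx, fun x hx y hy => ?_⟩
  obtain ⟨g, rfl⟩ := htrans hx
  obtain ⟨h, rfl⟩ := htrans hy
  refine ⟨h * g⁻¹, ?_, fun k hk => ?_⟩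
  · simp only [smul_smul, inv_mul_cancel_right]
  · simp only [smul_smul] at hk
    have := eq_one_of_prod_smul_eq h0 h1 hm hx0 (gc := h⁻¹ * (k * g))
      (by rw [mul_smul, hk, inv_smul_smul])
    rw [inv_mul_eq_one] at this
    rw [this, mul_inv_cancel_right]

/-! ### The product decomposition of `S_{m₂}(E)` -/

theorem exists_equiv_of_existsUnique {α β : Type*} (r : α → β → Prop) (h : ∀ a, ∃! b, r a b)
    (h' : ∀ b, ∃! a, r a b) : ∃ e : α ≃ β, ∀ a, r a (e a) := by
  choose f hf hf' using fun a => h a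
  choose k hk hk' using fun b => h' b
  exact ⟨⟨f, k, fun a => (hk' _ _ (hf a)).symm, fun b => (hf' _ _ (hk b)).symm⟩, hf⟩

/-- `nilMat` is quadratic in `s`, while `stdNilp` is homogeneous of degree one and has scale
$w^{-1}$. Rescaling the generator by $kw$ thus absorbs the constant `k` and removes the ambiguity in
the generator. -/
theorem nilMat_eq_smul_stdNilp {s : Fin 2 → Poly} {w k : ℂ} (hs : s 1 = C w) (hw : w ≠ 0)
    (hk : k ≠ 0) (f : Poly) : nilMat (C k * f) s = f • stdNilp ((k * w) • s) := by
  have e0 : (((k * w) • s) 0 : Poly) = C k * C w * s 0 := by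
    rw [Pi.smul_apply, smul_eq_C_mul, C_mul]
  have e1 : (((k * w) • s) 1 : Poly) = C (k * w * w) := by
    rw [Pi.smul_apply, smul_eq_C_mul, hs, ← C_mul]
  have hinv : (C (k * w * w)⁻¹ * (C k * C w) ^ 2 : Poly) = C k := by
    rw [← C_mul, ← C_pow, ← C_mul]
    congr 1
    field_simp
  ext1 a b
  rw [Matrix.smul_apply, smul_eq_mul]
  fin_cases a <;> fin_cases b
  · simp only [nilMat, stdNilp, e0, e1, hs, Fin.zero_eta, Matrix.of_apply, Matrix.cons_val',
      Matrix.cons_val_zero]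
    ring
  · simp only [nilMat, stdNilp, e0, e1, Fin.zero_eta, Fin.mk_one, Matrix.of_apply, Matrix.cons_val',
      Matrix.cons_val_zero, Matrix.cons_val_one, constantCoeff_C]
    linear_combination f * s 0 ^ 2 * hinv
  · simp only [nilMat, stdNilp, e1, hs, Fin.zero_eta, Fin.mk_one, Matrix.of_apply,
      Matrix.cons_val', Matrix.cons_val_zero, Matrix.cons_val_one, C_mul]
    ring
  · change -(C k * f * (s 0 * s 1)) = f * -((k * w) • s) 0
    rw [e0, hs]
    ring

theorem smul_stdNilp {s : Fin 2 → Poly} {w : ℂ} (hs : s 1 = C w) (hw : w ≠ 0) (f : Poly) :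
    f • stdNilp s = nilMat (C w⁻¹ * f) s := by
  rw [nilMat_eq_smul_stdNilp hs hw (inv_ne_zero hw), inv_mul_cancel₀ hw, one_smul]

theorem stdNilp_one_zero (s : Fin 2 → Poly) : stdNilp s 1 0 = s 1 := rfl

theorem stdNilp_injective {s s' : Fin 2 → Poly} {f : Poly} (hf : f ≠ 0)
    (h : f • stdNilp s = f • stdNilp s') : s = s' := by
  have h2 := smul_right_injective (Matrix (Fin 2) (Fin 2) Poly) hf h
  funext a
  fin_cases a
  · exact congrFun (congrFun h2 0) 0
  · exact congrFun (congrFun h2 1) 0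

/-- The action of an automorphism `[a, p; 0, c]` on sections: `s ↦ a⁻¹ g s`. -/
def stdAct {m : Fin 2 → ℤ} (g : AutE m) (s : Fin 2 → Poly) : Fin 2 → Poly :=
  (constantCoeff (autMat g 0 0))⁻¹ • (autMat g).mulVec s

theorem stdAct_mem {m : Fin 2 → ℤ} (hm : m 1 < m 0) (g : AutE m) {j : ℤ} {s : Fin 2 → Poly}
    (hs : s ∈ lineGen m j) : stdAct g s ∈ lineGen m j := by
  obtain ⟨a, c, ha, -, e00, -, -⟩ := exists_autMat_of_lt hm g
  refine smul_mem_lineGen (mulVec_mem_lineGen g hs) (inv_ne_zero ?_)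
  rwa [e00, constantCoeff_C]

theorem stdAct_zero {m : Fin 2 → ℤ} {g : AutE m} {a w : ℂ} (ha : a ≠ 0)
    (e00 : autMat g 0 0 = C a) {s : Fin 2 → Poly} (hs : s 1 = C w) :
    stdAct g s 0 = s 0 + C (a⁻¹ * w) * autMat g 0 1 := by
  have hC : (C a⁻¹ * C a : Poly) = 1 := by rw [← C_mul, inv_mul_cancel₀ ha, C_1]
  rw [stdAct, Pi.smul_apply, smul_eq_C_mul, Matrix.mulVec, dotProduct, Fin.sum_univ_two, e00, hs,
    constantCoeff_C, C_mul]
  linear_combination s 0 * hC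

theorem stdAct_one {m : Fin 2 → ℤ} {g : AutE m} {a c w : ℂ}
    (e00 : autMat g 0 0 = C a) (e10 : autMat g 1 0 = 0) (e11 : autMat g 1 1 = C c)
    {s : Fin 2 → Poly} (hs : s 1 = C w) : stdAct g s 1 = C (a⁻¹ * c * w) := by
  rw [stdAct, Pi.smul_apply, smul_eq_C_mul, Matrix.mulVec, dotProduct, Fin.sum_univ_two, e00, e10,
    e11, hs, constantCoeff_C, zero_mul, zero_add, ← C_mul, ← C_mul, mul_assoc]

/-- Conjugation replaces the generator by $gs$, whose constant component is $cw$, and divides the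
scale by $\det g=ac$. Normalizing the scale again leaves the factor $a^{-1}$ of `stdAct`. -/
theorem smul_field_stdNilp {lam : ℂ} {m : Fin 2 → ℤ} (hm : m 1 < m 0) (g : AutE m)
    {x : HiggsPair lam m} {f : Poly} {s : Fin 2 → Poly} (hs : s ∈ lineGen m (m 1))
    (hx : x.field = f • stdNilp s) : (g • x).field = f • stdNilp (stdAct g s) := by
  obtain ⟨a, c, ha, hc, e00, e10, e11⟩ := exists_autMat_of_lt hm g
  obtain ⟨w, hw, hs1⟩ := lineGen_second hm hs
  have key : autMat g * stdNilp s = stdNilp (stdAct g s) * autMat g := by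
    have t0 := stdAct_zero ha e00 hs1
    have t1 := stdAct_one e00 e10 e11 hs1
    have hCa : (C a⁻¹ * C a : Poly) = 1 := by rw [← C_mul, inv_mul_cancel₀ ha, C_1]
    have hCc : (C c⁻¹ * C c : Poly) = 1 := by rw [← C_mul, inv_mul_cancel₀ hc, C_1]
    have hCw : (C w⁻¹ * C w : Poly) = 1 := by rw [← C_mul, inv_mul_cancel₀ hw, C_1]
    have hinv : (a⁻¹ * c * w)⁻¹ = a * c⁻¹ * w⁻¹ := by
      rw [mul_inv, mul_inv, inv_inv]
    rw [Matrix.eta_fin_two (autMat g), stdNilp, stdNilp, Matrix.mul_fin_two, Matrix.mul_fin_two, t0,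
      t1, hs1, e00, e10, e11, constantCoeff_C, constantCoeff_C, hinv]
    simp only [C_mul]
    set u := s 0
    set p := autMat g 0 1
    have h00 : C a * u + p * C w = (u + C a⁻¹ * C w * p) * C a +
        -(C a * C c⁻¹ * C w⁻¹ * (u + C a⁻¹ * C w * p) ^ 2) * 0 := by
      linear_combination -(C w * p) * hCa
    have h01 : C a * -(C w⁻¹ * u ^ 2) + p * -u = (u + C a⁻¹ * C w * p) * p +
        -(C a * C c⁻¹ * C w⁻¹ * (u + C a⁻¹ * C w * p) ^ 2) * C c := by
      linear_combination (C a * C w⁻¹ * (u + C a⁻¹ * C w * p) ^ 2) * hCc +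
        (2 * u * p * C a⁻¹ * C a + C a * C a⁻¹ ^ 2 * C w * p ^ 2) * hCw +
        (2 * u * p + C a⁻¹ * C w * p ^ 2) * hCa
    have h10 : 0 * u + C c * C w = C a⁻¹ * C c * C w * C a + -(u + C a⁻¹ * C w * p) * 0 := by
      linear_combination -(C c * C w) * hCa
    have h11 : 0 * -(C w⁻¹ * u ^ 2) + C c * -u = C a⁻¹ * C c * C w * p +
        -(u + C a⁻¹ * C w * p) * C c := by
      ring
    rw [h00, h01, h10, h11]
  rw [smul_field, hx, Matrix.mul_smul, Matrix.smul_mul, key, mul_assoc, autMat_mul_inv, mul_one]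

/-- Upper triangular automorphisms act simply transitively on `P_{m₂}(E)`. -/
theorem exists_stdAct_eq {m : Fin 2 → ℤ} (hm : m 1 < m 0) {s s' : Fin 2 → Poly}
    (hs : s ∈ lineGen m (m 1)) (hs' : s' ∈ lineGen m (m 1)) : ∃ g : AutE m, stdAct g s = s' := by
  obtain ⟨w, hw, hs1⟩ := lineGen_second hm hs
  obtain ⟨w', hw', hs1'⟩ := lineGen_second hm hs'
  -- Scalars allow $a=1$; the entries then solve $u'=u+wp$ and $w'=cw$.
  obtain ⟨g, hg⟩ := exists_upper_triangular_aut (m := m) (a := 1) (c := w' / w) one_ne_zero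
    (div_ne_zero hw' hw) (p := w⁻¹ • (s' 0 - s 0))
    (Submodule.smul_mem _ _ (Submodule.sub_mem _ (hs'.1 0) (hs.1 0)))
  have e00 : autMat g 0 0 = C 1 := by rw [hg]; rfl
  have e01 : autMat g 0 1 = w⁻¹ • (s' 0 - s 0) := by rw [hg]; rfl
  have e10 : autMat g 1 0 = 0 := by rw [hg]; rfl
  have e11 : autMat g 1 1 = C (w' / w) := by rw [hg]; rfl
  refine ⟨g, funext fun a => ?_⟩
  fin_cases a
  · refine (stdAct_zero one_ne_zero e00 hs1).trans ?_
    rw [e01, ← smul_eq_C_mul, smul_smul, inv_one, one_mul, mul_inv_cancel₀ hw, one_smul]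
    simp
  · refine (stdAct_one e00 e10 e11 hs1).trans ?_
    rw [inv_one, one_mul, div_mul_cancel₀ _ hw]
    exact hs1'.symm

theorem mem_scalars_of_stdAct {m : Fin 2 → ℤ} (hm : m 1 < m 0) {s : Fin 2 → Poly}
    (hs : s ∈ lineGen m (m 1)) {g : AutE m} (h : stdAct g s = s) : g ∈ scalars m := by
  obtain ⟨a, c, ha, hc, e00, e10, e11⟩ := exists_autMat_of_lt hm g
  obtain ⟨w, hw, hs1⟩ := lineGen_second hm hs
  have t0 := stdAct_zero ha e00 hs1
  have t1 := stdAct_one e00 e10 e11 hs1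
  rw [h] at t0 t1
  have hp : autMat g 0 1 = 0 := by
    have h2 : (C (a⁻¹ * w) : Poly) ≠ 0 := by simpa using ⟨ha, hw⟩
    exact (mul_eq_zero.1 (by linear_combination -t0)).resolve_left h2
  have hac : c = a := by
    rw [hs1] at t1
    have := C_injective _ _ t1
    field_simp at this
    exact this.symm
  refine mem_scalars_of_eq (c := a) ?_
  rw [Fin.forall_fin_two, Fin.forall_fin_two, Fin.forall_fin_two]
  simp [e00, e10, e11, hp, hac]

/-- The action laws on the second factor are inherited from the stratum by lifting each pair over a
fixed point of the base; simple transitivity comes from `exists_stdAct_eq` and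
`mem_scalars_of_stdAct`. -/
theorem actsOnFactor_of_stdAct {lam : ℂ} (h0 : lam ≠ 0) (h1 : lam ≠ 1) {m : Fin 2 → ℤ}
    (hm : m 1 < m 0) {Base : Type*} [Nonempty Base] (e : S lam m (m 1) ≃ Base × lineGen m (m 1))
    (h : ∀ (g : AutE m) (x y : S lam m (m 1)), (y : HiggsPair lam m) = g • (x : HiggsPair lam m) →
      (e y).1 = (e x).1 ∧ ((e y).2 : Fin 2 → Poly) = stdAct g (e x).2) : ActsOnFactor e := by
  have hinv : ∀ g : PAut m, ∀ x ∈ S lam m (m 1), g • x ∈ S lam m (m 1) := by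
    intro g x hx
    induction g using QuotientGroup.induction_on with
    | H g => exact smul_mem_S h0 h1 g hx
  refine ⟨hinv, ?_⟩
  obtain ⟨b⟩ := ‹Nonempty Base›
  have hex : ∀ g : PAut m, ∃ f : lineGen m (m 1) → lineGen m (m 1), ∀ x y : S lam m (m 1),
      (y : HiggsPair lam m) = g • (x : HiggsPair lam m) → e y = ((e x).1, f (e x).2) := by
    intro g
    induction g using QuotientGroup.induction_on with
    | H g =>
      exact ⟨fun s => ⟨stdAct g s, stdAct_mem hm g s.2⟩, fun x y hxy =>
        Prod.ext (h g x y hxy).1 (Subtype.ext (h g x y hxy).2)⟩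
  choose f hf using hex
  have hval : ∀ (g : AutE m) (p : lineGen m (m 1)),
      (f (QuotientGroup.mk g) p : Fin 2 → Poly) = stdAct g p := by
    intro g p
    obtain ⟨x, hx⟩ := e.surjective (b, p)
    have h1 := hf (QuotientGroup.mk g) x ⟨_, hinv (QuotientGroup.mk g) x x.2⟩ rfl
    have h2 := (h g x ⟨_, hinv (QuotientGroup.mk g) x x.2⟩ rfl).2
    rw [h1, hx] at h2
    exact h2
  let act : MulAction (PAut m) (lineGen m (m 1)) :=
    { smul := f
      one_smul := fun p => by
        obtain ⟨x, hx⟩ := e.surjective (b, p)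
        have := hf 1 x x (one_smul _ _).symm
        rw [hx] at this
        exact (congrArg Prod.snd this).symm
      mul_smul := fun g k p => by
        obtain ⟨x, hx⟩ := e.surjective (b, p)
        have e1 := hf k x ⟨_, hinv k x x.2⟩ rfl
        have e2 := hf g ⟨_, hinv k x x.2⟩ ⟨_, hinv g _ (hinv k x x.2)⟩ rfl
        have e3 := hf (g * k) x ⟨_, hinv g _ (hinv k x x.2)⟩ (mul_smul _ _ _).symm
        rw [e1, e3, hx] at e2
        exact congrArg Prod.snd e2 }
  refine ⟨MulAction.toPermHom (PAut m) (lineGen m (m 1)), fun p p' => ?_, hf⟩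
  obtain ⟨g, hg⟩ := exists_stdAct_eq hm p.2 p'.2
  have hgp : (QuotientGroup.mk g : PAut m) • p = p' := Subtype.ext ((hval g p).trans hg)
  refine ⟨QuotientGroup.mk g, hgp, fun k hk => ?_⟩
  have hkp : k • p = p' := hk
  have hfix : ((QuotientGroup.mk g)⁻¹ * k) • p = p := by
    rw [mul_smul, hkp, ← hgp, inv_smul_smul]
  have h1 : ((QuotientGroup.mk g)⁻¹ * k : PAut m) = 1 := by
    generalize ((QuotientGroup.mk g)⁻¹ * k : PAut m) = k' at hfix
    induction k' using QuotientGroup.induction_on with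
    | H k' =>
      refine (QuotientGroup.eq_one_iff k').2 (mem_scalars_of_stdAct hm p.2 ?_)
      rw [← hval, show f _ p = p from hfix]
  exact (inv_mul_eq_one.1 h1).symm

/-- The scale has degree zero, so it is absorbed into the generator, and the kernel passes through
all four flags. -/
theorem decomposition_two {lam : ℂ} (h0 : lam ≠ 0) (h1 : lam ≠ 1) {m : Fin 2 → ℤ}
    (hm : m 0 - m 1 = 2) : ∃ e : S lam m (m 1) ≃ Unit × lineGen m (m 1),
      (∀ x : S lam m (m 1), (x : HiggsPair lam m).field = stdNilp (e x).2) ∧ ActsOnFactor e := by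
  have hm' : m 1 < m 0 := by omega
  have hj : 2 + 2 * m 1 - m 0 - m 1 = 0 := by omega
  have hstd : ∀ {s : Fin 2 → Poly} {w : ℂ}, s 1 = C w → w ≠ 0 → stdNilp s = nilMat (C w⁻¹) s :=
    fun hs hw => by simpa using smul_stdNilp hs hw 1
  have hinj : ∀ {s s' : Fin 2 → Poly}, stdNilp s = stdNilp s' → s = s' := fun h =>
    stdNilp_injective one_ne_zero (by rw [h])
  have hright : ∀ x : S lam m (m 1), ∃! b : Unit × lineGen m (m 1),
      (x : HiggsPair lam m).field = stdNilp b.2 := by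
    intro x
    obtain ⟨s, hs, k, hk, hΦ, -⟩ := exists_constant_scale h0 h1 hj x.2
    obtain ⟨w, hw, hs1⟩ := lineGen_second hm' hs
    have hx : (x : HiggsPair lam m).field = stdNilp ((k * w) • s) := by
      rw [hΦ]
      simpa using nilMat_eq_smul_stdNilp hs1 hw hk 1
    refine ⟨((), ⟨_, smul_mem_lineGen hs (mul_ne_zero hk hw)⟩), hx, fun b hb => ?_⟩
    exact Prod.ext rfl (Subtype.ext (hinj (hb.symm.trans hx)))
  have hleft : ∀ b : Unit × lineGen m (m 1), ∃! x : S lam m (m 1),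
      (x : HiggsPair lam m).field = stdNilp b.2 := by
    rintro ⟨⟨⟩, s, hs⟩
    obtain ⟨w, hw, hs1⟩ := lineGen_second hm' hs
    obtain ⟨F, hF⟩ := exists_flag_meets lam hs
    refine ⟨⟨⟨F, stdNilp s⟩, ?_⟩, rfl, ?_⟩
    · rw [hstd hs1 hw]
      exact mem_S_of_constant_scale h0 h1 hj hs (inv_ne_zero hw) hF
    · rintro ⟨⟨F', Φ⟩, hx⟩ (rfl : Φ = stdNilp s)
      have hx' := hx.1
      rw [hstd hs1 hw, nilMat_mem_QPHnil_iff h0 h1 (by rw [hj]; exact C_mem_forms _) hs] at hx'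
      have hF' : F' = F := flag_eq_of_meets hs
        (fun i => (hx' i).resolve_left (by simpa using hw)) hF
      subst hF'
      rfl
  obtain ⟨e, he⟩ := exists_equiv_of_existsUnique _ hright hleft
  refine ⟨e, he, actsOnFactor_of_stdAct h0 h1 hm' e fun g x y hxy => ⟨rfl, ?_⟩⟩
  have h2 := smul_field_stdNilp hm' g (x := x) (f := 1) (e x).2.2 (by rw [one_smul]; exact he x)
  rw [← hxy, he y, one_smul] at h2
  exact hinj h2

/-! ### The nodal curve and the case of difference one -/

/-- The linear map `[f₀ : f₁] ↦ [w f₀ - u f₁ : f₁]` on the fibre over `z`, for `s = (u, w)`. -/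
def shear (s : Fin 2 → Poly) (z v : Fin 2 → ℂ) : Fin 2 → ℂ :=
  ![eval z (s 1) * v 0 - eval z (s 0) * v 1, v 1]

theorem shear_smul (s : Fin 2 → Poly) (z v : Fin 2 → ℂ) (c : ℂ) :
    shear s z (c • v) = c • shear s z v := by
  ext a; fin_cases a <;> simp [shear]; ring

theorem wedge_shear (s : Fin 2 → Poly) (z v v' : Fin 2 → ℂ) :
    wedge (shear s z v) (shear s z v') = eval z (s 1) * wedge v v' := by
  simp [shear, wedge]; ring

theorem shear_ne_zero {s : Fin 2 → Poly} {z v : Fin 2 → ℂ} (hs : eval z (s 1) ≠ 0) (hv : v ≠ 0) :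
    shear s z v ≠ 0 := by
  intro h
  have h1 : v 1 = 0 := congrFun h 1
  have h0 := congrFun h 0
  simp only [shear, Matrix.cons_val_zero, h1, mul_zero, sub_zero, Pi.zero_apply, mul_eq_zero] at h0
  exact hv (by ext a; fin_cases a; exacts [h0.resolve_left hs, h1])

theorem exists_shear_eq {s : Fin 2 → Poly} {z : Fin 2 → ℂ} (hs : eval z (s 1) ≠ 0)
    (y : Fin 2 → ℂ) : ∃ v, shear s z v = y := by
  refine ⟨![(y 0 + eval z (s 0) * y 1) / eval z (s 1), y 1], ?_⟩
  ext a; fin_cases a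
  · simp only [shear, Matrix.cons_val_zero, Matrix.cons_val_one, Fin.zero_eta]
    field_simp
    ring
  · simp [shear]

/-- The flag `F` corresponds to the point `ξ` of the exceptional curve. -/
def ShearsTo (s : Fin 2 → Poly) (z : Fin 2 → ℂ) (F ξ : P1) : Prop :=
  ∀ v ∈ F.submodule, shear s z v ∈ ξ.submodule

theorem shearsTo_of_mem {s : Fin 2 → Poly} {z : Fin 2 → ℂ} {F ξ : P1} {v : Fin 2 → ℂ} (hv : v ≠ 0)
    (hF : v ∈ F.submodule) (hξ : shear s z v ∈ ξ.submodule) : ShearsTo s z F ξ := by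
  intro v' hv'
  rw [mem_submodule_iff hF hv] at hv'
  obtain ⟨c, rfl⟩ := exists_smul_of_wedge hv hv'
  rw [shear_smul]
  exact Submodule.smul_mem _ _ hξ

theorem existsUnique_shearsTo_right {s : Fin 2 → Poly} {z : Fin 2 → ℂ} (hs : eval z (s 1) ≠ 0)
    (F : P1) : ∃! ξ, ShearsTo s z F ξ := by
  have hne := shear_ne_zero hs F.rep_nonzero
  refine ⟨Projectivization.mk ℂ _ hne, shearsTo_of_mem F.rep_nonzero (rep_mem F)
    ((mem_mk_iff hne _).2 (wedge_self _)), fun ξ hξ => ?_⟩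
  exact (mk_eq_of_mem hne (hξ _ (rep_mem F))).symm

theorem existsUnique_shearsTo_left {s : Fin 2 → Poly} {z : Fin 2 → ℂ} (hs : eval z (s 1) ≠ 0)
    (ξ : P1) : ∃! F, ShearsTo s z F ξ := by
  obtain ⟨v, hv⟩ := exists_shear_eq hs ξ.rep
  have hv0 : v ≠ 0 := by
    rintro rfl
    apply ξ.rep_nonzero
    rw [← hv]
    ext a; fin_cases a <;> simp [shear]
  refine ⟨Projectivization.mk ℂ v hv0, shearsTo_of_mem hv0 ((mem_mk_iff hv0 _).2 (wedge_self _))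
    (by rw [hv]; exact rep_mem ξ), fun F hF => ?_⟩
  have h := hF _ (rep_mem F)
  rw [mem_submodule_iff (rep_mem ξ) ξ.rep_nonzero, ← hv, wedge_shear, mul_eq_zero] at h
  refine (mk_eq_of_mem hv0 ((mem_submodule_iff (rep_mem F) F.rep_nonzero v).2 ?_)).symm
  rw [wedge_comm, h.resolve_left hs, neg_zero]

/-- The shear sends $(u,w)$ to $(0,w)$ and is injective on lines, so the node corresponds to the
flag cut out by the kernel. -/
theorem shearsTo_node_iff {lam : ℂ} {s : Fin 2 → Poly} {i : Fin 4}
    (hs : eval (marked lam i) (s 1) ≠ 0) {F : QP} {ξ : P1}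
    (h : ShearsTo s (marked lam i) (F i) ξ) : ξ = node ↔ Meets lam F s i := by
  set v : Fin 2 → ℂ := fun a => eval (marked lam i) (s a) with hv
  have hv0 : v ≠ 0 := fun e => hs (congrFun e 1)
  have hsh : shear s (marked lam i) v = v 1 • ![0, 1] := by
    ext a; fin_cases a
    · simp [shear, hv]; ring
    · simp [shear]
  have hnode : shear s (marked lam i) v ∈ node.submodule := by
    rw [hsh]
    exact Submodule.smul_mem _ _ ((mem_mk_iff _ _).2 (wedge_self _))
  constructor
  · rintro rfl
    obtain ⟨F', -, huniq⟩ := existsUnique_shearsTo_left hs node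
    have hF' := huniq _ (shearsTo_of_mem hv0 ((mem_mk_iff hv0 v).2 (wedge_self _)) hnode)
    change v ∈ (F i).submodule
    rw [huniq _ h, ← hF']
    exact (mem_mk_iff hv0 v).2 (wedge_self _)
  · intro hm
    exact P1_eq_of_mem (shear_ne_zero hs hv0) (h v hm) hnode

/-- The corner terms cancel in $w'f_0'-u'f_1'$ and the factor $c$ comes out of both coordinates.
Hence the coordinates $\xi_i$ are invariant under automorphisms. -/
theorem shear_stdAct {m : Fin 2 → ℤ} (hm : m 1 < m 0) {s : Fin 2 → Poly}
    (hs : s ∈ lineGen m (m 1)) (g : AutE m) :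
    ∃ c : ℂ, ∀ z v : Fin 2 → ℂ, shear (stdAct g s) z ((autEval g z).mulVec v) = c • shear s z v := by
  obtain ⟨a, c, ha, hc, e00, e10, e11⟩ := exists_autMat_of_lt hm g
  obtain ⟨w, hw, hs1⟩ := lineGen_second hm hs
  refine ⟨c, fun z v => ?_⟩
  have e00' : autEval g z 0 0 = a := by rw [autEval, Matrix.map_apply, e00, eval_C]
  have e10' : autEval g z 1 0 = 0 := by rw [autEval, Matrix.map_apply, e10, map_zero]
  have e11' : autEval g z 1 1 = c := by rw [autEval, Matrix.map_apply, e11, eval_C]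
  have e01' : autEval g z 0 1 = eval z (autMat g 0 1) := rfl
  have t0 := stdAct_zero ha e00 hs1
  have t1 := stdAct_one e00 e10 e11 hs1
  ext k; fin_cases k
  · simp only [shear, t0, t1, hs1, Matrix.mulVec, dotProduct, Fin.sum_univ_two, e00', e01', e10',
      e11', Fin.zero_eta, Matrix.cons_val_zero, eval_C, map_add, map_mul, Pi.smul_apply,
      smul_eq_mul]
    field_simp
    ring
  · simp [shear, Matrix.mulVec, dotProduct, Fin.sum_univ_two, e10', e11']

theorem exists_smul_linForm {q : Poly} (hq : q ∈ forms 1) (hq0 : q ≠ 0) {r : P1 → Fin 2 → ℂ}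
    (hr : ∀ z, r z ≠ 0 ∧ r z ∈ z.submodule) :
    ∃ z : P1, ∃ k : ℂ, k ≠ 0 ∧ q = C k * linForm (r z) := by
  -- The zero of `q`, read off from its two coefficients.
  set v : Fin 2 → ℂ := ![eval ![0, 1] q, -eval ![1, 0] q] with hv
  have hqv : q = linForm v := by
    rw [forms_one_eq hq, linForm]
    simp [hv]
    ring
  have hv0 : v ≠ 0 := by
    intro h
    rw [h] at hqv
    exact hq0 (by rw [hqv]; simp [linForm])
  refine ⟨Projectivization.mk ℂ v hv0, ?_⟩
  obtain ⟨h1, h2⟩ := hr (Projectivization.mk ℂ v hv0)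
  rw [mem_mk_iff] at h2
  rw [wedge_comm, neg_eq_zero] at h2
  obtain ⟨c, hc⟩ := exists_smul_of_wedge h1 h2
  refine ⟨c, ?_, ?_⟩
  · rintro rfl
    rw [zero_smul] at hc
    exact hv0 hc
  · rw [hqv]
    conv_lhs => rw [hc]
    simp only [linForm, Pi.smul_apply, smul_eq_mul, C_mul]
    ring

theorem linForm_rep_eq_zero_iff {r : P1 → Fin 2 → ℂ} (hr : ∀ z, r z ≠ 0 ∧ r z ∈ z.submodule)
    (z : P1) (v : Fin 2 → ℂ) : eval v (linForm (r z)) = 0 ↔ v ∈ z.submodule := by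
  rw [eval_linForm, mem_submodule_iff (hr z).2 (hr z).1, wedge_comm, neg_eq_zero]

/-- The lower left entry is a nonzero constant times the linear form, so its zero recovers the
point; the form can then be cancelled. -/
theorem linForm_stdNilp_injective {m : Fin 2 → ℤ} (hm : m 1 < m 0) {r : P1 → Fin 2 → ℂ}
    (hr : ∀ z, r z ≠ 0 ∧ r z ∈ z.submodule) {z z' : P1} {s s' : Fin 2 → Poly}
    (hs : s ∈ lineGen m (m 1)) (hs' : s' ∈ lineGen m (m 1))
    (h : linForm (r z) • stdNilp s = linForm (r z') • stdNilp s') : z = z' ∧ s = s' := by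
  obtain ⟨w, hw, hs1⟩ := lineGen_second hm hs
  obtain ⟨w', hw', hs1'⟩ := lineGen_second hm hs'
  have hz : z = z' := by
    have h10 := congrArg (eval (r z)) (congrFun (congrFun h 1) 0)
    rw [Matrix.smul_apply, Matrix.smul_apply, stdNilp_one_zero, stdNilp_one_zero, hs1, hs1',
      smul_eq_mul, smul_eq_mul, map_mul, map_mul, (linForm_rep_eq_zero_iff hr z _).2 (hr z).2,
      zero_mul, eval_C, eq_comm, mul_eq_zero, linForm_rep_eq_zero_iff hr] at h10
    exact P1_eq_of_mem (hr z).1 (hr z).2 (h10.resolve_right hw')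
  subst hz
  exact ⟨rfl, stdNilp_injective (linForm_ne_zero (hr z).1) h⟩

/-- The relation between the points of `S_{m₂}(E)` and of `Bl × P_{m₂}(E)` for `m₁ - m₂ = 1`. -/
def Corresponds {lam : ℂ} {m : Fin 2 → ℤ} (r : P1 → Fin 2 → ℂ) (x : HiggsPair lam m)
    (b : P1 × (Fin 4 → P1)) (s : Fin 2 → Poly) : Prop :=
  x.field = linForm (r b.1) • stdNilp s ∧ ∀ i, ShearsTo s (marked lam i) (x.flag i) (b.2 i)

/-- The scale is linear with zero `z`. Where $z_i\ne z$ the flag must lie on the kernel, which means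
$\xi_i$ is the node; at $z_i=z$ the flag is unconstrained, and so is $\xi_i$. -/
theorem existsUnique_corresponds_right {lam : ℂ} (h0 : lam ≠ 0) (h1 : lam ≠ 1) {m : Fin 2 → ℤ}
    (hm : m 0 - m 1 = 1) {r : P1 → Fin 2 → ℂ} (hr : ∀ z, r z ≠ 0 ∧ r z ∈ z.submodule)
    (x : S lam m (m 1)) :
    ∃! b : Bl lam × lineGen m (m 1), Corresponds r (x : HiggsPair lam m) b.1 b.2 := by
  have hm' : m 1 < m 0 := by omega
  obtain ⟨s, hs, q, hq, hq0, hΦ, hF⟩ := (mem_S_iff h0 h1).1 x.2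
  rw [show 2 + 2 * m 1 - m 0 - m 1 = 1 by omega] at hq
  obtain ⟨z, k, hk, rfl⟩ := exists_smul_linForm hq hq0 hr
  obtain ⟨w, hw, hs1⟩ := lineGen_second hm' hs
  rw [nilMat_eq_smul_stdNilp hs1 hw hk] at hΦ
  have hkw := mul_ne_zero hk hw
  have hs' := smul_mem_lineGen hs hkw
  have hF' : ∀ i, marked lam i ∈ z.submodule ∨ Meets lam (x : HiggsPair lam m).flag ((k * w) • s) i := by
    intro i
    rw [meets_smul hkw, ← linForm_rep_eq_zero_iff hr]
    refine (hF i).imp_left fun h => ?_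
    rw [map_mul, eval_C] at h
    exact (mul_eq_zero.1 h).resolve_left hk
  generalize (k * w) • s = s' at hΦ hs' hF'
  obtain ⟨w', hw', hs1'⟩ := lineGen_second hm' hs'
  have hne : ∀ i, eval (marked lam i) (s' 1) ≠ 0 := fun i => by rwa [hs1', eval_C]
  choose ξ hξ hξu using fun i => existsUnique_shearsTo_right (hne i) ((x : HiggsPair lam m).flag i)
  refine ⟨(⟨(z, ξ), fun i hi => ?_⟩, ⟨s', hs'⟩), ⟨hΦ, hξ⟩, ?_⟩
  · exact (shearsTo_node_iff (hne i) (hξ i)).2 ((hF' i).resolve_left hi)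
  · rintro ⟨⟨⟨z₂, ξ₂⟩, hb⟩, s₂, hs₂⟩ ⟨hΦ₂, hξ₂⟩
    obtain ⟨rfl, rfl⟩ := linForm_stdNilp_injective hm' hr hs₂ hs' (hΦ₂.symm.trans hΦ)
    have : ξ₂ = ξ := funext fun i => hξu i _ (hξ₂ i)
    subst this
    rfl

theorem existsUnique_corresponds_left {lam : ℂ} (h0 : lam ≠ 0) (h1 : lam ≠ 1) {m : Fin 2 → ℤ}
    (hm : m 0 - m 1 = 1) {r : P1 → Fin 2 → ℂ} (hr : ∀ z, r z ≠ 0 ∧ r z ∈ z.submodule)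
    (b : Bl lam × lineGen m (m 1)) :
    ∃! x : S lam m (m 1), Corresponds r (x : HiggsPair lam m) b.1 b.2 := by
  obtain ⟨⟨⟨z, ξ⟩, hb⟩, s, hs⟩ := b
  obtain ⟨w, hw, hs1⟩ := lineGen_second (by omega) hs
  have hne : ∀ i, eval (marked lam i) (s 1) ≠ 0 := fun i => by rwa [hs1, eval_C]
  choose F hF using fun i => (existsUnique_shearsTo_left (hne i) (ξ i)).exists
  refine ⟨⟨⟨F, linForm (r z) • stdNilp s⟩, ?_⟩, ⟨rfl, hF⟩, ?_⟩
  · refine (mem_S_iff h0 h1).2 ⟨s, hs, C w⁻¹ * linForm (r z), ?_, ?_, smul_stdNilp hs1 hw _, ?_⟩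
    · have h := mul_mem_forms (C_mem_forms w⁻¹) (linForm_mem_forms (r z))
      rwa [show (0 : ℤ) + 1 = 2 + 2 * m 1 - m 0 - m 1 by omega] at h
    · have hw0 : (C w⁻¹ : Poly) ≠ 0 := by simpa using hw
      exact mul_ne_zero hw0 (linForm_ne_zero (hr z).1)
    · intro i
      by_cases hi : marked lam i ∈ z.submodule
      · left
        rw [map_mul, (linForm_rep_eq_zero_iff hr z _).2 hi, mul_zero]
      · right
        exact (shearsTo_node_iff (hne i) (hF i)).1 (hb i hi)
  · rintro ⟨⟨F₂, Φ₂⟩, hx⟩ ⟨hΦ₂, hF₂⟩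
    have hF₂' : ∀ i, ShearsTo s (marked lam i) (F₂ i) (ξ i) := hF₂
    have e1 : F₂ = F := funext fun i =>
      (existsUnique_shearsTo_left (hne i) (ξ i)).unique (hF₂' i) (hF i)
    have e2 : Φ₂ = linForm (r z) • stdNilp s := hΦ₂
    subst e1 e2
    rfl

theorem Corresponds.smul {lam : ℂ} {m : Fin 2 → ℤ} (hm : m 1 < m 0) {r : P1 → Fin 2 → ℂ}
    {x : HiggsPair lam m} {b : P1 × (Fin 4 → P1)} {s : Fin 2 → Poly} (hs : s ∈ lineGen m (m 1))
    (h : Corresponds r x b s) (g : AutE m) : Corresponds r (g • x) b (stdAct g s) := by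
  refine ⟨smul_field_stdNilp hm g hs h.1, fun i v hv => ?_⟩
  have e : v = (autEval g (marked lam i)).mulVec ((autEval g⁻¹ (marked lam i)).mulVec v) := by
    rw [Matrix.mulVec_mulVec, autEval_mul_inv, Matrix.one_mulVec]
  obtain ⟨c, hc⟩ := shear_stdAct hm hs g
  rw [e, mulVec_mem_smul_flag_iff] at hv
  rw [e, hc]
  exact Submodule.smul_mem _ _ (h.2 i _ hv)

theorem decomposition_one {lam : ℂ} (h0 : lam ≠ 0) (h1 : lam ≠ 1) {m : Fin 2 → ℤ}
    (hm : m 0 - m 1 = 1) {r : P1 → Fin 2 → ℂ} (hr : ∀ z, r z ≠ 0 ∧ r z ∈ z.submodule) :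
    ∃ e : S lam m (m 1) ≃ Bl lam × lineGen m (m 1),
      (∀ x : S lam m (m 1), Corresponds r (x : HiggsPair lam m) (e x).1 (e x).2) ∧
        ActsOnFactor e := by
  have hm' : m 1 < m 0 := by omega
  obtain ⟨e, he⟩ := exists_equiv_of_existsUnique
    (fun (x : S lam m (m 1)) (b : Bl lam × lineGen m (m 1)) =>
      Corresponds r (x : HiggsPair lam m) b.1 b.2)
    (existsUnique_corresponds_right h0 h1 hm hr) (existsUnique_corresponds_left h0 h1 hm hr)
  have : Nonempty (Bl lam) := ⟨⟨(node, fun _ => node), fun _ _ => rfl⟩⟩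
  refine ⟨e, he, actsOnFactor_of_stdAct h0 h1 hm' e fun g x y hxy => ?_⟩
  have h2 := (he x).smul hm' (e x).2.2 g
  rw [← hxy] at h2
  -- The translated data also correspond to `y`, so uniqueness identifies them with its image under
  -- `e`.
  have h3 := (existsUnique_corresponds_right h0 h1 hm hr y).unique (he y)
    (y₂ := ((e x).1, ⟨stdAct g (e x).2, stdAct_mem hm' g (e x).2.2⟩)) h2
  rw [h3]
  exact ⟨rfl, rfl⟩

end QPHiggs

end

/-! ### The proposition -/

theorem mainTheorem6 (lam : ℂ) (h0 : lam ≠ 0) (h1 : lam ≠ 1)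
    (m : Fin 2 → ℤ) (hm : m 1 ≤ m 0) :
    -- (i) classification of the conditionally stable strata
    ((m 0 - m 1 ≤ 2 →
        QPHiggs.condStable (QPHiggs.Q lam m) = QPHiggs.iota lam m '' QPHiggs.U lam m) ∧
      (3 ≤ m 0 - m 1 → QPHiggs.condStable (QPHiggs.Q lam m) = ∅) ∧
      (m 1 < m 0 →
        QPHiggs.condStable (QPHiggs.R lam m) =
            ⋃ I ∈ {I : Finset (Fin 4) | (I.card : ℤ) ≤ 3 - m 0 + m 1}, QPHiggs.RI lam m I ∧
          Pairwise fun I I' => Disjoint (QPHiggs.RI lam m I) (QPHiggs.RI lam m I')) ∧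
      (m 0 = m 1 →
        QPHiggs.condStable (QPHiggs.S lam m (m 1)) =
            ⋃ I ∈ {I : Finset (Fin 4) | I.card = 2 ∨ I.card = 3}, QPHiggs.SI lam m I (m 1) ∧
          Pairwise fun I I' =>
            Disjoint (QPHiggs.SI lam m I (m 1)) (QPHiggs.SI lam m I' (m 1))) ∧
      (∀ j : ℤ, j ≤ m 1 → ¬ (m 0 = m 1 ∧ j = m 1) →
        QPHiggs.condStable (QPHiggs.S lam m j) = QPHiggs.S lam m j)) ∧
    -- (ii) points of the zero section that are stable for every interior chamber
    {x ∈ QPHiggs.condStable (QPHiggs.Q lam m) |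
        ∀ C, QPHiggs.IsInteriorChamber (m 0 + m 1) C → QPHiggs.StableOn C x} =
      QPHiggs.iota lam m '' QPHiggs.U' lam m ∧
    -- (iii) freeness and transitivity of the action
    (m 1 < m 0 →
      QPHiggs.ActsFreelyOn (QPHiggs.PAut m) (QPHiggs.condStable (QPHiggs.R lam m))) ∧
    (m 0 = m 1 →
      QPHiggs.ActsFreelyOn (QPHiggs.PAut m) (QPHiggs.condStable (QPHiggs.S lam m (m 1))) ∧
      QPHiggs.ActsFreelyTransitivelyOn (QPHiggs.PAut m × ℂˣ)
        (QPHiggs.condStable (QPHiggs.S lam m (m 1 - 1)))) ∧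
    (m 0 - m 1 = 2 →
      ∃ e : QPHiggs.S lam m (m 1) ≃ Unit × QPHiggs.lineGen m (m 1),
        (∀ x : QPHiggs.S lam m (m 1),
          (x : QPHiggs.HiggsPair lam m).field = QPHiggs.stdNilp (e x).2) ∧
        QPHiggs.ActsOnFactor e) ∧
    (m 0 - m 1 = 1 →
      ∀ r : QPHiggs.P1 → Fin 2 → ℂ, (∀ z, r z ≠ 0 ∧ r z ∈ z.submodule) →
      ∃ e : QPHiggs.S lam m (m 1) ≃ QPHiggs.Bl lam × QPHiggs.lineGen m (m 1),
        (∀ x : QPHiggs.S lam m (m 1),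
          (x : QPHiggs.HiggsPair lam m).field =
            QPHiggs.linForm (r (e x).1.1.1) • QPHiggs.stdNilp (e x).2 ∧
          ∀ i, ∀ v ∈ ((x : QPHiggs.HiggsPair lam m).flag i).submodule,
            ![MvPolynomial.eval (QPHiggs.marked lam i) ((e x).2.1 1) * v 0 -
                MvPolynomial.eval (QPHiggs.marked lam i) ((e x).2.1 0) * v 1, v 1] ∈
              ((e x).1.1.2 i).submodule) ∧
        QPHiggs.ActsOnFactor e) := by
  refine ⟨⟨fun _ => QPHiggs.condStable_Q h0 h1 hm, fun h => ?_, fun h =>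
    ⟨QPHiggs.condStable_R h0 h1 h, QPHiggs.disjoint_RI lam h⟩, fun h =>
    ⟨QPHiggs.condStable_S_top h0 h1 h, QPHiggs.disjoint_SI h0 h1 m (m 1)⟩, fun j hj hne => ?_⟩,
    QPHiggs.stable_for_interior_chambers hm,
    fun h => QPHiggs.actsFreelyOn_condStable_R h0 h1 h, fun h =>
    ⟨QPHiggs.actsFreelyOn_condStable_S_top h0 h1 h, ?_⟩,
    fun h => QPHiggs.decomposition_two h0 h1 h, fun h r hr => ?_⟩
  · rw [QPHiggs.condStable_Q h0 h1 hm, QPHiggs.U_eq_empty h0 h1 h, Set.image_empty]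
  · exact QPHiggs.condStable_S h0 h1 (by omega)
  · rw [QPHiggs.condStable_S h0 h1 (by omega)]
    exact QPHiggs.actsFreelyTransitivelyOn_S h0 h1 h
  · exact QPHiggs.decomposition_one h0 h1 h hr
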